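/- Let $P$ be a simple polygon in the plane (a closed region, with boundary curve $\partial P$). A chord of $P$ is a nondegenerate line segment contained in $P$ with both endpoints on $\partial P$. The endpoints of a chord $K$ split $\partial P$ into two chains; the two open half-polygons of $K$ consist of the points of $P\setminus K$ that can be joined within $P\setminus K$ to the first, respectively to the second, of these chains, and a half-polygon of $K$ is an open half-polygon together with $K$. A chord crosses a set $X$ if both of its open half-polygons contain points of $X$. A set $Q\subseteq P$ is geodesically convex if it contains the shortest path in $P$ between any two of its points, and the geodesic convex hull of a subset of $P$ is the smallest geodesically convex set containing it. An anchor is a point of $P$ or a subchain of $\partial P$. A $k$-anchor hull is the geodesic convex hull of the union of at most $k$ anchors, and a $k$-cell is the intersection of at most $k$ half-polygons (of possibly different chords) of $P$. Let $\mathcal K$ be any set of chords of $P$. The $k$-anchor range space (respectively the $k$-cell range space) on $\mathcal K$ has ground set $\mathcal K$, and its ranges are the sets $\{K\in\mathcal K : K \text{ crosses } H\}$, where $H$ runs over all $k$-anchor hulls (respectively all $k$-cells) of $P$. The VC-dimension of a range space is the maximum size of a subset $A$ of its ground set that is shattered, i.e. such that every subset of $A$ is the intersection of $A$ with a range. Then: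 1. the $3$-anchor range space on $\mathcal K$ has VC-dimension less than $259$; 2. the $4$-anchor range space on $\mathcal K$ has VC-dimension at most $372$; 3. the $4$-cell range space on $\mathcal K$ has VC-dimension at most $372$. -/

import Mathlib

noncomputable section

/-! ### Range spaces and VC-dimension -/

/-- A range space: a ground set together with a set of subsets of it, the ranges. -/
structure RangeSpace (α : Type*) where
  /-- The ground set. -/
  ground : Set α
  /-- The ranges. -/
  ranges : Set (Set α)
  subset_ground : ∀ R ∈ ranges, R ⊆ ground

namespace RangeSpace

variable {α : Type*}

/-- `A` is shattered if the restriction of the ranges to `A` is the whole power set of `A`. -/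
def Shatters (S : RangeSpace α) (A : Set α) : Prop :=
  A ⊆ S.ground ∧ {B | ∃ R ∈ S.ranges, B = A ∩ R} = 𝒫 A

/-- The VC-dimension: the largest size of a shattered set, `⊤` if there is no largest one. -/
def vcDim (S : RangeSpace α) : ℕ∞ :=
  ⨆ A ∈ {A | S.Shatters A}, A.encard

end RangeSpace

/-! ### Simple polygons -/

/-- The Euclidean plane. -/
abbrev Plane : Type := EuclideanSpace ℝ (Fin 2)

namespace Polygon

variable {n : ℕ}

/-- The closed polygonal curve through the vertices is simple: at least three vertices, the edges
are nondegenerate, consecutive edges meet only in their common vertex, and edges that are not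
consecutive are disjoint. -/
structure IsSimple (P : Polygon Plane n) : Prop where
  three_le : 3 ≤ n
  nondegenerate : P.HasNondegenerateEdges
  consecutive : ∀ i, P.edgeSet ℝ i ∩ P.edgeSet ℝ (finRotate n i) = {P (finRotate n i)}
  disjoint : ∀ i j, i ≠ j → j ≠ finRotate n i → i ≠ finRotate n j →
    Disjoint (P.edgeSet ℝ i) (P.edgeSet ℝ j)

/-- The closed polygon: its boundary curve together with the points that the curve encloses, i.e.
those whose connected component in the complement of the curve is bounded. -/
def region (P : Polygon Plane n) : Set Plane :=
  P.boundary ℝ ∪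
    {x | x ∉ P.boundary ℝ ∧ Bornology.IsBounded (connectedComponentIn (P.boundary ℝ)ᶜ x)}

/-- The `n`-periodic parametrization of the boundary curve that runs along the `i`-th edge, at
constant speed, while the parameter runs from `i` to `i + 1`. -/
def boundaryPoint [NeZero n] (P : Polygon Plane n) (t : ℝ) : Plane :=
  P.edgePath ℝ ((finRotate n ^ ⌊t⌋) 0) (Int.fract t)

/-! ### Geodesics and geodesic convexity -/

/-- `γ` is a shortest path of the polygon: it lies in the closed polygon, and no path in the closed
polygon with the same ends is shorter. The length of a path is its total variation. -/
def IsGeodesic (P : Polygon Plane n) {x y : Plane} (γ : Path x y) : Prop :=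
  Set.range γ ⊆ P.region ∧
    ∀ γ' : Path x y, Set.range γ' ⊆ P.region →
      eVariationOn γ Set.univ ≤ eVariationOn γ' Set.univ

/-- `Q` is a geodesically convex subset of the polygon: the geodesic between any two points of `Q`
is contained in `Q`. -/
def GeodesicallyConvex (P : Polygon Plane n) (Q : Set Plane) : Prop :=
  Q ⊆ P.region ∧
    ∀ x ∈ Q, ∀ y ∈ Q, ∀ γ : Path x y, P.IsGeodesic γ → Set.range γ ⊆ Q

/-- The geodesic convex hull of `S`: the smallest geodesically convex subset of the polygon that
contains `S`. -/
def geodesicHull (P : Polygon Plane n) (S : Set Plane) : Set Plane :=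
  ⋂₀ {Q | S ⊆ Q ∧ P.GeodesicallyConvex Q}

/-! ### Anchors and anchor hulls -/

/-- `C` is a subchain of the polygon boundary (possibly a single point or the whole boundary). -/
def IsSubchain [NeZero n] (P : Polygon Plane n) (C : Set Plane) : Prop :=
  ∃ s t : ℝ, s ≤ t ∧ C = P.boundaryPoint '' Set.Icc s t

/-- An anchor is a point of the polygon or a subchain of its boundary. -/
def IsAnchor [NeZero n] (P : Polygon Plane n) (A : Set Plane) : Prop :=
  (∃ p ∈ P.region, A = {p}) ∨ P.IsSubchain A

/-- A `k`-anchor hull is the geodesic convex hull of (the union of) at most `k` anchors. -/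
def IsAnchorHull [NeZero n] (P : Polygon Plane n) (k : ℕ) (H : Set Plane) : Prop :=
  ∃ j ≤ k, ∃ A : Fin j → Set Plane, (∀ i, P.IsAnchor (A i)) ∧ H = P.geodesicHull (⋃ i, A i)

/-! ### Chords, half-polygons and crossing -/

/-- `K` is a chord: a line segment in the closed polygon with both endpoints on the boundary. -/
def IsChord (P : Polygon Plane n) (K : Set Plane) : Prop :=
  ∃ a ∈ P.boundary ℝ, ∃ b ∈ P.boundary ℝ, a ≠ b ∧ K = segment ℝ a b ∧ K ⊆ P.region

/-- The segment between the boundary points with parameters `s` and `t`. -/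
def boundarySegment [NeZero n] (P : Polygon Plane n) (s t : ℝ) : Set Plane :=
  segment ℝ (P.boundaryPoint s) (P.boundaryPoint t)

/-- For `s < t < s + n` such that `K = P.boundarySegment s t` is a chord, the endpoints of `K` split
the boundary into two chains; this is the open half-polygon on the side of the chain with parameters
between `s` and `t`: all points of the polygon off `K` that can be joined to that chain by a path in
the polygon that avoids `K`. (If `K` touches the boundary between its endpoints, then the polygon
minus `K` can have more than two components, and several of them make up one half-polygon.)
The half-polygon on the other side of `K` is `P.openHalfPolygon t (s + n)`. -/
def openHalfPolygon [NeZero n] (P : Polygon Plane n) (s t : ℝ) : Set Plane :=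
  {x | ∃ y ∈ P.boundaryPoint '' Set.Ioo s t, JoinedIn (P.region \ P.boundarySegment s t) x y}

/-- `H` is a closed half-polygon: an open half-polygon of some chord, together with that chord. -/
def IsHalfPolygon [NeZero n] (P : Polygon Plane n) (H : Set Plane) : Prop :=
  ∃ s t : ℝ, s < t ∧ t < s + n ∧ P.boundarySegment s t ⊆ P.region ∧
    H = P.openHalfPolygon s t ∪ P.boundarySegment s t

/-- The chord `K` crosses the set `X`: both open half-polygons of `K` contain points of `X`. -/
def Crosses [NeZero n] (P : Polygon Plane n) (K X : Set Plane) : Prop :=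
  ∃ s t : ℝ, s < t ∧ t < s + n ∧ K = P.boundarySegment s t ∧
    (P.openHalfPolygon s t ∩ X).Nonempty ∧ (P.openHalfPolygon t (s + n) ∩ X).Nonempty

/-- A `k`-cell is the intersection of at most `k` half-polygons (the polygon itself for none). -/
def IsCell [NeZero n] (P : Polygon Plane n) (k : ℕ) (Q : Set Plane) : Prop :=
  ∃ j ≤ k, ∃ H : Fin j → Set Plane, (∀ i, P.IsHalfPolygon (H i)) ∧ Q = P.region ∩ ⋂ i, H i

/-! ### The range spaces -/

/-- The range space with ground set `𝒦` that has, for each set `X` with the property `F`, the range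
of all members of `𝒦` that cross `X`. -/
def crossingRangeSpace [NeZero n] (P : Polygon Plane n) (𝒦 : Set (Set Plane))
    (F : Set Plane → Prop) : RangeSpace (Set Plane) where
  ground := 𝒦
  ranges := {R | ∃ X, F X ∧ R = {K ∈ 𝒦 | P.Crosses K X}}
  subset_ground := by
    rintro R ⟨X, -, rfl⟩
    exact Set.sep_subset _ _

/-- The `k`-anchor range space on a set `𝒦` of chords: the ranges are the sets of chords of `𝒦` that
cross a `k`-anchor hull. -/
def anchorRangeSpace [NeZero n] (P : Polygon Plane n) (k : ℕ) (𝒦 : Set (Set Plane)) :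
    RangeSpace (Set Plane) :=
  P.crossingRangeSpace 𝒦 (P.IsAnchorHull k)

/-- The `k`-cell range space on a set `𝒦` of chords: the ranges are the sets of chords of `𝒦` that
cross a `k`-cell. -/
def cellRangeSpace [NeZero n] (P : Polygon Plane n) (k : ℕ) (𝒦 : Set (Set Plane)) :
    RangeSpace (Set Plane) :=
  P.crossingRangeSpace 𝒦 (P.IsCell k)

end Polygon

end

/-! Fix `m` chords and record for a set `X` its type `sideType`: which of the `2m` open
half-polygons it meets. A chord crosses `X` iff both of its half-polygons occur in the type, so a
shattered family of `m` chords forces at least `2 ^ m` types of ranges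
(`IsSimple.encard_lt_of_shatters`). It remains to bound the number of types by a polynomial in `m`.

Points have quadratically many types (`IsSimple.ncard_pointTypes_le`). Along a chord, the complement
of each half-polygon is an interval, so linearly many types occur there. A point off all chords is
moved along a generic ray up to the boundary or to a first chord; in the latter case the chord, its
side and the type of the hit point determine the type. A subchain is either cut at a chord endpoint
into two members of nested families, or contains no chord endpoint and has the type of one parameter
or of two points (`IsSimple.chainTypes_subset`).

The complement of an open half-polygon is geodesically convex, because a path that enters and leaves
it is shortened along the chord (`geodesicallyConvex_diff`). So a hull has the type of the union of
its anchors. A half-polygon that meets a cell already meets one of at most `k` boundary arcs or `k`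
pieces of bounding chords of the cell (`IsSimple.sideType_cellOf`). The resulting polynomials are
crude, but well below `2 ^ 259` and `2 ^ 373`.

All this needs a piece of the Jordan curve theorem: the two half-polygons of a chord are disjoint
and lie locally on different sides of it. Winding numbers, written as sums of viewing angles,
provide it. The boundary winds once, in a fixed direction, around all inner points
(`IsSimple.exists_orientation`); this winding is the sum of those of the two closed curves into
which a chord divides the boundary (`sideAngle_add`); and a point of one half-polygon is not
encircled by the curve around the other (`IsSimple.sideAngle_of_mem_openHalfPolygon`). -/

noncomputable section

open Set Filter Topology

namespace Polygon

variable {n : ℕ}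

/-! ### The boundary parametrization -/

section BoundaryPoint

variable [NeZero n] (P : Polygon Plane n)

/-- The index of the vertex with parameter `z`. -/
def vertexIndex (n : ℕ) [NeZero n] (z : ℤ) : Fin n := (finRotate n ^ z) 0

lemma vertexIndex_succ (z : ℤ) : vertexIndex n (z + 1) = finRotate n (vertexIndex n z) := by
  rw [vertexIndex, add_comm, zpow_add, zpow_one, Equiv.Perm.mul_apply]; rfl

lemma finRotate_val (i : Fin n) : ((finRotate n i : Fin n) : ℕ) = (i + 1) % n := by
  obtain ⟨m, rfl⟩ := Nat.exists_eq_succ_of_ne_zero (NeZero.ne n)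
  rw [finRotate_apply, Fin.val_add]
  simp

lemma finRotate_pow_val (i : Fin n) (k : ℕ) :
    (((finRotate n ^ k) i : Fin n) : ℕ) = (i + k) % n := by
  induction k with
  | zero => simp [Nat.mod_eq_of_lt i.2]
  | succ k ih =>
    rw [pow_succ', Equiv.Perm.mul_apply, finRotate_val, ih, Nat.mod_add_mod, add_assoc]

lemma finRotate_pow_self : finRotate n ^ n = 1 := by
  ext i
  rw [finRotate_pow_val]
  simp [Nat.mod_eq_of_lt i.2]

lemma vertexIndex_val (z : ℤ) : ((vertexIndex n z : Fin n) : ℤ) = z % n := by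
  have hn : (n : ℤ) ≠ 0 := by exact_mod_cast NeZero.ne n
  have h1 : vertexIndex n z = vertexIndex n (z % n) := by
    conv_lhs => rw [← Int.emod_add_mul_ediv z n]
    rw [vertexIndex, zpow_add, zpow_mul, zpow_natCast, finRotate_pow_self, one_zpow, mul_one]
    rfl
  obtain ⟨k, hk⟩ := Int.eq_ofNat_of_zero_le (Int.emod_nonneg z hn)
  rw [h1, hk, vertexIndex, zpow_natCast, finRotate_pow_val]
  have : (k : ℤ) < n := by
    rw [← hk]; exact Int.emod_lt_of_pos _ (by have := NeZero.pos n; omega)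
  have h0 : ((0 : Fin n) : ℕ) = 0 := by simp
  rw [h0, zero_add, Nat.mod_eq_of_lt (by omega)]

lemma vertexIndex_eq_iff (z w : ℤ) : vertexIndex n z = vertexIndex n w ↔ z % n = w % n := by
  rw [← vertexIndex_val, ← vertexIndex_val]
  simp [Fin.ext_iff]

lemma vertexIndex_fin (i : Fin n) : vertexIndex n i = i := by
  have := vertexIndex_val (n := n) (i : ℤ)
  rw [Int.emod_eq_of_lt (by omega) (by omega)] at this
  exact Fin.ext (by exact_mod_cast this)

lemma boundaryPoint_eq (t : ℝ) :
    P.boundaryPoint t = P.edgePath ℝ (vertexIndex n ⌊t⌋) (Int.fract t) := rfl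

lemma boundaryPoint_intCast (i : ℤ) : P.boundaryPoint i = P (vertexIndex n i) := by
  simp [boundaryPoint_eq, edgePath]

/-- Between consecutive integers the parametrization is affine. -/
lemma boundaryPoint_eq_lineMap (i : ℤ) {t : ℝ} (h0 : (i : ℝ) ≤ t) (h1 : t ≤ i + 1) :
    P.boundaryPoint t =
      AffineMap.lineMap (P.boundaryPoint i) (P.boundaryPoint (i + 1 : ℤ)) (t - i) := by
  rcases h1.lt_or_eq with h | h
  · have hf : ⌊t⌋ = i := Int.floor_eq_iff.2 ⟨h0, h⟩
    rw [boundaryPoint_intCast, boundaryPoint_intCast, vertexIndex_succ, boundaryPoint_eq,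
      edgePath, hf, Int.fract, hf]
  · have : t = ((i + 1 : ℤ) : ℝ) := by push_cast; exact h
    rw [this]
    simp

lemma boundaryPoint_add_period (t : ℝ) : P.boundaryPoint (t + n) = P.boundaryPoint t := by
  rw [boundaryPoint_eq, boundaryPoint_eq, Int.floor_add_natCast, Int.fract_add_natCast]
  congr 2
  rw [vertexIndex_eq_iff]; simp

lemma boundaryPoint_periodic : Function.Periodic P.boundaryPoint n := P.boundaryPoint_add_period

lemma boundaryPoint_add_int_mul (t : ℝ) (z : ℤ) :
    P.boundaryPoint (t + z * n) = P.boundaryPoint t :=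
  P.boundaryPoint_periodic.int_mul z t

lemma continuous_boundaryPoint : Continuous P.boundaryPoint := by
  have hloc : LocallyFinite fun i : ℤ => Icc (i : ℝ) (i + 1) := by
    intro x
    refine ⟨Ioo (x - 1) (x + 1), Ioo_mem_nhds (by linarith) (by linarith), ?_⟩
    refine (Set.finite_Icc (⌊x⌋ - 2) (⌈x⌉ + 2)).subset ?_
    rintro i ⟨y, ⟨h1, h2⟩, h3, h4⟩
    have a1 := Int.lt_floor_add_one x
    have a2 := Int.ceil_lt_add_one x
    have a3 := Int.floor_le x
    have a4 := Int.le_ceil x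
    constructor
    · have : ((⌊x⌋ - 2 : ℤ) : ℝ) ≤ i := by push_cast; linarith
      exact_mod_cast this
    · have : (i : ℝ) ≤ ((⌈x⌉ + 2 : ℤ) : ℝ) := by push_cast; linarith
      exact_mod_cast this
  refine hloc.continuous ?_ (fun i => isClosed_Icc) ?_
  · ext x
    simp only [mem_iUnion, mem_univ, iff_true]
    exact ⟨⌊x⌋, Int.floor_le x, (Int.lt_floor_add_one x).le⟩
  · intro i
    refine ContinuousOn.congr (f := fun t : ℝ => AffineMap.lineMap (P.boundaryPoint i)
      (P.boundaryPoint (i + 1 : ℤ)) (t - i)) ?_ (fun t ht => P.boundaryPoint_eq_lineMap i ht.1 ht.2)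
    simp only [AffineMap.lineMap_apply_module']
    fun_prop

lemma boundary_eq_range : P.boundary ℝ = range P.boundaryPoint := by
  ext x
  simp only [boundary, edgeSet_eq_image_edgePath, mem_iUnion]
  constructor
  · rintro ⟨i, l, hl, rfl⟩
    refine ⟨((i : ℕ) : ℤ) + l, ?_⟩
    rw [P.boundaryPoint_eq_lineMap ((i : ℕ) : ℤ) (by linarith [hl.1]) (by linarith [hl.2]),
      boundaryPoint_intCast, boundaryPoint_intCast, vertexIndex_succ, vertexIndex_fin]
    simp [edgePath]
  · rintro ⟨t, rfl⟩
    exact ⟨vertexIndex n ⌊t⌋, Int.fract t, ⟨Int.fract_nonneg t, (Int.fract_lt_one t).le⟩, rfl⟩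

lemma boundaryPoint_mem (t : ℝ) : P.boundaryPoint t ∈ P.boundary ℝ := by
  rw [boundary_eq_range]; exact mem_range_self t

lemma exists_int_shift_mem_Ico (s t : ℝ) : ∃ z : ℤ, t + z * n ∈ Ico s (s + n) := by
  have hn : (0 : ℝ) < n := by exact_mod_cast NeZero.pos n
  obtain ⟨z, hz, -⟩ := existsUnique_add_zsmul_mem_Ico hn t s
  exact ⟨z, by simpa using hz⟩

lemma exists_boundaryPoint_eq (s : ℝ) {x : Plane} (hx : x ∈ P.boundary ℝ) :
    ∃ t ∈ Ico s (s + n), P.boundaryPoint t = x := by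
  rw [boundary_eq_range] at hx
  obtain ⟨t, rfl⟩ := hx
  obtain ⟨z, hz⟩ := exists_int_shift_mem_Ico (n := n) s t
  exact ⟨_, hz, P.boundaryPoint_add_int_mul t z⟩

lemma boundary_eq_image_Icc (s : ℝ) : P.boundary ℝ = P.boundaryPoint '' Icc s (s + n) := by
  refine Subset.antisymm (fun x hx => ?_) ?_
  · obtain ⟨t, ht, rfl⟩ := P.exists_boundaryPoint_eq s hx
    exact ⟨t, Ico_subset_Icc_self ht, rfl⟩
  · rintro _ ⟨t, -, rfl⟩; exact P.boundaryPoint_mem t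

lemma isCompact_boundary : IsCompact (P.boundary ℝ) := by
  rw [P.boundary_eq_image_Icc 0]
  exact isCompact_Icc.image P.continuous_boundaryPoint

variable {P}

omit [NeZero n] in
lemma IsSimple.lineMap_injective (hP : P.IsSimple) (i : Fin n) :
    Function.Injective (P.edgePath ℝ i) :=
  AffineMap.lineMap_injective ℝ (hP.nondegenerate i)

/-- Consecutive edges share only the vertex that has fractional part `1` on the first of them, a
value that `Int.fract` never takes; other distinct edges are disjoint. So both parameters are on one
edge, where the parametrization is injective. -/
lemma IsSimple.exists_int_of_boundaryPoint_eq (hP : P.IsSimple) {u v : ℝ}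
    (h : P.boundaryPoint u = P.boundaryPoint v) : ∃ z : ℤ, v = u + z * n := by
  have fl : ∀ u : ℝ, Int.fract u ∈ Icc (0 : ℝ) 1 :=
    fun u => ⟨Int.fract_nonneg u, (Int.fract_lt_one u).le⟩
  have key : ∀ u v : ℝ, P.boundaryPoint u = P.boundaryPoint v →
      vertexIndex n ⌊v⌋ ≠ finRotate n (vertexIndex n ⌊u⌋) := by
    intro u v h hc
    have h1 : P.boundaryPoint u ∈ P.edgeSet ℝ (vertexIndex n ⌊u⌋) := ⟨_, fl u, rfl⟩
    have h2 : P.boundaryPoint u ∈ P.edgeSet ℝ (vertexIndex n ⌊v⌋) := ⟨_, fl v, h.symm⟩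
    rw [hc] at h2
    have h3 := hP.consecutive (vertexIndex n ⌊u⌋) ▸ mem_inter h1 h2
    have h4 : P.edgePath ℝ (vertexIndex n ⌊u⌋) (Int.fract u) =
        P.edgePath ℝ (vertexIndex n ⌊u⌋) 1 := by
      rw [mem_singleton_iff] at h3
      rw [← boundaryPoint_eq, h3]; simp [edgePath]
    exact (Int.fract_lt_one u).ne (hP.lineMap_injective _ h4)
  have hij : vertexIndex n ⌊u⌋ = vertexIndex n ⌊v⌋ := by
    by_contra hne
    exact Set.disjoint_left.1 (hP.disjoint _ _ hne (key u v h) (key v u h.symm))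
      ⟨_, fl u, rfl⟩ ⟨_, fl v, h.symm⟩
  have hfr : Int.fract u = Int.fract v := by
    rw [boundaryPoint_eq, boundaryPoint_eq, hij] at h
    exact hP.lineMap_injective _ h
  rw [vertexIndex_eq_iff] at hij
  obtain ⟨z, hz⟩ := Int.ModEq.dvd hij
  refine ⟨z, ?_⟩
  have hz' : (⌊v⌋ : ℝ) - ⌊u⌋ = n * z := by exact_mod_cast hz
  have e1 := Int.floor_add_fract u
  have e2 := Int.floor_add_fract v
  linarith

lemma IsSimple.boundaryPoint_ne (hP : P.IsSimple) {u v : ℝ} (h1 : u < v) (h2 : v < u + n) :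
    P.boundaryPoint u ≠ P.boundaryPoint v := by
  intro h
  obtain ⟨z, hz⟩ := hP.exists_int_of_boundaryPoint_eq h
  have hn : (0 : ℝ) < n := by exact_mod_cast NeZero.pos n
  have h3 : (0 : ℝ) < z := by
    by_contra hc; push Not at hc
    nlinarith
  have h4 : (z : ℝ) < 1 := by
    by_contra hc; push Not at hc
    nlinarith
  have : (0 : ℤ) < z ∧ z < 1 := ⟨by exact_mod_cast h3, by exact_mod_cast h4⟩
  omega

end BoundaryPoint

end Polygon

/-! ### Angles subtended by segments -/

/-- The identification of the plane with the complex numbers. -/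
def planeToComplex : Plane ≃ₗᵢ[ℝ] ℂ := Complex.orthonormalBasisOneI.repr.symm

@[simp] lemma planeToComplex_re (x : Plane) : (planeToComplex x).re = x 0 := by
  simp [planeToComplex]

@[simp] lemma planeToComplex_im (x : Plane) : (planeToComplex x).im = x 1 := by
  simp [planeToComplex]

/-- The cross product of two vectors in the plane. -/
def cross (u v : Plane) : ℝ := u 0 * v 1 - u 1 * v 0

/-- The signed angle under which the segment from `p` to `q` is seen from `x`. -/
def viewAngle (x p q : Plane) : ℝ :=
  Complex.arg (planeToComplex (q - x) / planeToComplex (p - x))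

lemma im_div_eq_cross (u v : Plane) :
    (planeToComplex v / planeToComplex u).im = cross u v / Complex.normSq (planeToComplex u) := by
  rw [Complex.div_im]
  simp only [planeToComplex_re, planeToComplex_im, cross]
  ring

lemma viewAngle_self (x p : Plane) : viewAngle x p p = 0 := Complex.arg_div_self _

lemma planeToComplex_sub_ne_zero {x p : Plane} (h : x ≠ p) : planeToComplex (p - x) ≠ 0 := by
  rw [Ne, LinearIsometryEquiv.map_eq_zero_iff, sub_eq_zero]
  exact h.symm

/-- If the quotient were a real `c ≤ 0`, then `x` would be the convex combination of `p` and `q`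
with weights `-c / (1 - c)` and `1 / (1 - c)`. So the branch cut of `Complex.arg` is met only on the
segment. -/
lemma div_mem_slitPlane {x p q : Plane} (hx : x ∉ segment ℝ p q) :
    planeToComplex (q - x) / planeToComplex (p - x) ∈ Complex.slitPlane := by
  have hp : x ≠ p := fun h => hx (h ▸ left_mem_segment ℝ p q)
  have hp' := planeToComplex_sub_ne_zero hp
  by_contra hc
  rw [Complex.mem_slitPlane_iff, not_or, not_lt, not_not] at hc
  apply hx
  set z := planeToComplex (q - x) / planeToComplex (p - x) with hz
  have h1 : planeToComplex (q - x) = z.re • planeToComplex (p - x) := by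
    have : z = (z.re : ℂ) := Complex.ext (by simp) (by simp [hc.2])
    rw [Complex.real_smul, ← this, hz, div_mul_cancel₀ _ hp']
  rw [← map_smul] at h1
  have h2 := planeToComplex.injective h1
  have h3 : 0 < 1 - z.re := by linarith [hc.1]
  refine ⟨-z.re / (1 - z.re), 1 / (1 - z.re), div_nonneg (by linarith [hc.1]) h3.le,
    by positivity, by field_simp; ring, ?_⟩
  have h4 : q = x + z.re • (p - x) := by rw [← h2]; abel
  rw [h4, ← smul_right_inj h3.ne', smul_add, smul_smul, smul_smul, mul_div_cancel₀ _ h3.ne',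
    mul_div_cancel₀ _ h3.ne']
  module

lemma viewAngle_symm {x p q : Plane} (hx : x ∉ segment ℝ p q) :
    viewAngle x q p = -viewAngle x p q := by
  have := Complex.slitPlane_arg_ne_pi (div_mem_slitPlane hx)
  rw [viewAngle, ← inv_div, Complex.arg_inv, if_neg this, viewAngle]

lemma continuousAt_viewAngle {x p q : Plane} (hx : x ∉ segment ℝ p q) :
    ContinuousAt (fun y => viewAngle y p q) x := by
  have hp : x ≠ p := fun h => hx (h ▸ left_mem_segment ℝ p q)
  refine ContinuousAt.comp (g := Complex.arg)
    (f := fun y => planeToComplex (q - y) / planeToComplex (p - y))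
    (Complex.continuousAt_arg (div_mem_slitPlane hx)) ?_
  refine ContinuousAt.div ?_ ?_ (planeToComplex_sub_ne_zero hp)
  · exact (planeToComplex.continuous.comp (continuous_const.sub continuous_id)).continuousAt
  · exact (planeToComplex.continuous.comp (continuous_const.sub continuous_id)).continuousAt

lemma viewAngle_coe {x p q : Plane} (hp : x ≠ p) (hq : x ≠ q) :
    (viewAngle x p q : Real.Angle) =
      Complex.arg (planeToComplex (q - x)) - Complex.arg (planeToComplex (p - x)) :=
  Complex.arg_div_coe_angle (planeToComplex_sub_ne_zero hq) (planeToComplex_sub_ne_zero hp)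

lemma eq_zero_of_coe_angle_eq_zero {θ : ℝ} (h : (θ : Real.Angle) = 0) (h1 : -(2 * Real.pi) < θ)
    (h2 : θ < 2 * Real.pi) : θ = 0 := by
  obtain ⟨k, hk⟩ := Real.Angle.coe_eq_zero_iff.1 h
  rw [zsmul_eq_mul] at hk
  have hpi := Real.pi_pos
  have h3 : (-1 : ℝ) < k := by nlinarith
  have h4 : (k : ℝ) < 1 := by nlinarith
  have : -1 < k ∧ k < 1 := ⟨by exact_mod_cast h3, by exact_mod_cast h4⟩
  have : k = 0 := by omega
  simp [← hk, this]

/-- Modulo `2π` both sides are the same difference of arguments. The three angles are all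
nonnegative or all nonpositive, according to the sign of `cross (p - x) (q - x)`, and are below `π`
in absolute value, so the two sides differ by less than `2π`. -/
lemma viewAngle_split {x p q r : Plane} (hx : x ∉ segment ℝ p q) (hr : r ∈ segment ℝ p q) :
    viewAngle x p r + viewAngle x r q = viewAngle x p q := by
  have hp : x ≠ p := fun h => hx (h ▸ left_mem_segment ℝ p q)
  have hq : x ≠ q := fun h => hx (h ▸ right_mem_segment ℝ p q)
  have hxr : x ≠ r := fun h => hx (h ▸ hr)
  have hpr : x ∉ segment ℝ p r :=
    fun h => hx ((convex_segment p q).segment_subset (left_mem_segment ℝ p q) hr h)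
  have hrq : x ∉ segment ℝ r q :=
    fun h => hx ((convex_segment p q).segment_subset hr (right_mem_segment ℝ p q) h)
  rw [← sub_eq_zero]
  obtain ⟨a, b, ha, hb, hab, rfl⟩ := hr
  have im1 : 0 ≤ cross (p - x) (q - x) →
      0 ≤ viewAngle x p (a • p + b • q) ∧ 0 ≤ viewAngle x (a • p + b • q) q ∧
        0 ≤ viewAngle x p q := by
    intro h
    simp only [viewAngle, Complex.arg_nonneg_iff, im_div_eq_cross]
    have e1 : cross (p - x) (a • p + b • q - x) = b * cross (p - x) (q - x) := by
      obtain rfl : a = 1 - b := by linarith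
      simp [cross]; ring
    have e2 : cross (a • p + b • q - x) (q - x) = a * cross (p - x) (q - x) := by
      obtain rfl : a = 1 - b := by linarith
      simp [cross]; ring
    rw [e1, e2]
    have := fun z => Complex.normSq_nonneg z
    refine ⟨div_nonneg (by positivity) (this _), div_nonneg (by positivity) (this _),
      div_nonneg h (this _)⟩
  have im2 : cross (p - x) (q - x) ≤ 0 →
      viewAngle x p (a • p + b • q) ≤ 0 ∧ viewAngle x (a • p + b • q) q ≤ 0 ∧
        viewAngle x p q ≤ 0 := by
    intro h
    have e1 : cross (a • p + b • q - x) (p - x) = -(b * cross (p - x) (q - x)) := by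
      obtain rfl : a = 1 - b := by linarith
      simp [cross]; ring
    have e2 : cross (q - x) (a • p + b • q - x) = -(a * cross (p - x) (q - x)) := by
      obtain rfl : a = 1 - b := by linarith
      simp [cross]; ring
    have e3 : cross (q - x) (p - x) = -cross (p - x) (q - x) := by
      simp [cross]; ring
    have := fun z => Complex.normSq_nonneg z
    rw [← neg_nonneg, ← neg_nonneg (a := viewAngle x _ q), ← neg_nonneg (a := viewAngle x p q),
      ← viewAngle_symm hpr, ← viewAngle_symm hrq, ← viewAngle_symm hx]
    simp only [viewAngle, Complex.arg_nonneg_iff, im_div_eq_cross]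
    rw [e1, e2, e3]
    refine ⟨div_nonneg ?_ (this _), div_nonneg ?_ (this _), div_nonneg ?_ (this _)⟩ <;>
      nlinarith
  have lt : ∀ {u v : Plane}, x ∉ segment ℝ u v → -Real.pi < viewAngle x u v ∧
      viewAngle x u v < Real.pi := fun h => ⟨Complex.neg_pi_lt_arg _,
        (Complex.arg_le_pi _).lt_of_ne (Complex.slitPlane_arg_ne_pi (div_mem_slitPlane h))⟩
  apply eq_zero_of_coe_angle_eq_zero
  · rw [Real.Angle.coe_sub, Real.Angle.coe_add, viewAngle_coe hp hxr, viewAngle_coe hxr hq,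
      viewAngle_coe hp hq]
    abel
  · rcases le_total 0 (cross (p - x) (q - x)) with h | h
    · linarith [(im1 h).1, (im1 h).2.1, (lt hx).2, Real.pi_pos]
    · linarith [(im2 h).2.2, (lt hpr).1, (lt hrq).1]
  · rcases le_total 0 (cross (p - x) (q - x)) with h | h
    · linarith [(im1 h).2.2, (lt hpr).2, (lt hrq).2]
    · linarith [(im2 h).1, (im2 h).2.1, (lt hx).1, Real.pi_pos]

lemma tendsto_viewAngle_cobounded (p q : Plane) :
    Tendsto (fun x => viewAngle x p q) (Bornology.cobounded Plane) (𝓝 0) := by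
  rw [← Complex.arg_one]
  refine Tendsto.comp (g := Complex.arg)
    (f := fun y => planeToComplex (q - y) / planeToComplex (p - y))
    (Complex.continuousAt_arg (by simp)) ?_
  have hlim : Tendsto (fun y => planeToComplex (p - y)) (Bornology.cobounded Plane)
      (Bornology.cobounded ℂ) := by
    rw [← tendsto_norm_atTop_iff_cobounded]
    have : ∀ y, ‖planeToComplex (p - y)‖ = dist y p := by
      intro y; rw [planeToComplex.norm_map, dist_eq_norm, norm_sub_rev]
    simp_rw [this]
    exact Metric.tendsto_dist_right_cobounded_atTop p
  have h1 : Tendsto (fun y => 1 + planeToComplex (q - p) * (planeToComplex (p - y))⁻¹)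
      (Bornology.cobounded Plane) (𝓝 1) := by
    have := (tendsto_inv₀_cobounded.comp hlim).const_mul (planeToComplex (q - p))
    simpa using this.const_add 1
  refine h1.congr' ?_
  have hne : ∀ᶠ y in Bornology.cobounded Plane, y ≠ p := by
    have := (Metric.tendsto_dist_right_cobounded_atTop p).eventually_gt_atTop 0
    exact this.mono fun y hy => dist_pos.1 hy
  filter_upwards [hne] with y hy
  have h0 := planeToComplex_sub_ne_zero hy
  have : planeToComplex (q - y) = planeToComplex (q - p) + planeToComplex (p - y) := by
    rw [← map_add]; congr 1; abel
  rw [this]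
  field_simp
  ring

/-- The angle under which a segment is seen jumps by `2π` when one crosses the segment. -/
lemma tendsto_viewAngle_jump {a b y v : Plane} (hy : y ∈ segment ℝ a b) (ha : y ≠ a) (hb : y ≠ b)
    (hv : 0 < cross (b - a) v) :
    Tendsto (fun r : ℝ => viewAngle (y + r • v) a b - viewAngle (y - r • v) a b) (𝓝[>] 0)
      (𝓝 (2 * Real.pi)) := by
  obtain ⟨c, e, hc, he, hce, rfl⟩ := hy
  obtain rfl : c = 1 - e := by linarith
  have he0 : 0 < e := he.lt_of_ne' (by rintro rfl; simp at ha)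
  have hc0 : 0 < 1 - e := hc.lt_of_ne' (by intro h; rw [h] at hb; simp at hb; apply hb; rw [show e = 1 by linarith]; simp)
  set y := (1 - e) • a + e • b with hyd
  set f : ℝ → ℂ := fun r => planeToComplex (b - (y + r • v)) / planeToComplex (a - (y + r • v))
    with hf
  have h0 : planeToComplex (a - (y + (0 : ℝ) • v)) ≠ 0 := by
    simpa using planeToComplex_sub_ne_zero ha
  have hcont : ContinuousAt f 0 := by
    refine ContinuousAt.div ?_ ?_ h0
    · exact (planeToComplex.continuous.comp (by fun_prop)).continuousAt
    · exact (planeToComplex.continuous.comp (by fun_prop)).continuousAt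
  -- At `r = 0` the quotient lies on the branch cut of `Complex.arg`. Moving along `v` or `-v`
  -- brings it into the upper or lower half-plane, where the argument tends to `π` or `-π`.
  have hf0 : f 0 = ((-(1 - e) / e : ℝ) : ℂ) := by
    have e1 : b - (y + (0 : ℝ) • v) = (-(1 - e) / e : ℝ) • (a - (y + (0 : ℝ) • v)) := by
      rw [← smul_right_inj he0.ne', smul_smul, mul_div_cancel₀ _ he0.ne', hyd]
      module
    rw [hf]
    simp only
    rw [e1, map_smul, Complex.real_smul, mul_div_cancel_right₀ _ h0]
  have hre : (f 0).re < 0 := by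
    rw [hf0, Complex.ofReal_re]; exact div_neg_of_neg_of_pos (by linarith) he0
  have him : (f 0).im = 0 := by rw [hf0, Complex.ofReal_im]
  have himr : ∀ r, (f r).im = r * (cross (b - a) v /
      Complex.normSq (planeToComplex (a - (y + r • v)))) := by
    intro r
    rw [hf]; simp only
    rw [im_div_eq_cross]
    have : cross (a - (y + r • v)) (b - (y + r • v)) = r * cross (b - a) v := by
      simp [cross, hyd]; ring
    rw [this]; ring
  have hne : ∀ᶠ r in 𝓝 (0 : ℝ), 0 < Complex.normSq (planeToComplex (a - (y + r • v))) := by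
    have : ContinuousAt (fun r : ℝ => planeToComplex (a - (y + r • v))) 0 :=
      (planeToComplex.continuous.comp (by fun_prop)).continuousAt
    filter_upwards [this.eventually_ne h0] with r hr using Complex.normSq_pos.2 hr
  have hp : Tendsto (fun r : ℝ => viewAngle (y + r • v) a b) (𝓝[>] 0) (𝓝 Real.pi) := by
    refine (Complex.tendsto_arg_nhdsWithin_im_nonneg_of_re_neg_of_im_zero hre him).comp
      (tendsto_nhdsWithin_iff.2 ⟨hcont.tendsto.mono_left nhdsWithin_le_nhds, ?_⟩)
    filter_upwards [nhdsWithin_le_nhds hne, self_mem_nhdsWithin] with r hr hr0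
    have hr0' : (0 : ℝ) < r := hr0
    change 0 ≤ (f r).im
    rw [himr]; positivity
  have hq : Tendsto (fun r : ℝ => viewAngle (y - r • v) a b) (𝓝[>] 0) (𝓝 (-Real.pi)) := by
    have ht : Tendsto (fun r : ℝ => -r) (𝓝[>] 0) (𝓝[<] 0) := by
      simpa using tendsto_neg_nhdsGT (a := (0 : ℝ))
    have : Tendsto (fun r : ℝ => viewAngle (y + r • v) a b) (𝓝[<] 0) (𝓝 (-Real.pi)) := by
      refine (Complex.tendsto_arg_nhdsWithin_im_neg_of_re_neg_of_im_zero hre him).comp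
        (tendsto_nhdsWithin_iff.2 ⟨hcont.tendsto.mono_left nhdsWithin_le_nhds, ?_⟩)
      filter_upwards [nhdsWithin_le_nhds hne, self_mem_nhdsWithin] with r hr hr0
      have hr0' : r < 0 := hr0
      change (f r).im < 0
      rw [himr]
      exact mul_neg_of_neg_of_pos hr0' (by positivity)
    refine (this.comp ht).congr fun r => ?_
    simp [sub_eq_add_neg]
  have := hp.sub hq
  rwa [sub_neg_eq_add, ← two_mul] at this

/-! ### Total angles of chains and of closed curves. -/

lemma sum_Ico_int_sub {M : Type*} [AddCommGroup M] (f : ℤ → M) {a b : ℤ} (h : a ≤ b) :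
    ∑ i ∈ Finset.Ico a b, (f (i + 1) - f i) = f b - f a := by
  induction b, h using Int.leInduction with
  | base => simp
  | succ b h ih =>
    have : Finset.Ico a (b + 1) = insert b (Finset.Ico a b) := by
      ext x; simp only [Finset.mem_Ico, Finset.mem_insert]; omega
    rw [this, Finset.sum_insert (by simp), ih]
    abel

lemma isCompact_segment_plane (a b : Plane) : IsCompact (segment ℝ a b) := by
  rw [segment_eq_image_lineMap]
  exact isCompact_Icc.image AffineMap.lineMap_continuous

namespace Polygon

variable {n : ℕ} [NeZero n] (P : Polygon Plane n)

/-- The point of the interval from `s` to `t` that is closest to `r`. -/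
def clamp (s t r : ℝ) : ℝ := max s (min r t)

lemma clamp_of_le {s t r : ℝ} (h : r ≤ s) : clamp s t r = s :=
  max_eq_left ((min_le_left _ _).trans h)

lemma clamp_of_ge {s t r : ℝ} (hst : s ≤ t) (h : t ≤ r) : clamp s t r = t := by
  rw [clamp, min_eq_right h, max_eq_right hst]

lemma clamp_mem {s t : ℝ} (hst : s ≤ t) (r : ℝ) : clamp s t r ∈ Icc s t :=
  ⟨le_max_left _ _, max_le hst (min_le_right _ _)⟩

/-- The total signed angle under which the chain with parameters from `s` to `t` is seen
from `x`. -/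
def chainAngle (x : Plane) (s t : ℝ) : ℝ :=
  ∑ i ∈ Finset.Ico ⌊s⌋ ⌈t⌉,
    viewAngle x (P.boundaryPoint (clamp s t i)) (P.boundaryPoint (clamp s t (i + 1 : ℤ)))

/-- Clamping makes all edges beyond the chain degenerate, with angle zero. Chains with different
ends can thus be summed over a common range of edges. -/
lemma chainAngle_eq_sum (x : Plane) {s t : ℝ} (hst : s ≤ t) {a b : ℤ} (ha : a ≤ ⌊s⌋)
    (hb : ⌈t⌉ ≤ b) :
    P.chainAngle x s t = ∑ i ∈ Finset.Ico a b,
      viewAngle x (P.boundaryPoint (clamp s t i)) (P.boundaryPoint (clamp s t (i + 1 : ℤ))) := by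
  refine Finset.sum_subset (Finset.Ico_subset_Ico ha hb) fun i _ hi => ?_
  rw [Finset.mem_Ico, not_and_or, not_le, not_lt] at hi
  rcases hi with hi | hi
  · have h1 : ((i + 1 : ℤ) : ℝ) ≤ s := (Int.cast_le.2 hi).trans (Int.floor_le s)
    have h2 : (i : ℝ) ≤ s := by push_cast at h1; linarith
    rw [clamp_of_le h1, clamp_of_le h2, viewAngle_self]
  · have h1 : t ≤ (i : ℝ) := (Int.le_ceil t).trans (Int.cast_le.2 hi)
    have h2 : t ≤ ((i + 1 : ℤ) : ℝ) := by push_cast; linarith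
    rw [clamp_of_ge hst h1, clamp_of_ge hst h2, viewAngle_self]

lemma chainAngle_add_period (x : Plane) (s t : ℝ) :
    P.chainAngle x (s + n) (t + n) = P.chainAngle x s t := by
  rw [chainAngle, chainAngle, Int.floor_add_natCast, Int.ceil_add_natCast,
    ← Finset.sum_Ico_add']
  refine Finset.sum_congr rfl fun i _ => ?_
  have : ∀ r : ℝ, clamp (s + n) (t + n) (r + n) = clamp s t r + n := by
    intro r
    simp only [clamp, min_add_add_right, max_add_add_right]
  have e1 : ((i + n : ℤ) : ℝ) = (i : ℝ) + n := by push_cast; ring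
  have e2 : ((i + n + 1 : ℤ) : ℝ) = ((i + 1 : ℤ) : ℝ) + n := by push_cast; ring
  rw [e1, e2, this, this, P.boundaryPoint_add_period, P.boundaryPoint_add_period]

lemma segment_boundaryPoint (i : ℤ) {u v : ℝ} (hu : (i : ℝ) ≤ u) (huv : u ≤ v) (hv : v ≤ i + 1) :
    segment ℝ (P.boundaryPoint u) (P.boundaryPoint v) = P.boundaryPoint '' Icc u v := by
  set A := P.boundaryPoint i
  set B := P.boundaryPoint (i + 1 : ℤ)
  have hl : ∀ w ∈ Icc u v, P.boundaryPoint w = AffineMap.lineMap A B (w - i) := fun w hw =>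
    P.boundaryPoint_eq_lineMap i (hu.trans hw.1) (hw.2.trans hv)
  rw [image_congr hl, hl u ⟨le_rfl, huv⟩, hl v ⟨huv, le_rfl⟩, ← image_segment, segment_eq_Icc (by linarith)]
  ext x
  constructor
  · rintro ⟨l, hl, rfl⟩
    exact ⟨l + i, ⟨by linarith [hl.1], by linarith [hl.2]⟩, by simp⟩
  · rintro ⟨w, hw, rfl⟩
    exact ⟨w - i, ⟨by linarith [hw.1], by linarith [hw.2]⟩, rfl⟩

lemma segment_clamp_subset {s t : ℝ} (hst : s ≤ t) (i : ℤ) :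
    segment ℝ (P.boundaryPoint (clamp s t i)) (P.boundaryPoint (clamp s t (i + 1 : ℤ))) ⊆
      P.boundaryPoint '' Icc s t := by
  rcases le_total ((i + 1 : ℤ) : ℝ) s with h | h
  · have h2 : (i : ℝ) ≤ s := by push_cast at h; linarith
    rw [clamp_of_le h, clamp_of_le h2, segment_same, singleton_subset_iff]
    exact ⟨s, ⟨le_rfl, hst⟩, rfl⟩
  rcases le_total t (i : ℝ) with h' | h'
  · have h2 : t ≤ ((i + 1 : ℤ) : ℝ) := by push_cast; linarith
    rw [clamp_of_ge hst h', clamp_of_ge hst h2, segment_same, singleton_subset_iff]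
    exact ⟨t, ⟨hst, le_rfl⟩, rfl⟩
  have h1 : (i : ℝ) ≤ clamp s t i := by
    rw [clamp, min_eq_left h']; exact le_max_right _ _
  have h2 : clamp s t (i + 1 : ℤ) ≤ (i : ℝ) + 1 := by
    push_cast at h ⊢
    exact max_le h (min_le_left _ _)
  have h3 : clamp s t i ≤ clamp s t (i + 1 : ℤ) := by
    push_cast
    exact max_le_max le_rfl (min_le_min (by linarith) le_rfl)
  rw [P.segment_boundaryPoint i h1 h3 h2]
  exact image_mono (Icc_subset_Icc (clamp_mem hst _).1 (clamp_mem hst _).2)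

lemma continuousAt_chainAngle {x : Plane} {s t : ℝ} (hst : s ≤ t)
    (hx : x ∉ P.boundaryPoint '' Icc s t) : ContinuousAt (fun y => P.chainAngle y s t) x :=
  tendsto_finsetSum _ fun i _ =>
    continuousAt_viewAngle fun h => hx (P.segment_clamp_subset hst i h)

lemma tendsto_chainAngle_cobounded (s t : ℝ) :
    Tendsto (fun x => P.chainAngle x s t) (Bornology.cobounded Plane) (𝓝 0) := by
  rw [← Finset.sum_const_zero (s := Finset.Ico ⌊s⌋ ⌈t⌉)]
  exact tendsto_finsetSum _ fun i _ => tendsto_viewAngle_cobounded _ _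

/-- Modulo `2π` the angles of the edges are differences of arguments and telescope. For closed
curves the total is then in `2πℤ`, hence locally constant off the curve. -/
lemma chainAngle_coe {x : Plane} {s t : ℝ} (hst : s ≤ t) (hx : x ∉ P.boundaryPoint '' Icc s t) :
    (P.chainAngle x s t : Real.Angle) = Complex.arg (planeToComplex (P.boundaryPoint t - x)) -
      Complex.arg (planeToComplex (P.boundaryPoint s - x)) := by
  have hab : ⌊s⌋ ≤ ⌈t⌉ := (Int.floor_le_floor hst).trans (Int.floor_le_ceil t)
  have hne : ∀ r, x ≠ P.boundaryPoint (clamp s t r) :=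
    fun r h => hx ⟨_, clamp_mem hst r, h.symm⟩
  rw [chainAngle, ← Real.Angle.coe_coeHom, map_sum]
  simp only [Real.Angle.coe_coeHom]
  simp_rw [viewAngle_coe (hne _) (hne _)]
  rw [sum_Ico_int_sub (fun i : ℤ => ((Complex.arg (planeToComplex
    (P.boundaryPoint (clamp s t i) - x)) : ℝ) : Real.Angle)) hab,
    clamp_of_ge hst (Int.le_ceil t), clamp_of_le (Int.floor_le s)]

lemma chainAngle_add {x : Plane} {s t u : ℝ} (hst : s ≤ t) (htu : t ≤ u)
    (hx : x ∉ P.boundaryPoint '' Icc s u) :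
    P.chainAngle x s t + P.chainAngle x t u = P.chainAngle x s u := by
  rw [P.chainAngle_eq_sum x hst le_rfl (Int.ceil_le_ceil htu),
    P.chainAngle_eq_sum x htu (Int.floor_le_floor hst) le_rfl, chainAngle, ← Finset.sum_add_distrib]
  refine Finset.sum_congr rfl fun i _ => ?_
  have hsu := hst.trans htu
  rcases le_or_gt ((i + 1 : ℤ) : ℝ) t with h | h
  · have h2 : (i : ℝ) ≤ t := by push_cast at h; linarith
    rw [clamp_of_le h, clamp_of_le h2, viewAngle_self, add_zero]
    simp only [clamp, min_eq_left h, min_eq_left h2, min_eq_left (h.trans htu),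
      min_eq_left (h2.trans htu)]
  rcases le_or_gt t (i : ℝ) with h' | h'
  · rw [clamp_of_ge hst h', clamp_of_ge hst h.le, viewAngle_self, zero_add]
    simp only [clamp]
    have : ∀ r : ℝ, t ≤ r → max t (min r u) = max s (min r u) := fun r hr => by
      rw [max_eq_right (le_min hr htu), max_eq_right (hst.trans (le_min hr htu))]
    rw [this _ h', this _ h.le]
  -- Only the edge with `t` strictly inside remains; it is cut in two at `t`, and `viewAngle_split`
  -- applies.
  have e1 : clamp s t i = clamp s u i := by
    simp only [clamp, min_eq_left h'.le, min_eq_left (h'.le.trans htu)]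
  have e2 : clamp t u (i + 1 : ℤ) = clamp s u (i + 1 : ℤ) := by
    simp only [clamp]
    rw [max_eq_right (le_min h.le htu), max_eq_right (hst.trans (le_min h.le htu))]
  rw [clamp_of_ge hst h.le, clamp_of_le h'.le, e1, e2]
  have hsub := P.segment_clamp_subset hsu i
  refine viewAngle_split (fun hh => hx (hsub hh)) ?_
  have a1 : (i : ℝ) ≤ clamp s u i := by
    rw [clamp, min_eq_left (h'.le.trans htu)]; exact le_max_right _ _
  have a2 : clamp s u i ≤ t := by
    rw [clamp, min_eq_left (h'.le.trans htu)]; exact max_le hst h'.le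
  have a3 : t ≤ clamp s u (i + 1 : ℤ) := le_max_of_le_right (le_min h.le htu)
  have a4 : clamp s u (i + 1 : ℤ) ≤ (i : ℝ) + 1 := by
    rw [clamp]; push_cast at h ⊢
    exact max_le (hst.trans h.le) (min_le_left _ _)
  rw [P.segment_boundaryPoint i a1 (a2.trans a3) a4]
  exact ⟨t, ⟨a2, a3⟩, rfl⟩

/-- The total signed angle along the whole boundary does not depend on the starting point. -/
lemma chainAngle_period_eq {x : Plane} (hx : x ∉ P.boundary ℝ) (s t : ℝ) :
    P.chainAngle x s (s + n) = P.chainAngle x t (t + n) := by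
  have hn : (0 : ℝ) < n := by exact_mod_cast NeZero.pos n
  have hx' : ∀ a b, x ∉ P.boundaryPoint '' Icc a b := by
    rintro a b ⟨u, -, rfl⟩; exact hx (P.boundaryPoint_mem u)
  have key : ∀ s t : ℝ, s ≤ t → P.chainAngle x s (s + n) = P.chainAngle x t (t + n) := by
    intro s t h
    have h1 := P.chainAngle_add h (by linarith : t ≤ t + n) (hx' _ _)
    have h2 := P.chainAngle_add (by linarith : s ≤ s + n) (by linarith : s + n ≤ t + n) (hx' _ _)
    rw [P.chainAngle_add_period] at h2
    linarith
  rcases le_total s t with h | h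
  exacts [key s t h, (key t s h).symm]

/-- Up to a factor `2π`, the winding number of the boundary around `x`. -/
def totalAngle (x : Plane) : ℝ := P.chainAngle x 0 n

lemma totalAngle_eq {x : Plane} (hx : x ∉ P.boundary ℝ) {s t : ℝ} (hst : s ≤ t) (hts : t ≤ s + n) :
    P.chainAngle x s t + P.chainAngle x t (s + n) = P.totalAngle x := by
  rw [P.chainAngle_add hst hts, P.chainAngle_period_eq hx s 0, zero_add, totalAngle]
  rintro ⟨u, -, rfl⟩; exact hx (P.boundaryPoint_mem u)

lemma totalAngle_coe {x : Plane} (hx : x ∉ P.boundary ℝ) : (P.totalAngle x : Real.Angle) = 0 := by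
  have hn : (0 : ℝ) ≤ n := by positivity
  rw [totalAngle, P.chainAngle_coe hn]
  · have := P.boundaryPoint_add_period 0
    rw [zero_add] at this
    rw [this, sub_self]
  · rintro ⟨u, -, rfl⟩; exact hx (P.boundaryPoint_mem u)

lemma continuousAt_totalAngle {x : Plane} (hx : x ∉ P.boundary ℝ) :
    ContinuousAt P.totalAngle x := by
  refine P.continuousAt_chainAngle (by positivity) ?_
  rintro ⟨u, -, rfl⟩; exact hx (P.boundaryPoint_mem u)

/-- The total angle of the closed curve that consists of the chain from `s` to `t` and the segment
back. -/
def sideAngle (x : Plane) (s t : ℝ) : ℝ :=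
  P.chainAngle x s t + viewAngle x (P.boundaryPoint t) (P.boundaryPoint s)

/-- The closed curve that consists of the chain from `s` to `t` and the segment back. -/
def sideCurve (s t : ℝ) : Set Plane := P.boundaryPoint '' Icc s t ∪ P.boundarySegment s t

lemma isClosed_sideCurve (s t : ℝ) : IsClosed (P.sideCurve s t) := by
  refine (isCompact_Icc.image P.continuous_boundaryPoint).isClosed.union ?_
  exact (isCompact_segment_plane _ _).isClosed

variable {P} in
lemma continuousAt_sideAngle {x : Plane} {s t : ℝ} (hst : s ≤ t) (hx : x ∉ P.sideCurve s t) :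
    ContinuousAt (fun y => P.sideAngle y s t) x := by
  refine (P.continuousAt_chainAngle hst fun h => hx (Or.inl h)).add
    (continuousAt_viewAngle fun h => hx (Or.inr ?_))
  rwa [boundarySegment, segment_symm]

variable {P} in
lemma sideAngle_coe {x : Plane} {s t : ℝ} (hst : s ≤ t) (hx : x ∉ P.sideCurve s t) :
    (P.sideAngle x s t : Real.Angle) = 0 := by
  have h : ∀ u ∈ Icc s t, x ≠ P.boundaryPoint u := fun u hu h => hx (Or.inl ⟨u, hu, h.symm⟩)
  rw [sideAngle, Real.Angle.coe_add, P.chainAngle_coe hst fun h => hx (Or.inl h),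
    viewAngle_coe (h t ⟨hst, le_rfl⟩) (h s ⟨le_rfl, hst⟩)]
  abel

lemma tendsto_sideAngle_cobounded (s t : ℝ) :
    Tendsto (fun x => P.sideAngle x s t) (Bornology.cobounded Plane) (𝓝 0) := by
  simpa [sideAngle] using (P.tendsto_chainAngle_cobounded s t).add (tendsto_viewAngle_cobounded _ _)

/-- The two side curves run along the chord in opposite directions, so that its contributions
cancel. -/
lemma sideAngle_add {x : Plane} (hx : x ∉ P.boundary ℝ) {s t : ℝ} (hst : s ≤ t) (hts : t ≤ s + n)
    (hK : x ∉ P.boundarySegment s t) :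
    P.sideAngle x s t + P.sideAngle x t (s + n) = P.totalAngle x := by
  rw [← P.totalAngle_eq hx hst hts, sideAngle, sideAngle, P.boundaryPoint_add_period,
    viewAngle_symm hK]
  ring

end Polygon

/-- A function with values in `2πℤ` that is continuous near a connected set is constant on it. -/
lemma IsPreconnected.eq_of_coe_angle_eq_zero {S : Set Plane} (hS : IsPreconnected S)
    {f : Plane → ℝ} (hf : ∀ x ∈ S, ContinuousAt f x) (h0 : ∀ x ∈ S, (f x : Real.Angle) = 0)
    {x y : Plane} (hx : x ∈ S) (hy : y ∈ S) : f x = f y := by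
  have hc : ContinuousOn f S := fun x hx => (hf x hx).continuousWithinAt
  set g : Plane → ℤ := fun x => round (f x / (2 * Real.pi)) with hg
  have hpi := Real.pi_pos
  have hfg : ∀ x ∈ S, f x = g x * (2 * Real.pi) := by
    intro x hx
    obtain ⟨k, hk⟩ := Real.Angle.coe_eq_zero_iff.1 (h0 x hx)
    rw [zsmul_eq_mul] at hk
    have : f x / (2 * Real.pi) = k := by rw [← hk]; field_simp
    rw [hg]; simp only; rw [this, round_intCast, hk]
  have hgc : ContinuousOn g S := by
    rw [Int.isClosedEmbedding_coe_real.isInducing.continuousOn_iff]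
    refine (hc.div_const (2 * Real.pi)).congr fun x hx => ?_
    simp only [Function.comp]
    rw [hfg x hx]; field_simp
  rw [hfg x hx, hfg y hy, hS.constant hgc hx hy]

/-- The first point of a closed set on a segment. -/
lemma exists_first_mem {B : Set Plane} (hB : IsClosed B) {γ : ℝ → Plane} {a b : ℝ}
    (hγ : ContinuousOn γ (Icc a b)) (hab : a ≤ b) (hb : γ b ∈ B) :
    ∃ c ∈ Icc a b, γ c ∈ B ∧ ∀ u ∈ Ico a c, γ u ∉ B := by
  have hc : IsCompact (Icc a b ∩ γ ⁻¹' B) :=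
    isCompact_Icc.of_isClosed_subset (hγ.preimage_isClosed_of_isClosed isClosed_Icc hB)
      inter_subset_left
  obtain ⟨c, hc, hmin⟩ := hc.exists_isLeast ⟨b, ⟨hab, le_rfl⟩, hb⟩
  refine ⟨c, hc.1, hc.2, fun u hu hmem => ?_⟩
  exact absurd (hmin ⟨⟨hu.1, hu.2.le.trans hc.1.2⟩, hmem⟩) (not_le.2 hu.2)

lemma exists_last_mem {B : Set Plane} (hB : IsClosed B) {γ : ℝ → Plane} {a b : ℝ}
    (hγ : ContinuousOn γ (Icc a b)) (hab : a ≤ b) (ha : γ a ∈ B) :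
    ∃ c ∈ Icc a b, γ c ∈ B ∧ ∀ u ∈ Ioc c b, γ u ∉ B := by
  have hc : IsCompact (Icc a b ∩ γ ⁻¹' B) :=
    isCompact_Icc.of_isClosed_subset (hγ.preimage_isClosed_of_isClosed isClosed_Icc hB)
      inter_subset_left
  obtain ⟨c, hc, hmax⟩ := hc.exists_isGreatest ⟨a, ⟨le_rfl, hab⟩, ha⟩
  refine ⟨c, hc.1, hc.2, fun u hu hmem => ?_⟩
  exact absurd (hmax ⟨⟨hc.1.1.trans hu.1.le, hu.2⟩, hmem⟩) (not_le.2 hu.1)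

/-! ### Sectors -/

lemma exists_polar {w : ℂ} (hw : ∀ h : ℝ, 0 ≤ h → w ≠ h) :
    ∃ φ ∈ Ioo 0 (2 * Real.pi), w = ‖w‖ * Complex.exp (φ * Complex.I) := by
  have h0 : w.arg ≠ 0 := by
    intro h
    rw [Complex.arg_eq_zero_iff] at h
    exact hw w.re h.1 (Complex.ext (by simp) (by simp [h.2]))
  have hpi := Real.pi_pos
  rcases h0.lt_or_gt with h | h
  · refine ⟨w.arg + 2 * Real.pi, ⟨by linarith [Complex.neg_pi_lt_arg w], by linarith⟩, ?_⟩
    conv_lhs => rw [← Complex.norm_mul_exp_arg_mul_I w]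
    congr 1
    rw [Complex.exp_eq_exp_iff_exists_int]
    exact ⟨-1, by push_cast; ring⟩
  · exact ⟨w.arg, ⟨h, by linarith [Complex.arg_le_pi w]⟩, (Complex.norm_mul_exp_arg_mul_I w).symm⟩

lemma polar_ne {r h θ β : ℝ} (hr : 0 < r) (hh : 0 ≤ h) (h1 : θ ≠ β) (h2 : |θ - β| < 2 * Real.pi) :
    (r : ℂ) * Complex.exp (θ * Complex.I) ≠ h * Complex.exp (β * Complex.I) := by
  intro h
  have hn := congrArg norm h
  simp only [norm_mul, Complex.norm_real, Complex.norm_exp_ofReal_mul_I, mul_one,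
    Real.norm_of_nonneg hr.le, Real.norm_of_nonneg hh] at hn
  rw [← hn] at h
  have h3 := mul_left_cancel₀ (by exact_mod_cast hr.ne') h
  rw [Complex.exp_eq_exp_iff_exists_int] at h3
  obtain ⟨k, hk⟩ := h3
  have h4 : θ = β + k * (2 * Real.pi) := by
    have := congrArg Complex.im hk
    simpa using this
  have hpi := Real.pi_pos
  rw [abs_lt] at h2
  have h5 : (-1 : ℝ) < k := by nlinarith
  have h6 : (k : ℝ) < 1 := by nlinarith
  have : -1 < k ∧ k < 1 := ⟨by exact_mod_cast h5, by exact_mod_cast h6⟩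
  have hk0 : k = 0 := by omega
  rw [hk0] at h4
  exact h1 (by simpa using h4)

/-- Two rays with a common source `z` cut a disk with center `z` into sectors that are connected
and adjacent to both rays. -/
lemma exists_sector {z d₁ d₂ y : Plane} {ε : ℝ} (hd₁ : d₁ ≠ 0) (hd₂ : d₂ ≠ 0)
    (hd : ∀ a b : ℝ, 0 < a → 0 < b → a • d₁ ≠ b • d₂) (hy : dist y z < ε)
    (hy₁ : ∀ h : ℝ, 0 ≤ h → y ≠ z + h • d₁) (hy₂ : ∀ h : ℝ, 0 ≤ h → y ≠ z + h • d₂) :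
    ∃ S : Set Plane, IsPreconnected S ∧ y ∈ S ∧ S ⊆ Metric.ball z ε ∧
      (∀ x ∈ S, ∀ h : ℝ, 0 ≤ h → x ≠ z + h • d₁ ∧ x ≠ z + h • d₂) ∧
      ∀ h : ℝ, 0 < h → ‖h • d₁‖ < ε → ‖h • d₂‖ < ε →
        z + h • d₁ ∈ closure S ∧ z + h • d₂ ∈ closure S := by
  set c := planeToComplex d₁ with hc
  have hc0 : c ≠ 0 := by
    rw [hc, Ne, LinearIsometryEquiv.map_eq_zero_iff]; exact hd₁
  have hcn : 0 < ‖c‖ := norm_pos_iff.2 hc0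
  -- Polar coordinates around `z`, scaled and rotated so that `d₁` has radius `1` and angle `0`.
  set Φ : ℝ × ℝ → Plane := fun p =>
    z + planeToComplex.symm ((p.1 : ℂ) * Complex.exp (p.2 * Complex.I) * c) with hΦ
  have hΦc : Continuous Φ := by
    refine continuous_const.add (planeToComplex.symm.continuous.comp ?_)
    fun_prop
  have hΦdist : ∀ r θ : ℝ, 0 ≤ r → dist (Φ (r, θ)) z = r * ‖c‖ := by
    intro r θ hr
    simp [hΦ, dist_eq_norm, abs_of_nonneg hr, Complex.norm_exp_ofReal_mul_I]
  have hΦeq : ∀ (r θ : ℝ) (x : Plane), x = Φ (r, θ) ↔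
      planeToComplex (x - z) / c = (r : ℂ) * Complex.exp (θ * Complex.I) := by
    intro r θ x
    rw [hΦ, div_eq_iff hc0, ← sub_eq_iff_eq_add', eq_comm, LinearIsometryEquiv.symm_apply_eq,
      eq_comm]
  -- the second ray
  have h2 : ∀ h : ℝ, 0 ≤ h → planeToComplex d₂ / c ≠ h := by
    intro h hh he
    rw [div_eq_iff hc0, hc, ← Complex.real_smul, ← map_smul] at he
    have he' := planeToComplex.injective he
    rcases hh.eq_or_lt with rfl | hh
    · exact hd₂ (by simpa using he')
    · exact hd h 1 hh one_pos (by rw [one_smul, he'])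
  obtain ⟨β, hβ, hβ2⟩ := exists_polar h2
  set ρ := ‖planeToComplex d₂ / c‖ with hρ
  have hρ0 : 0 ≤ ρ := norm_nonneg _
  have hray1 : ∀ h : ℝ, z + h • d₁ = Φ (h, 0) := by
    intro h
    rw [hΦeq, add_sub_cancel_left, map_smul, Complex.real_smul, ← hc, mul_div_cancel_right₀ _ hc0]
    simp
  have hray1' : ∀ h : ℝ, z + h • d₁ = Φ (h, 2 * Real.pi) := by
    intro h
    rw [hΦeq]
    push_cast
    rw [Complex.exp_two_pi_mul_I, add_sub_cancel_left, map_smul, Complex.real_smul, ← hc,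
      mul_div_cancel_right₀ _ hc0, mul_one]
  have hray2 : ∀ h : ℝ, z + h • d₂ = Φ (h * ρ, β) := by
    intro h
    rw [hΦeq]
    push_cast
    rw [mul_assoc, ← hβ2]
    simp [mul_div_assoc]
  obtain ⟨φ, hφ, hφ2⟩ := exists_polar (w := planeToComplex (y - z) / c) (by
    intro h hh he
    refine hy₁ h hh ?_
    rw [hray1, hΦeq, he]; simp)
  set r₀ := ‖planeToComplex (y - z) / c‖ with hr₀
  have hyΦ : y = Φ (r₀, φ) := (hΦeq _ _ _).2 hφ2
  have hr0 : 0 < r₀ := by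
    refine (norm_nonneg _).lt_of_ne' fun (h : r₀ = 0) => ?_
    refine hy₁ 0 le_rfl ?_
    rw [hyΦ, hray1, hΦeq, ← hyΦ, hφ2, h]; simp
  have hφβ : φ ≠ β := by
    intro h
    have hρ1 : 0 < ρ := by
      refine hρ0.lt_of_ne' fun h => ?_
      have := h2 0 le_rfl
      rw [hβ2, h] at this; simp at this
    refine hy₂ (r₀ / ρ) (by positivity) ?_
    rw [hray2, div_mul_cancel₀ _ hρ1.ne', hyΦ, h]
  -- The sector is the range of angles, `(0, β)` or `(β, 2π)`, that contains the angle `φ` of `y`.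
  -- The first ray has both angles `0` and `2π`, so either sector is bounded by both rays.
  have main : ∀ α α' : ℝ, φ ∈ Ioo α α' → Ioo α α' ⊆ Ioo 0 (2 * Real.pi) → β ∉ Ioo α α' →
      (α = 0 ∧ α' = β ∨ α = β ∧ α' = 2 * Real.pi) → ∃ S : Set Plane, IsPreconnected S ∧ y ∈ S ∧
      S ⊆ Metric.ball z ε ∧
      (∀ x ∈ S, ∀ h : ℝ, 0 ≤ h → x ≠ z + h • d₁ ∧ x ≠ z + h • d₂) ∧
      ∀ h : ℝ, 0 < h → ‖h • d₁‖ < ε → ‖h • d₂‖ < ε →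
        z + h • d₁ ∈ closure S ∧ z + h • d₂ ∈ closure S := by
    intro α α' hφ' hsub hβ' hcase
    have hαα : α < α' := hφ'.1.trans hφ'.2
    refine ⟨Φ '' (Ioo 0 (ε / ‖c‖) ×ˢ Ioo α α'), ?_, ?_, ?_, ?_, ?_⟩
    · exact (isPreconnected_Ioo.prod isPreconnected_Ioo).image _ hΦc.continuousOn
    · refine ⟨(r₀, φ), ⟨⟨hr0, ?_⟩, hφ'⟩, hyΦ.symm⟩
      rw [lt_div_iff₀ hcn, ← hΦdist _ φ hr0.le, ← hyΦ]; exact hy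
    · rintro _ ⟨⟨r, θ⟩, ⟨hr, -⟩, rfl⟩
      rw [Metric.mem_ball, hΦdist _ _ hr.1.le, ← lt_div_iff₀ hcn]
      exact hr.2
    · rintro _ ⟨⟨r, θ⟩, ⟨hr, hθ⟩, rfl⟩ h hh
      have hθ' := hsub hθ
      constructor
      · rw [hray1]
        intro he
        rw [hΦeq, (hΦeq r θ _).1 rfl] at he
        refine polar_ne hr.1 hh hθ'.1.ne' ?_ he
        rw [sub_zero, abs_of_pos hθ'.1]; exact hθ'.2
      · rw [hray2]
        intro he
        rw [hΦeq, (hΦeq r θ _).1 rfl] at he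
        refine polar_ne hr.1 (mul_nonneg hh hρ0) ?_ ?_ he
        · rintro rfl; exact hβ' hθ
        · rw [abs_lt]; constructor <;> linarith [hθ'.1, hθ'.2, hβ.1, hβ.2]
    · intro h hh hn1 hn2
      have hcl : ∀ r ∈ Ioo 0 (ε / ‖c‖), ∀ θ ∈ Icc α α',
          Φ (r, θ) ∈ closure (Φ '' (Ioo 0 (ε / ‖c‖) ×ˢ Ioo α α')) := by
        intro r hr θ hθ
        refine image_closure_subset_closure_image hΦc ⟨(r, θ), ?_, rfl⟩
        rw [closure_prod_eq, closure_Ioo hαα.ne]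
        exact ⟨subset_closure hr, hθ⟩
      have hr1 : h ∈ Ioo 0 (ε / ‖c‖) := by
        refine ⟨hh, ?_⟩
        rw [lt_div_iff₀ hcn, hc, planeToComplex.norm_map]
        rwa [norm_smul, Real.norm_of_nonneg hh.le] at hn1
      have hr2 : h * ρ ∈ Ioo 0 (ε / ‖c‖) := by
        have hd2 : 0 < ‖d₂‖ := norm_pos_iff.2 hd₂
        have hρ' : ρ = ‖d₂‖ / ‖c‖ := by rw [hρ, norm_div, planeToComplex.norm_map]
        rw [hρ']
        refine ⟨by positivity, ?_⟩
        rw [← mul_div_assoc]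
        refine div_lt_div_of_pos_right ?_ hcn
        rwa [norm_smul, Real.norm_of_nonneg hh.le] at hn2
      rcases hcase with ⟨rfl, rfl⟩ | ⟨rfl, rfl⟩
      · rw [hray1, hray2]
        exact ⟨hcl _ hr1 _ ⟨le_rfl, hαα.le⟩, hcl _ hr2 _ ⟨hαα.le, le_rfl⟩⟩
      · rw [hray1', hray2]
        exact ⟨hcl _ hr1 _ ⟨hαα.le, le_rfl⟩, hcl _ hr2 _ ⟨le_rfl, hαα.le⟩⟩
  rcases hφβ.lt_or_gt with h | h
  · exact main 0 β ⟨hφ.1, h⟩ (Ioo_subset_Ioo_right hβ.2.le) (fun h => h.2.false)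
      (Or.inl ⟨rfl, rfl⟩)
  · exact main β (2 * Real.pi) ⟨h, hφ.2⟩ (Ioo_subset_Ioo_left hβ.1.le) (fun h => h.1.false)
      (Or.inr ⟨rfl, rfl⟩)

/-! ### The boundary curve near one of its points, and the components of its complement. -/

namespace Polygon

variable {n : ℕ} [NeZero n] {P : Polygon Plane n}

lemma exists_local_rays (P : Polygon Plane n) (u : ℝ) : ∃ d₁ d₂ : Plane, ∃ δ : ℝ, 0 < δ ∧ δ ≤ 1 ∧
    (∀ h ∈ Icc 0 δ, P.boundaryPoint (u + h) = P.boundaryPoint u + h • d₁) ∧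
    ∀ h ∈ Icc 0 δ, P.boundaryPoint (u - h) = P.boundaryPoint u + h • d₂ := by
  have e1 := Int.floor_le u
  have e2 := Int.lt_floor_add_one u
  have e3 := Int.ceil_lt_add_one u
  have e4 := Int.le_ceil u
  refine ⟨P.boundaryPoint (⌊u⌋ + 1 : ℤ) - P.boundaryPoint ⌊u⌋,
    -(P.boundaryPoint (⌈u⌉ - 1 + 1 : ℤ) - P.boundaryPoint (⌈u⌉ - 1 : ℤ)),
    min (⌊u⌋ + 1 - u) (u - (⌈u⌉ - 1)), lt_min (by linarith) (by linarith),
    (min_le_left _ _).trans (by linarith), ?_, ?_⟩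
  · intro h hh
    have := hh.2.trans (min_le_left _ _)
    rw [P.boundaryPoint_eq_lineMap ⌊u⌋ e1 e2.le,
      P.boundaryPoint_eq_lineMap ⌊u⌋ (by linarith [hh.1]) (by linarith)]
    simp only [AffineMap.lineMap_apply_module']
    module
  · intro h hh
    have := hh.2.trans (min_le_right _ _)
    rw [P.boundaryPoint_eq_lineMap (⌈u⌉ - 1) (t := u) (by push_cast; linarith)
        (by push_cast; linarith),
      P.boundaryPoint_eq_lineMap (⌈u⌉ - 1) (by push_cast; linarith)
        (by push_cast; linarith [hh.1])]
    simp only [AffineMap.lineMap_apply_module']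
    module

omit [NeZero n] in
lemma IsSimple.three_le_real (hP : P.IsSimple) : (3 : ℝ) ≤ n := by exact_mod_cast hP.three_le

/-- By injectivity the rest of the curve is a compact set that misses the given point, so it stays
at positive distance. Near the point only the two local rays remain. -/
lemma IsSimple.exists_ball (hP : P.IsSimple) (u : ℝ) {δ : ℝ} (h0 : 0 < δ) :
    ∃ ε > 0, ∀ x ∈ P.boundary ℝ, dist x (P.boundaryPoint u) < ε →
      ∃ h ∈ Icc 0 δ, x = P.boundaryPoint (u + h) ∨ x = P.boundaryPoint (u - h) := by
  have hn := hP.three_le_real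
  have hc : IsClosed (P.boundaryPoint '' Icc (u + δ) (u - δ + n)) :=
    (isCompact_Icc.image P.continuous_boundaryPoint).isClosed
  have hz : P.boundaryPoint u ∉ P.boundaryPoint '' Icc (u + δ) (u - δ + n) := by
    rintro ⟨v, hv, he⟩
    exact hP.boundaryPoint_ne (by linarith [hv.1]) (by linarith [hv.2]) he.symm
  obtain ⟨ε, hε, hb⟩ := Metric.isOpen_iff.1 hc.isOpen_compl _ hz
  refine ⟨ε, hε, fun x hx hd => ?_⟩
  obtain ⟨t, ht, rfl⟩ := P.exists_boundaryPoint_eq (u - δ) hx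
  have h2 : t < u + δ := by
    by_contra hc
    exact hb hd ⟨t, ⟨not_lt.1 hc, ht.2.le⟩, rfl⟩
  rcases le_total u t with h | h
  · exact ⟨t - u, ⟨by linarith, by linarith⟩, Or.inl (by ring_nf)⟩
  · exact ⟨u - t, ⟨by linarith, by linarith [ht.1]⟩, Or.inr (by ring_nf)⟩

/-- Every component of the complement of the boundary curve is adjacent to the whole curve. -/
lemma IsSimple.boundary_subset_closure (hP : P.IsSimple) {y : Plane} (hy : y ∉ P.boundary ℝ) :
    P.boundary ℝ ⊆ closure (connectedComponentIn (P.boundary ℝ)ᶜ y) := by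
  set U := connectedComponentIn (P.boundary ℝ)ᶜ y with hU
  have hclosed : IsClosed (P.boundaryPoint ⁻¹' closure U) :=
    isClosed_closure.preimage P.continuous_boundaryPoint
  -- The parameters of points adherent to `U` form a clopen subset of the line. Openness: near a
  -- boundary point the curve consists of two rays. If `U` comes close to the point, it contains one
  -- of the two sectors between the rays, and that sector is adjacent to both rays.
  have hopen : IsOpen (P.boundaryPoint ⁻¹' closure U) := by
    rw [isOpen_iff_mem_nhds]
    intro u hu
    obtain ⟨d₁, d₂, δ, hδ, hδ1, hd₁, hd₂⟩ := P.exists_local_rays u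
    obtain ⟨ε₀, hε₀, hball⟩ := hP.exists_ball u hδ
    have hn := hP.three_le_real
    have hd₁0 : d₁ ≠ 0 := by
      rintro rfl
      have := hd₁ δ ⟨hδ.le, le_rfl⟩
      rw [smul_zero, add_zero] at this
      exact hP.boundaryPoint_ne (by linarith) (by linarith) this.symm
    have hd₂0 : d₂ ≠ 0 := by
      rintro rfl
      have := hd₂ δ ⟨hδ.le, le_rfl⟩
      rw [smul_zero, add_zero] at this
      exact hP.boundaryPoint_ne (by linarith) (by linarith) this
    -- If the rays had the same direction, the curve would pass through a common point just before
    -- and just after `u`. The factor `k` keeps both parameters within `δ`.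
    have hd : ∀ a b : ℝ, 0 < a → 0 < b → a • d₁ ≠ b • d₂ := by
      intro a b ha hb h
      set k := δ / (a + b) with hk
      have hk0 : 0 < k := by positivity
      have hka : k * a + k * b = δ := by rw [hk]; field_simp
      have h1 := hd₁ (k * a) ⟨by positivity, by nlinarith⟩
      have h2 := hd₂ (k * b) ⟨by positivity, by nlinarith⟩
      rw [mul_smul] at h1 h2
      rw [h, ← h2] at h1
      refine hP.boundaryPoint_ne ?_ ?_ h1.symm <;> nlinarith
    have hn₁ : 0 < ‖d₁‖ := norm_pos_iff.2 hd₁0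
    have hn₂ : 0 < ‖d₂‖ := norm_pos_iff.2 hd₂0
    obtain ⟨ε, hε, hεε, hε₁, hε₂⟩ : ∃ ε > 0, ε ≤ ε₀ ∧ ε ≤ δ * ‖d₁‖ ∧ ε ≤ δ * ‖d₂‖ :=
      ⟨min ε₀ (min (δ * ‖d₁‖) (δ * ‖d₂‖)), by positivity, min_le_left _ _,
        (min_le_right _ _).trans (min_le_left _ _), (min_le_right _ _).trans (min_le_right _ _)⟩
    obtain ⟨x, hxU, hxε⟩ := Metric.mem_closure_iff.1 hu ε hε
    rw [dist_comm] at hxε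
    have hxC : x ∈ (P.boundary ℝ)ᶜ := connectedComponentIn_subset _ _ hxU
    obtain ⟨S, hS, hxS, hSb, hSr, hScl⟩ := exists_sector hd₁0 hd₂0 hd hxε
      (by
        rintro h hh rfl
        rw [dist_self_add_left, norm_smul, Real.norm_of_nonneg hh] at hxε
        refine hxC ?_
        rw [← hd₁ h ⟨hh, by nlinarith⟩]
        exact P.boundaryPoint_mem _)
      (by
        rintro h hh rfl
        rw [dist_self_add_left, norm_smul, Real.norm_of_nonneg hh] at hxε
        refine hxC ?_
        rw [← hd₂ h ⟨hh, by nlinarith⟩]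
        exact P.boundaryPoint_mem _)
    have hSC : S ⊆ (P.boundary ℝ)ᶜ := by
      intro w hw hwC
      obtain ⟨h, hh, he | he⟩ := hball w hwC (lt_of_lt_of_le (hSb hw) hεε)
      · exact (hSr w hw h hh.1).1 (he.trans (hd₁ h hh))
      · exact (hSr w hw h hh.1).2 (he.trans (hd₂ h hh))
    have hSU : S ⊆ U := by
      rw [hU, connectedComponentIn_eq hxU]
      exact hS.subset_connectedComponentIn hxS hSC
    set η := min δ (min (ε / ‖d₁‖) (ε / ‖d₂‖)) with hη
    have hη0 : 0 < η := by positivity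
    have hpt : ∀ h, 0 < h → h < η → P.boundaryPoint (u + h) ∈ closure U ∧
        P.boundaryPoint (u - h) ∈ closure U := by
      intro h h0 h1
      have a1 : h < δ := h1.trans_le (min_le_left _ _)
      have a2 : h < ε / ‖d₁‖ := h1.trans_le ((min_le_right _ _).trans (min_le_left _ _))
      have a3 : h < ε / ‖d₂‖ := h1.trans_le ((min_le_right _ _).trans (min_le_right _ _))
      rw [lt_div_iff₀ hn₁] at a2
      rw [lt_div_iff₀ hn₂] at a3
      rw [hd₁ h ⟨h0.le, a1.le⟩, hd₂ h ⟨h0.le, a1.le⟩]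
      have := hScl h h0 (by rwa [norm_smul, Real.norm_of_nonneg h0.le])
        (by rwa [norm_smul, Real.norm_of_nonneg h0.le])
      exact ⟨closure_mono hSU this.1, closure_mono hSU this.2⟩
    filter_upwards [Ioo_mem_nhds (by linarith : u - η < u) (by linarith : u < u + η)] with v hv
    rcases lt_trichotomy u v with h | h | h
    · have := (hpt (v - u) (by linarith) (by linarith [hv.2])).1
      rwa [add_sub_cancel] at this
    · rwa [← h]
    · have := (hpt (u - v) (by linarith) (by linarith [hv.1])).2
      rwa [sub_sub_cancel] at this
  -- The first boundary point on a segment from `y` to the curve is adherent to `U`.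
  have hne : (P.boundaryPoint ⁻¹' closure U).Nonempty := by
    set γ : ℝ → Plane := fun l => AffineMap.lineMap y (P.boundaryPoint 0) l with hγ
    have hγc : Continuous γ := AffineMap.lineMap_continuous
    obtain ⟨c, hc, hcB, hmin⟩ := exists_first_mem P.isCompact_boundary.isClosed
      hγc.continuousOn zero_le_one (b := 1) (by simpa [hγ] using P.boundaryPoint_mem 0)
    have hc0 : 0 < c := by
      refine hc.1.lt_of_ne ?_
      rintro rfl
      exact hy (by simpa [hγ] using hcB)
    have hsub : γ '' Ico 0 c ⊆ U := by
      refine (isPreconnected_Ico.image _ hγc.continuousOn).subset_connectedComponentIn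
        ⟨0, ⟨le_rfl, hc0⟩, by simp [hγ]⟩ ?_
      rintro _ ⟨l, hl, rfl⟩
      exact hmin l hl
    rw [boundary_eq_range] at hcB
    obtain ⟨u, hu⟩ := hcB
    refine ⟨u, ?_⟩
    rw [mem_preimage, hu]
    refine closure_mono hsub (image_closure_subset_closure_image hγc ⟨c, ?_, rfl⟩)
    rw [closure_Ico hc0.ne]
    exact ⟨hc0.le, le_rfl⟩
  have huniv := IsClopen.eq_univ ⟨hclosed, hopen⟩ hne
  rw [boundary_eq_range]
  rintro _ ⟨u, rfl⟩
  exact huniv.symm.subset (mem_univ u)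

/-- Crossing a chord at an inner point off the opposite chain changes the side angle by `2π`. -/
lemma eventually_sideAngle_jump {s t : ℝ} (hts : t ≤ s + n) {y v : Plane}
    (hy : y ∈ P.boundarySegment s t) (hys : y ≠ P.boundaryPoint s) (hyt : y ≠ P.boundaryPoint t)
    (hyC : y ∉ P.boundaryPoint '' Icc t (s + n))
    (hv : 0 < cross (P.boundaryPoint t - P.boundaryPoint s) v) :
    ∀ᶠ r : ℝ in 𝓝[>] 0, y + r • v ∉ P.sideCurve t (s + n) ∧ y - r • v ∉ P.sideCurve t (s + n) ∧
      P.sideAngle (y + r • v) t (s + n) - P.sideAngle (y - r • v) t (s + n) = 2 * Real.pi := by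
  have hclosed : IsClosed (P.boundaryPoint '' Icc t (s + n)) :=
    (isCompact_Icc.image P.continuous_boundaryPoint).isClosed
  have c1 : Tendsto (fun r : ℝ => y + r • v) (𝓝[>] 0) (𝓝 y) := by
    have : Continuous fun r : ℝ => y + r • v := by fun_prop
    simpa using (this.tendsto 0).mono_left nhdsWithin_le_nhds
  have c2 : Tendsto (fun r : ℝ => y - r • v) (𝓝[>] 0) (𝓝 y) := by
    have : Continuous fun r : ℝ => y - r • v := by fun_prop
    simpa using (this.tendsto 0).mono_left nhdsWithin_le_nhds
  -- The chain is at positive distance from `y`, so its angle is continuous there and only the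
  -- contribution of the segment jumps.
  have hcont := P.continuousAt_chainAngle hts hyC
  have j1 := tendsto_viewAngle_jump hy hys hyt hv
  have j2 := ((hcont.tendsto.comp c1).sub (hcont.tendsto.comp c2)).add j1
  rw [sub_self, zero_add] at j2
  have hpi := Real.pi_pos
  filter_upwards [c1 (hclosed.isOpen_compl.mem_nhds hyC), c2 (hclosed.isOpen_compl.mem_nhds hyC),
    j2 (Ioo_mem_nhds (by linarith : Real.pi < 2 * Real.pi)
      (by linarith : 2 * Real.pi < 3 * Real.pi)), self_mem_nhdsWithin] with r h1 h2 h3 hr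
  have hr0 : (0 : ℝ) < r := hr
  have hper : P.boundaryPoint (s + n) = P.boundaryPoint s := P.boundaryPoint_add_period s
  have hoff : ∀ k : ℝ, k ≠ 0 → y + k • v ∉ segment ℝ (P.boundaryPoint s) (P.boundaryPoint t) := by
    intro k hk hmem
    obtain ⟨a, b, ha, hb, hab, he⟩ := hmem
    obtain ⟨a', b', ha', hb', hab', he'⟩ := hy
    have : cross (P.boundaryPoint t - P.boundaryPoint s) (y + k • v - y) = 0 := by
      rw [← he, ← he']
      obtain rfl : a = 1 - b := by linarith
      obtain rfl : a' = 1 - b' := by linarith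
      simp [cross]; ring
    rw [add_sub_cancel_left] at this
    have h' : cross (P.boundaryPoint t - P.boundaryPoint s) (k • v) =
        k * cross (P.boundaryPoint t - P.boundaryPoint s) v := by simp [cross]; ring
    rw [h'] at this
    rcases mul_eq_zero.1 this with h | h
    exacts [hk h, hv.ne' h]
  have o1 : y + r • v ∉ P.sideCurve t (s + n) := by
    rintro (h | h)
    · exact h1 h
    · rw [boundarySegment, hper, segment_symm] at h
      exact hoff r hr0.ne' h
  have o2 : y - r • v ∉ P.sideCurve t (s + n) := by
    rintro (h | h)
    · exact h2 h
    · rw [boundarySegment, hper, segment_symm, sub_eq_add_neg, ← neg_smul] at h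
      exact hoff (-r) (by linarith) h
  refine ⟨o1, o2, ?_⟩
  -- The difference is a multiple of `2π` between `π` and `3π`.
  have h4 : P.sideAngle (y + r • v) t (s + n) - P.sideAngle (y - r • v) t (s + n) - 2 * Real.pi
      = 0 := by
    have e : P.sideAngle (y + r • v) t (s + n) - P.sideAngle (y - r • v) t (s + n) =
        (P.chainAngle (y + r • v) t (s + n) - P.chainAngle (y - r • v) t (s + n)) +
          (viewAngle (y + r • v) (P.boundaryPoint s) (P.boundaryPoint t) -
          viewAngle (y - r • v) (P.boundaryPoint s) (P.boundaryPoint t)) := by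
      rw [sideAngle, sideAngle, hper]; ring
    refine eq_zero_of_coe_angle_eq_zero ?_ ?_ ?_
    · rw [Real.Angle.coe_sub, Real.Angle.coe_sub, sideAngle_coe hts o1, sideAngle_coe hts o2,
        Real.Angle.coe_two_pi]
      simp
    · rw [e]; have := h3.1; simp only [Function.comp] at this; linarith
    · rw [e]; have := h3.2; simp only [Function.comp] at this; linarith
  linarith

end Polygon

/-! ### Cross products and lines. -/

lemma exists_smul_of_cross_eq_zero {d x : Plane} (hd : d ≠ 0) (h : cross d x = 0) :
    ∃ k : ℝ, x = k • d := by
  have h' : d 0 * x 1 = d 1 * x 0 := by rw [cross] at h; linarith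
  by_cases h0 : d 0 = 0
  · have h1 : d 1 ≠ 0 := by
      intro h1; apply hd; ext i; fin_cases i <;> simp [h0, h1]
    have hx0 : x 0 = 0 := by
      rw [h0, zero_mul] at h'
      exact (mul_eq_zero.1 h'.symm).resolve_left h1
    refine ⟨x 1 / d 1, ?_⟩
    ext i; fin_cases i
    · simp [h0, hx0]
    · simp [h1]
  · refine ⟨x 0 / d 0, ?_⟩
    ext i; fin_cases i
    · simp [h0]
    · simp only [Fin.mk_one, PiLp.smul_apply, smul_eq_mul]
      field_simp
      linarith

lemma cross_smul_right (u v : Plane) (k : ℝ) : cross u (k • v) = k * cross u v := by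
  simp [cross]; ring

lemma cross_smul_left (u v : Plane) (k : ℝ) : cross (k • u) v = k * cross u v := by
  simp [cross]; ring

lemma cross_self_eq_zero (u : Plane) : cross u u = 0 := by simp [cross]; ring

lemma cross_neg_right (u v : Plane) : cross u (-v) = -cross u v := by simp [cross]; ring

lemma cross_neg_left (u v : Plane) : cross (-u) v = -cross u v := by simp [cross]; ring

lemma exists_cross_pos {d : Plane} (hd : d ≠ 0) : ∃ v, 0 < cross d v := by
  refine ⟨!₂[-d 1, d 0], ?_⟩
  have : cross d !₂[-d 1, d 0] = d 0 ^ 2 + d 1 ^ 2 := by simp [cross]; ring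
  rw [this]
  by_contra hc
  have h0 : d 0 = 0 := by nlinarith [sq_nonneg (d 0), sq_nonneg (d 1)]
  have h1 : d 1 = 0 := by nlinarith [sq_nonneg (d 0), sq_nonneg (d 1)]
  apply hd; ext i; fin_cases i <;> simp [h0, h1]

lemma convex_cross_pos (d z : Plane) (σ : ℝ) : Convex ℝ {w | 0 < σ * cross d (w - z)} := by
  intro x hx y hy a b ha hb hab
  rw [mem_ofPred_eq] at *
  have : σ * cross d (a • x + b • y - z) =
      a * (σ * cross d (x - z)) + b * (σ * cross d (y - z)) := by
    obtain rfl : a = 1 - b := by linarith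
    simp [cross]; ring
  rw [this]
  rcases ha.eq_or_lt with rfl | ha
  · obtain rfl : b = 1 := by linarith
    simpa using hy
  · positivity

/-! ### The two sides of the boundary curve, its outside and its orientation. -/

namespace Polygon

variable {n : ℕ} [NeZero n] {P : Polygon Plane n}

/-- There are points on either side of the boundary curve, such that each component of the
complement of the curve contains one of them. -/
lemma IsSimple.exists_two_sides (hP : P.IsSimple) : ∃ p q : Plane, p ∉ P.boundary ℝ ∧
    q ∉ P.boundary ℝ ∧ P.totalAngle p - P.totalAngle q = 2 * Real.pi ∧
    ∀ y ∉ P.boundary ℝ, p ∈ connectedComponentIn (P.boundary ℝ)ᶜ y ∨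
      q ∈ connectedComponentIn (P.boundary ℝ)ᶜ y := by
  have hn := hP.three_le_real
  set d := P.boundaryPoint 1 - P.boundaryPoint 0 with hd
  have hd0 : d ≠ 0 := sub_ne_zero.2 (hP.boundaryPoint_ne zero_lt_one (by linarith)).symm
  have hdn : 0 < ‖d‖ := norm_pos_iff.2 hd0
  have hlin : ∀ u ∈ Icc (0 : ℝ) 1, P.boundaryPoint u = P.boundaryPoint 0 + u • d := by
    intro u hu
    have := P.boundaryPoint_eq_lineMap 0 (t := u) (by simpa using hu.1) (by simpa using hu.2)
    rw [this]
    simp [AffineMap.lineMap_apply_module', hd, add_comm]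
  -- Around the midpoint `z` of an edge the curve is straight, so a small disk minus the curve
  -- consists of two half-disks.
  set z := P.boundaryPoint (1 / 2) with hz
  have hzu : ∀ k : ℝ, |k| ≤ 1 / 2 → P.boundaryPoint (1 / 2 + k) = z + k • d := by
    intro k hk
    rw [abs_le] at hk
    rw [hz, hlin (1 / 2 + k) ⟨by linarith, by linarith⟩, hlin (1 / 2) ⟨by norm_num, by norm_num⟩]
    module
  obtain ⟨ε₀, hε₀, hball⟩ := hP.exists_ball (1 / 2) (show (0 : ℝ) < 1 / 4 by norm_num)
  obtain ⟨ε, hε, hεε, hεd⟩ : ∃ ε > 0, ε ≤ ε₀ ∧ ε ≤ 1 / 4 * ‖d‖ :=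
    ⟨min ε₀ (1 / 4 * ‖d‖), by positivity, min_le_left _ _, min_le_right _ _⟩
  have hline : ∀ x ∈ P.boundary ℝ, dist x z < ε → cross d (x - z) = 0 := by
    intro x hx hxz
    obtain ⟨h, hh, rfl | rfl⟩ := hball x hx (hxz.trans_le hεε)
    · rw [hzu h (abs_le.2 ⟨by linarith [hh.1], by linarith [hh.2]⟩), add_sub_cancel_left,
        cross_smul_right, cross_self_eq_zero, mul_zero]
    · rw [sub_eq_add_neg (1 / 2) h, hzu (-h) (abs_le.2 ⟨by linarith [hh.2], by linarith [hh.1]⟩),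
        add_sub_cancel_left, cross_smul_right, cross_self_eq_zero, mul_zero]
  obtain ⟨v, hv⟩ := exists_cross_pos hd0
  have ht : P.boundaryPoint (3 / 4) - P.boundaryPoint (1 / 4) = (1 / 2 : ℝ) • d := by
    rw [hlin (3 / 4) ⟨by norm_num, by norm_num⟩, hlin (1 / 4) ⟨by norm_num, by norm_num⟩]
    module
  have hseg : P.boundarySegment (1 / 4) (3 / 4) = P.boundaryPoint '' Icc (1 / 4) (3 / 4) :=
    P.segment_boundaryPoint 0 (by norm_num) (by norm_num) (by norm_num)
  -- The middle part of the edge takes the place of a chord. The remaining chain, closed by that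
  -- part, is the whole boundary, so the side angle is the total angle.
  have hjump := P.eventually_sideAngle_jump (s := 1 / 4) (t := 3 / 4) (y := z) (v := v)
    (by linarith) (by rw [hseg]; exact ⟨1 / 2, ⟨by norm_num, by norm_num⟩, rfl⟩)
    (hP.boundaryPoint_ne (by norm_num) (by linarith)).symm
    (hP.boundaryPoint_ne (by norm_num) (by linarith))
    (by
      rintro ⟨w, hw, he⟩
      exact hP.boundaryPoint_ne (by linarith [hw.1]) (by linarith [hw.2]) he.symm)
    (by rw [ht, cross_smul_left]; positivity)
  have hsmall : ∀ᶠ r : ℝ in 𝓝[>] 0, ‖r • v‖ < ε := by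
    have : Continuous fun r : ℝ => ‖r • v‖ := by fun_prop
    have h0 := (this.tendsto 0).mono_left (nhdsWithin_le_nhds (s := Ioi 0))
    simp only [zero_smul, norm_zero] at h0
    exact h0 (gt_mem_nhds hε)
  obtain ⟨r, ⟨hp, hq, hpq⟩, hr, hr0⟩ := (hjump.and (hsmall.and self_mem_nhdsWithin)).exists
  have hr0' : (0 : ℝ) < r := hr0
  have hcov : ∀ x, x ∉ P.sideCurve (3 / 4) (1 / 4 + n) → x ∉ P.boundary ℝ := by
    intro x hx hxC
    obtain ⟨u, hu, rfl⟩ := P.exists_boundaryPoint_eq (1 / 4) hxC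
    rcases le_total u (3 / 4) with h | h
    · refine hx (Or.inr ?_)
      rw [boundarySegment, P.boundaryPoint_add_period, segment_symm]
      change P.boundaryPoint u ∈ P.boundarySegment (1 / 4) (3 / 4)
      rw [hseg]
      exact ⟨u, ⟨hu.1, h⟩, rfl⟩
    · exact hx (Or.inl ⟨u, ⟨h, hu.2.le⟩, rfl⟩)
  have htot : ∀ x, x ∉ P.boundary ℝ → P.totalAngle x = P.sideAngle x (3 / 4) (1 / 4 + n) := by
    intro x hx
    rw [← P.totalAngle_eq hx (s := 1 / 4) (t := 3 / 4) (by norm_num) (by linarith), sideAngle,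
      P.boundaryPoint_add_period, add_comm]
    congr 1
    have e1 : ⌊(1 / 4 : ℝ)⌋ = 0 := Int.floor_eq_iff.2 ⟨by norm_num, by norm_num⟩
    have e2 : ⌈(3 / 4 : ℝ)⌉ = 1 := Int.ceil_eq_iff.2 ⟨by norm_num, by norm_num⟩
    have e3 : Finset.Ico (0 : ℤ) 1 = {0} := rfl
    rw [chainAngle, e1, e2, e3, Finset.sum_singleton, clamp_of_le (by norm_num),
      clamp_of_ge (by norm_num) (by norm_num)]
  have hnot : ∀ σ : ℝ, Metric.ball z ε ∩ {w | 0 < σ * cross d (w - z)} ⊆ (P.boundary ℝ)ᶜ := by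
    rintro σ w ⟨hw, hw'⟩ hwC
    rw [mem_ofPred_eq, hline w hwC hw, mul_zero] at hw'
    exact hw'.false
  have hconn : ∀ σ x y, x ∈ Metric.ball z ε → 0 < σ * cross d (x - z) → y ∈ Metric.ball z ε →
      0 < σ * cross d (y - z) → x ∈ connectedComponentIn (P.boundary ℝ)ᶜ y := by
    intro σ x y hx hx' hy hy'
    exact ((convex_ball z ε).inter (convex_cross_pos d z σ)).isPreconnected.subset_connectedComponentIn
      ⟨hy, hy'⟩ (hnot σ) ⟨hx, hx'⟩
  refine ⟨z + r • v, z - r • v, hcov _ hp, hcov _ hq, ?_, ?_⟩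
  · rw [htot _ (hcov _ hp), htot _ (hcov _ hq), hpq]
  · intro y hy
    -- Every component is adherent to `z`, so it has a point in the disk and contains the half-disk
    -- of that point.
    obtain ⟨x, hxU, hxz⟩ := Metric.mem_closure_iff.1
      (hP.boundary_subset_closure hy (P.boundaryPoint_mem (1 / 2))) ε hε
    rw [dist_comm] at hxz
    have hxC := connectedComponentIn_subset _ _ hxU
    rw [connectedComponentIn_eq hxU]
    have hx0 : cross d (x - z) ≠ 0 := by
      intro h
      obtain ⟨k, hk⟩ := exists_smul_of_cross_eq_zero hd0 h
      rw [dist_eq_norm, hk, norm_smul, Real.norm_eq_abs] at hxz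
      have hk1 : |k| < 1 / 4 := by
        by_contra hc
        nlinarith [not_lt.1 hc]
      refine hxC ?_
      have : x = P.boundaryPoint (1 / 2 + k) := by
        rw [hzu k (by linarith), ← hk]; abel
      rw [this]; exact P.boundaryPoint_mem _
    rcases hx0.lt_or_gt with h | h
    · right
      refine hconn (-1) _ _ ?_ ?_ hxz (by linarith)
      · rw [Metric.mem_ball, dist_eq_norm]; simpa using hr
      · rw [sub_sub_cancel_left, cross_neg_right, cross_smul_right]
        nlinarith
    · left
      refine hconn 1 _ _ ?_ ?_ hxz (by linarith)
      · rw [Metric.mem_ball, dist_eq_norm]; simpa using hr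
      · rw [add_sub_cancel_left, cross_smul_right]
        nlinarith

/-- The outside of the boundary curve. -/
def exterior (P : Polygon Plane n) : Set Plane := P.regionᶜ

omit [NeZero n] in
lemma mem_exterior_iff {x : Plane} : x ∈ P.exterior ↔ x ∉ P.boundary ℝ ∧
    ¬ Bornology.IsBounded (connectedComponentIn (P.boundary ℝ)ᶜ x) := by
  rw [exterior, region, mem_compl_iff, mem_union, mem_ofPred_eq]
  tauto

omit [NeZero n] in
lemma boundary_subset_region : P.boundary ℝ ⊆ P.region := subset_union_left

lemma boundaryPoint_mem_region (P : Polygon Plane n) (u : ℝ) : P.boundaryPoint u ∈ P.region :=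
  boundary_subset_region (P.boundaryPoint_mem u)

omit [NeZero n] in
lemma mem_region_of_mem_component {x y : Plane} (hx : x ∈ P.region) (hxC : x ∉ P.boundary ℝ)
    (hy : y ∈ connectedComponentIn (P.boundary ℝ)ᶜ x) : y ∈ P.region := by
  refine Or.inr ⟨connectedComponentIn_subset _ _ hy, ?_⟩
  rw [← connectedComponentIn_eq hy]
  exact (hx.resolve_left hxC).2

omit [NeZero n] in
lemma component_subset_exterior {x : Plane} (hx : x ∈ P.exterior) :
    connectedComponentIn (P.boundary ℝ)ᶜ x ⊆ P.exterior := by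
  intro y hy
  rw [mem_exterior_iff] at *
  refine ⟨connectedComponentIn_subset _ _ hy, ?_⟩
  rw [← connectedComponentIn_eq hy]
  exact hx.2

lemma isOpen_component (P : Polygon Plane n) (x : Plane) :
    IsOpen (connectedComponentIn (P.boundary ℝ)ᶜ x) :=
  P.isCompact_boundary.isClosed.isOpen_compl.connectedComponentIn

lemma isClosed_region (P : Polygon Plane n) : IsClosed P.region := by
  rw [← isOpen_compl_iff, isOpen_iff_mem_nhds]
  intro x hx
  have hx' : x ∈ P.exterior := hx
  exact mem_of_superset ((P.isOpen_component x).mem_nhds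
    (mem_connectedComponentIn (mem_exterior_iff.1 hx').1)) (component_subset_exterior hx')

/-- From outside a disk around the origin that contains the curve, one can go radially to infinity,
so the component is unbounded there. -/
lemma exists_norm_lt (P : Polygon Plane n) : ∃ R, 0 < R ∧ ∀ x ∈ P.region, ‖x‖ < R := by
  obtain ⟨R, hR, hb⟩ := P.isCompact_boundary.isBounded.exists_pos_norm_lt
  refine ⟨R, hR, fun x hx => ?_⟩
  by_contra hc
  rw [not_lt] at hc
  have hxC : x ∉ P.boundary ℝ := fun h => (hb x h).not_ge hc
  have hbd := (hx.resolve_left hxC).2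
  set γ : ℝ → Plane := fun t => (1 + t) • x with hγ
  have hγc : Continuous γ := by fun_prop
  have hsub : γ '' Ici 0 ⊆ connectedComponentIn (P.boundary ℝ)ᶜ x := by
    refine (isPreconnected_Ici.image _ hγc.continuousOn).subset_connectedComponentIn
      ⟨0, self_mem_Ici, by simp [hγ]⟩ ?_
    rintro _ ⟨t, ht, rfl⟩ hmem
    have h1 := hb _ hmem
    have ht' : 0 ≤ t := ht
    rw [hγ, norm_smul, Real.norm_of_nonneg (by linarith)] at h1
    nlinarith [norm_nonneg x]
  obtain ⟨R', -, hR'⟩ := hbd.exists_pos_norm_lt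
  have hx0 : 0 < ‖x‖ := hR.trans_le hc
  have := hR' (γ (|R'| / ‖x‖)) (hsub ⟨_, by simp only [mem_Ici]; positivity, rfl⟩)
  rw [hγ, norm_smul, Real.norm_of_nonneg (by positivity), add_mul, div_mul_cancel₀ _ hx0.ne'] at this
  linarith [le_abs_self R']

lemma exterior_nonempty (P : Polygon Plane n) : P.exterior.Nonempty := by
  obtain ⟨R, hR, hb⟩ := P.exists_norm_lt
  obtain ⟨x, hx⟩ := exists_norm_eq Plane hR.le
  exact ⟨x, fun h => (hb x h).ne hx⟩

/-- A function with values in `2πℤ` that tends to zero at infinity vanishes on unbounded sets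
on which it is constant. -/
lemma eq_zero_of_unbounded {S : Set Plane} (hS : IsPreconnected S) (hb : ¬ Bornology.IsBounded S)
    {f : Plane → ℝ} (hf : ∀ x ∈ S, ContinuousAt f x) (h0 : ∀ x ∈ S, (f x : Real.Angle) = 0)
    (hlim : Tendsto f (Bornology.cobounded Plane) (𝓝 0)) {x : Plane} (hx : x ∈ S) : f x = 0 := by
  have hpi := Real.pi_pos
  have hev := hlim (Ioo_mem_nhds (by linarith : -(2 * Real.pi) < 0) (by linarith : 0 < 2 * Real.pi))
  have hbd : Bornology.IsBounded (f ⁻¹' Ioo (-(2 * Real.pi)) (2 * Real.pi))ᶜ := by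
    rw [Bornology.isBounded_def, compl_compl]; exact hev
  have : ¬ S ⊆ (f ⁻¹' Ioo (-(2 * Real.pi)) (2 * Real.pi))ᶜ := fun h => hb (hbd.subset h)
  rw [not_subset] at this
  obtain ⟨y, hy, hy'⟩ := this
  rw [notMem_compl_iff] at hy'
  rw [hS.eq_of_coe_angle_eq_zero hf h0 hx hy]
  exact eq_zero_of_coe_angle_eq_zero (h0 y hy) hy'.1 hy'.2

lemma totalAngle_eq_of_mem_component {x y : Plane}
    (hy : y ∈ connectedComponentIn (P.boundary ℝ)ᶜ x) : P.totalAngle y = P.totalAngle x := by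
  have hx : x ∈ (P.boundary ℝ)ᶜ := connectedComponentIn_nonempty_iff.1 ⟨y, hy⟩
  refine isPreconnected_connectedComponentIn.eq_of_coe_angle_eq_zero
    (S := connectedComponentIn (P.boundary ℝ)ᶜ x) (fun w hw => ?_) (fun w hw => ?_) hy
    (mem_connectedComponentIn hx)
  · exact P.continuousAt_totalAngle (connectedComponentIn_subset _ _ hw)
  · exact P.totalAngle_coe (connectedComponentIn_subset _ _ hw)

lemma totalAngle_eq_zero_of_mem_exterior {x : Plane} (hx : x ∈ P.exterior) :
    P.totalAngle x = 0 := by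
  have hx' := mem_exterior_iff.1 hx
  refine eq_zero_of_unbounded isPreconnected_connectedComponentIn hx'.2 (fun w hw => ?_)
    (fun w hw => ?_) (P.tendsto_chainAngle_cobounded 0 n) (mem_connectedComponentIn hx'.1)
  · exact P.continuousAt_totalAngle (connectedComponentIn_subset _ _ hw)
  · exact P.totalAngle_coe (connectedComponentIn_subset _ _ hw)

/-- A simple polygon has an orientation: its boundary winds once around each inner point, always
in the same direction. -/
lemma IsSimple.exists_orientation (hP : P.IsSimple) : ∃ ε : ℝ, |ε| = 2 * Real.pi ∧
    ∀ x ∈ P.region, x ∉ P.boundary ℝ → P.totalAngle x = ε := by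
  obtain ⟨p, q, hp, hq, hpq, hcov⟩ := hP.exists_two_sides
  obtain ⟨o, ho⟩ := P.exterior_nonempty
  have ho' := mem_exterior_iff.1 ho
  have hpi := Real.pi_pos
  -- One of the two test points lies in an unbounded component and has total angle zero. Every
  -- bounded component must then contain the other one, whose total angle differs by `2π`.
  have key : ∀ p' q' : Plane, (∀ y ∉ P.boundary ℝ, p' ∈ connectedComponentIn (P.boundary ℝ)ᶜ y ∨
      q' ∈ connectedComponentIn (P.boundary ℝ)ᶜ y) →
      p' ∈ connectedComponentIn (P.boundary ℝ)ᶜ o → P.totalAngle p' = 0 ∧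
      ∀ x ∈ P.region, x ∉ P.boundary ℝ → P.totalAngle x = P.totalAngle q' := by
    intro p' q' hcov' hp'
    refine ⟨totalAngle_eq_zero_of_mem_exterior (component_subset_exterior ho hp'), ?_⟩
    intro x hx hxC
    rcases hcov' x hxC with h | h
    · exact absurd (mem_region_of_mem_component hx hxC h) (component_subset_exterior ho hp')
    · exact (totalAngle_eq_of_mem_component h).symm
  rcases hcov o ho'.1 with h | h
  · obtain ⟨h1, h2⟩ := key p q hcov h
    refine ⟨P.totalAngle q, ?_, h2⟩
    rw [h1] at hpq
    rw [abs_of_neg (by linarith)]; linarith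
  · obtain ⟨h1, h2⟩ := key q p (fun y hy => (hcov y hy).symm) h
    refine ⟨P.totalAngle p, ?_, h2⟩
    rw [h1] at hpq
    rw [abs_of_pos (by linarith)]; linarith

end Polygon

/-- A linear functional separates `x` from the segment, and going from `x` straight away from `a`
moves further to the side of `x`. -/
lemma exists_ray_avoiding_segment {a b x : Plane} (hx : x ∉ segment ℝ a b) :
    ∃ d : Plane, d ≠ 0 ∧ ∀ r : ℝ, 0 ≤ r → x + r • d ∉ segment ℝ a b := by
  obtain ⟨f, u, h1, h2⟩ := geometric_hahn_banach_point_closed (convex_segment a b)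
    (isCompact_segment_plane a b).isClosed hx
  have ha := h2 a (left_mem_segment ℝ a b)
  refine ⟨x - a, sub_ne_zero.2 fun h => hx (h ▸ left_mem_segment ℝ a b), fun r hr hm => ?_⟩
  have h3 := h2 _ hm
  rw [map_add, map_smul, map_sub, smul_eq_mul] at h3
  nlinarith

/-! ### The two half-polygons of a chord: covering, disjointness, openness. -/

namespace Polygon

variable {n : ℕ} [NeZero n] {P : Polygon Plane n}

/-- The parameters `s` and `t` determine a chord. -/
structure IsChordParam (P : Polygon Plane n) (s t : ℝ) : Prop where
  lt : s < t
  lt_add : t < s + n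
  subset : P.boundarySegment s t ⊆ P.region

lemma boundarySegment_swap (P : Polygon Plane n) (s t : ℝ) :
    P.boundarySegment t (s + n) = P.boundarySegment s t := by
  rw [boundarySegment, P.boundaryPoint_add_period, segment_symm, boundarySegment]

lemma boundarySegment_shift (P : Polygon Plane n) (s t : ℝ) (z : ℤ) :
    P.boundarySegment (s + z * n) (t + z * n) = P.boundarySegment s t := by
  rw [boundarySegment, P.boundaryPoint_add_int_mul, P.boundaryPoint_add_int_mul, boundarySegment]

lemma openHalfPolygon_shift (P : Polygon Plane n) (s t : ℝ) (z : ℤ) :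
    P.openHalfPolygon (s + z * n) (t + z * n) = P.openHalfPolygon s t := by
  have : P.boundaryPoint '' Ioo (s + z * n) (t + z * n) = P.boundaryPoint '' Ioo s t := by
    rw [← image_add_const_Ioo, image_image]
    simp_rw [P.boundaryPoint_add_int_mul]
  rw [openHalfPolygon, this, boundarySegment_shift, openHalfPolygon]

lemma openHalfPolygon_add (P : Polygon Plane n) (s t : ℝ) :
    P.openHalfPolygon (s + n) (t + n) = P.openHalfPolygon s t := by
  simpa using P.openHalfPolygon_shift s t 1

lemma IsChordParam.swap {s t : ℝ} (h : P.IsChordParam s t) : P.IsChordParam t (s + n) :=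
  ⟨h.lt_add, by linarith [h.lt], by rw [boundarySegment_swap]; exact h.subset⟩

lemma openHalfPolygon_subset {s t : ℝ} {x : Plane} (hx : x ∈ P.openHalfPolygon s t) :
    x ∈ P.region \ P.boundarySegment s t := by
  obtain ⟨y, -, hy⟩ := hx
  exact hy.source_mem

lemma openHalfPolygon_of_joinedIn {s t : ℝ} {x y : Plane} (hx : x ∈ P.openHalfPolygon s t)
    (h : JoinedIn (P.region \ P.boundarySegment s t) y x) : y ∈ P.openHalfPolygon s t := by
  obtain ⟨w, hw, hxw⟩ := hx
  exact ⟨w, hw, h.trans hxw⟩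

lemma boundaryPoint_mem_openHalfPolygon {s t u : ℝ} (hu : u ∈ Ioo s t)
    (hK : P.boundaryPoint u ∉ P.boundarySegment s t) :
    P.boundaryPoint u ∈ P.openHalfPolygon s t :=
  ⟨_, ⟨u, hu, rfl⟩, JoinedIn.refl ⟨P.boundaryPoint_mem_region u, hK⟩⟩

lemma joinedIn_of_segment {F : Set Plane} {x y : Plane} (h : segment ℝ x y ⊆ F) :
    JoinedIn F x y :=
  ((convex_segment x y).isPathConnected ⟨x, left_mem_segment ℝ x y⟩).joinedIn x
    (left_mem_segment ℝ x y) y (right_mem_segment ℝ x y) |>.mono h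

lemma segment_ray {x d : Plane} {c : ℝ} (hc : 0 ≤ c) {y : Plane}
    (hy : y ∈ segment ℝ x (x + c • d)) : ∃ r ∈ Icc 0 c, y = x + r • d := by
  rw [segment_eq_image'] at hy
  obtain ⟨l, hl, rfl⟩ := hy
  refine ⟨l * c, ⟨mul_nonneg hl.1 hc, by nlinarith [hl.2]⟩, ?_⟩
  simp only [add_sub_cancel_left, smul_smul]

/-- A ray that starts in the polygon meets the boundary. -/
lemma exists_ray_hit {x d : Plane} (hx : x ∈ P.region) (hd : d ≠ 0) :
    ∃ c : ℝ, 0 ≤ c ∧ x + c • d ∈ P.boundary ℝ ∧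
      (∀ r ∈ Ico 0 c, x + r • d ∈ P.region \ P.boundary ℝ) ∧
      segment ℝ x (x + c • d) ⊆ P.region := by
  obtain ⟨R, hR, hb⟩ := P.exists_norm_lt
  set γ : ℝ → Plane := fun r => x + r • d with hγ
  have hγc : Continuous γ := by fun_prop
  have hin : x ∉ P.boundary ℝ → ∀ c, 0 ≤ c → (∀ r ∈ Ico 0 c, γ r ∉ P.boundary ℝ) →
      ∀ r ∈ Ico 0 c, γ r ∈ P.region := by
    intro hxC c hc h r hr
    refine mem_region_of_mem_component hx hxC ?_
    exact (isPreconnected_Ico.image _ hγc.continuousOn).subset_connectedComponentIn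
      (s := γ '' Ico 0 c) ⟨0, ⟨le_rfl, hr.1.trans_lt hr.2⟩, by simp [hγ]⟩
      (by rintro _ ⟨w, hw, rfl⟩; exact h w hw) ⟨r, hr, rfl⟩
  have hex : ∃ c, 0 ≤ c ∧ γ c ∈ P.boundary ℝ := by
    by_contra! hno
    have hxC : x ∉ P.boundary ℝ := by simpa [hγ] using hno 0 le_rfl
    have hdn : 0 < ‖d‖ := norm_pos_iff.2 hd
    set T := (R + ‖x‖) / ‖d‖
    have hT : 0 ≤ T := by positivity
    have h1 := hb _ (hin hxC (T + 1) (by linarith) (fun r hr => hno r hr.1) T ⟨hT, by linarith⟩)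
    have h2 : ‖T • d‖ ≤ ‖γ T‖ + ‖x‖ := by
      have : T • d = γ T - x := by simp [hγ]
      rw [this]; exact norm_sub_le _ _
    rw [norm_smul, Real.norm_of_nonneg hT, div_mul_cancel₀ _ hdn.ne'] at h2
    linarith
  obtain ⟨c', hc', hcB⟩ := hex
  obtain ⟨c, hc, hcC, hmin⟩ := exists_first_mem P.isCompact_boundary.isClosed hγc.continuousOn hc' hcB
  have hlt : ∀ r ∈ Ico 0 c, γ r ∈ P.region \ P.boundary ℝ := by
    intro r hr
    have hxC : x ∉ P.boundary ℝ := by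
      simpa [hγ] using hmin 0 ⟨le_rfl, hr.1.trans_lt hr.2⟩
    exact ⟨hin hxC c hc.1 hmin r hr, hmin r hr⟩
  refine ⟨c, hc.1, hcC, hlt, fun y hy => ?_⟩
  obtain ⟨r, hr, rfl⟩ := segment_ray hc.1 hy
  rcases hr.2.lt_or_eq with h | rfl
  · exact (hlt r ⟨hr.1, h⟩).1
  · exact boundary_subset_region hcC

/-- A boundary point off the chord lies on one of the two chains. -/
lemma IsChordParam.boundary_cases {s t : ℝ} (h : P.IsChordParam s t) {y : Plane}
    (hy : y ∈ P.boundary ℝ) (hK : y ∉ P.boundarySegment s t) :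
    (∃ u ∈ Ioo s t, P.boundaryPoint u = y) ∨ ∃ u ∈ Ioo t (s + n), P.boundaryPoint u = y := by
  obtain ⟨u, hu, rfl⟩ := P.exists_boundaryPoint_eq s hy
  have h1 : s ≠ u := by rintro rfl; exact hK (left_mem_segment ℝ _ _)
  have h2 : u ≠ t := by rintro rfl; exact hK (right_mem_segment ℝ _ _)
  rcases h2.lt_or_gt with h3 | h3
  · exact Or.inl ⟨u, ⟨hu.1.lt_of_ne h1, h3⟩, rfl⟩
  · exact Or.inr ⟨u, ⟨h3, hu.2⟩, rfl⟩

/-- The two open half-polygons of a chord cover the polygon minus the chord. -/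
lemma IsChordParam.mem_or_mem {s t : ℝ} (h : P.IsChordParam s t) {x : Plane} (hx : x ∈ P.region)
    (hK : x ∉ P.boundarySegment s t) :
    x ∈ P.openHalfPolygon s t ∨ x ∈ P.openHalfPolygon t (s + n) := by
  obtain ⟨d, hd, hray⟩ := exists_ray_avoiding_segment hK
  obtain ⟨c, hc, hcC, -, hseg⟩ := exists_ray_hit hx hd
  have hK' : segment ℝ x (x + c • d) ⊆ P.region \ P.boundarySegment s t := by
    intro y hy
    refine ⟨hseg hy, ?_⟩
    obtain ⟨r, hr, rfl⟩ := segment_ray hc hy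
    exact hray r hr.1
  have hj := joinedIn_of_segment hK'
  rcases h.boundary_cases hcC (hray c hc) with ⟨u, hu, he⟩ | ⟨u, hu, he⟩
  · exact Or.inl ⟨_, ⟨u, hu, he⟩, hj⟩
  · refine Or.inr ⟨_, ⟨u, hu, he⟩, ?_⟩
    rwa [boundarySegment_swap]

lemma IsChordParam.sideCurve_subset {s t : ℝ} (h : P.IsChordParam s t) :
    P.sideCurve s t ⊆ P.region := by
  rintro x (⟨u, -, rfl⟩ | hx)
  · exact P.boundaryPoint_mem_region u
  · exact h.subset hx

/-- The side curve lies in the polygon, so the unbounded component of `x` avoids it, and the angle,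
constant there, tends to zero at infinity. -/
lemma IsChordParam.sideAngle_exterior {s t : ℝ} (h : P.IsChordParam s t) {x : Plane}
    (hx : x ∈ P.exterior) : x ∉ P.sideCurve s t ∧ P.sideAngle x s t = 0 := by
  have hsub : ∀ w ∈ connectedComponentIn (P.boundary ℝ)ᶜ x, w ∉ P.sideCurve s t :=
    fun w hw hw' => component_subset_exterior hx hw (h.sideCurve_subset hw')
  have hx' := mem_exterior_iff.1 hx
  have hxm := mem_connectedComponentIn (F := (P.boundary ℝ)ᶜ) hx'.1
  refine ⟨hsub x hxm, ?_⟩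
  exact eq_zero_of_unbounded (f := fun y => P.sideAngle y s t) isPreconnected_connectedComponentIn
    hx'.2 (fun w hw => continuousAt_sideAngle h.lt.le (hsub w hw))
    (fun w hw => sideAngle_coe h.lt.le (hsub w hw)) (P.tendsto_sideAngle_cobounded s t) hxm

lemma IsSimple.boundary_subset_closure_exterior (hP : P.IsSimple) :
    P.boundary ℝ ⊆ closure P.exterior := by
  obtain ⟨o, ho⟩ := P.exterior_nonempty
  exact (hP.boundary_subset_closure (mem_exterior_iff.1 ho).1).trans
    (closure_mono (component_subset_exterior ho))

/-- A small disk around the point misses the side curve but contains exterior points, where the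
angle is zero. -/
lemma IsSimple.sideAngle_boundaryPoint (hP : P.IsSimple) {s t : ℝ} (h : P.IsChordParam s t) {v : ℝ}
    (hv : v ∈ Ioo t (s + n)) (hK : P.boundaryPoint v ∉ P.boundarySegment s t) :
    P.boundaryPoint v ∉ P.sideCurve s t ∧ P.sideAngle (P.boundaryPoint v) s t = 0 := by
  have hnot : P.boundaryPoint v ∉ P.sideCurve s t := by
    rintro (⟨u, hu, he⟩ | h')
    · exact hP.boundaryPoint_ne (by linarith [hu.2, hv.1]) (by linarith [hu.1, hv.2]) he
    · exact hK h'
  refine ⟨hnot, ?_⟩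
  obtain ⟨ε, hε, hb⟩ := Metric.isOpen_iff.1 (P.isClosed_sideCurve s t).isOpen_compl _ hnot
  obtain ⟨x, hx, hxd⟩ := Metric.mem_closure_iff.1
    (hP.boundary_subset_closure_exterior (P.boundaryPoint_mem v)) ε hε
  rw [dist_comm] at hxd
  have hs := (convex_ball (P.boundaryPoint v) ε).isPreconnected.eq_of_coe_angle_eq_zero
    (f := fun y => P.sideAngle y s t) (fun w hw => continuousAt_sideAngle h.lt.le (hb hw))
    (fun w hw => sideAngle_coe h.lt.le (hb hw)) (Metric.mem_ball_self hε) hxd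
  exact hs.trans (h.sideAngle_exterior hx).2

lemma IsSimple.chain_inter_subset (hP : P.IsSimple) {s t : ℝ} :
    P.boundaryPoint '' Icc s t ∩ P.boundaryPoint '' Icc t (s + n) ⊆
      {P.boundaryPoint s, P.boundaryPoint t} := by
  rintro x ⟨⟨u, hu, rfl⟩, ⟨v, hv, he⟩⟩
  by_contra hc
  rw [mem_insert_iff, mem_singleton_iff, not_or] at hc
  have h1 : u ≠ s := by rintro rfl; exact hc.1 rfl
  have h2 : u ≠ t := by rintro rfl; exact hc.2 rfl
  exact hP.boundaryPoint_ne (hu.2.lt_of_ne h2 |>.trans_le hv.1)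
    (by linarith [hv.2, hu.1.lt_of_ne h1.symm]) he.symm

lemma IsSimple.totalAngle_ne_zero (hP : P.IsSimple) {x : Plane} (hx : x ∈ P.region)
    (hxC : x ∉ P.boundary ℝ) : P.totalAngle x ≠ 0 := by
  obtain ⟨ε, hε, h⟩ := hP.exists_orientation
  rw [h x hx hxC]
  rintro rfl
  rw [abs_zero] at hε
  linarith [Real.pi_pos]

/-- A point on one side of a chord is not encircled by the curve around the other side. -/
lemma IsSimple.sideAngle_of_mem_openHalfPolygon (hP : P.IsSimple) {s t : ℝ}
    (h : P.IsChordParam s t) {x : Plane} (hx : x ∈ P.openHalfPolygon t (s + n)) :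
    x ∉ P.sideCurve s t ∧ P.sideAngle x s t = 0 := by
  obtain ⟨_, ⟨v, hv, rfl⟩, hj⟩ := hx
  rw [boundarySegment_swap] at hj
  obtain ⟨γ, hγ⟩ := hj.symm
  set g : ℝ → Plane := fun τ => γ.extend τ with hg
  have hgc : Continuous g := γ.extend.continuous
  have hgm : ∀ τ, g τ ∈ P.region \ P.boundarySegment s t := by
    intro τ
    obtain ⟨w, hw⟩ : g τ ∈ range γ := by rw [← γ.extend_range]; exact mem_range_self τ
    rw [← hw]; exact hγ w
  have hg0 : g 0 = P.boundaryPoint v := γ.extend_zero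
  have hg1 : g 1 = x := γ.extend_one
  have hA : IsClosed (P.boundaryPoint '' Icc s t) :=
    (isCompact_Icc.image P.continuous_boundaryPoint).isClosed
  have hB : IsClosed (P.boundaryPoint '' Icc t (s + n)) :=
    (isCompact_Icc.image P.continuous_boundaryPoint).isClosed
  have hp := hP.sideAngle_boundaryPoint h hv (hg0 ▸ (hgm 0).2)
  have hconst : ∀ S : Set ℝ, IsPreconnected S → (∀ τ ∈ S, g τ ∉ P.boundaryPoint '' Icc s t) →
      ∀ τ ∈ S, ∀ τ' ∈ S, P.sideAngle (g τ) s t = P.sideAngle (g τ') s t := by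
    intro S hS hSA τ hτ τ' hτ'
    have hn : ∀ w ∈ g '' S, w ∉ P.sideCurve s t := by
      rintro _ ⟨w, hw, rfl⟩ (h' | h')
      exacts [hSA w hw h', (hgm w).2 h']
    exact (hS.image g hgc.continuousOn).eq_of_coe_angle_eq_zero (f := fun y => P.sideAngle y s t)
      (fun w hw => continuousAt_sideAngle h.lt.le (hn w hw))
      (fun w hw => sideAngle_coe h.lt.le (hn w hw)) ⟨τ, hτ, rfl⟩ ⟨τ', hτ', rfl⟩
  -- A path that starts on one chain and avoids the chord cannot reach the other chain. Otherwise
  -- take the first hit `c` and the last earlier time `c₀` on the own chain. In between the path is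
  -- off the boundary; one side angle is zero as at the start, the other is zero as at `c`. Their
  -- sum is the total angle of an inner point, which is not zero.
  have hhit : ∀ T ∈ Icc (0 : ℝ) 1, g T ∉ P.boundaryPoint '' Icc s t := by
    intro T hT hTA
    obtain ⟨c, hc, hcA, hmin⟩ := exists_first_mem hA hgc.continuousOn hT.1 hTA
    obtain ⟨c₀, hc₀, hcB, hmax⟩ := exists_last_mem hB hgc.continuousOn hc.1
      (by rw [hg0]; exact ⟨v, ⟨hv.1.le, hv.2.le⟩, rfl⟩)
    have hends : ∀ τ, g τ ∉ ({P.boundaryPoint s, P.boundaryPoint t} : Set Plane) := by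
      rintro τ (h' | h')
      · exact (hgm τ).2 (h' ▸ left_mem_segment ℝ _ _)
      · exact (hgm τ).2 (h' ▸ right_mem_segment ℝ _ _)
    have hlt : c₀ < c := by
      refine hc₀.2.lt_of_ne ?_
      rintro rfl
      exact hends _ (hP.chain_inter_subset ⟨hcA, hcB⟩)
    obtain ⟨m, hm⟩ := exists_between hlt
    have hm0 : 0 ≤ m := hc₀.1.trans hm.1.le
    have e1 : P.sideAngle (g m) s t = 0 := by
      rw [hconst (Ico 0 c) isPreconnected_Ico hmin m ⟨hm0, hm.2⟩ 0 ⟨le_rfl, hm0.trans_lt hm.2⟩,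
        hg0, hp.2]
    have e2 : P.sideAngle (g m) t (s + n) = 0 := by
      have hn : ∀ w ∈ g '' Ioc c₀ c, w ∉ P.sideCurve t (s + n) := by
        rintro _ ⟨w, hw, rfl⟩ (h' | h')
        · exact hmax w hw h'
        · rw [boundarySegment_swap] at h'; exact (hgm w).2 h'
      rw [(isPreconnected_Ioc.image g hgc.continuousOn).eq_of_coe_angle_eq_zero
        (f := fun y => P.sideAngle y t (s + n))
        (fun w hw => continuousAt_sideAngle h.swap.lt.le (hn w hw))
        (fun w hw => sideAngle_coe h.swap.lt.le (hn w hw)) ⟨m, ⟨hm.1, hm.2.le⟩, rfl⟩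
        ⟨c, ⟨hlt, le_rfl⟩, rfl⟩]
      obtain ⟨w, hw, hwe⟩ := hcA
      have hws : s ≠ w := by rintro rfl; exact hends c (Or.inl hwe.symm)
      have hwt : w ≠ t := by rintro rfl; exact hends c (Or.inr hwe.symm)
      rw [← hwe, ← P.boundaryPoint_add_period]
      refine (hP.sideAngle_boundaryPoint h.swap ⟨?_, ?_⟩ ?_).2
      · linarith [hw.1.lt_of_ne hws]
      · linarith [hw.2.lt_of_ne hwt]
      · rw [boundarySegment_swap, P.boundaryPoint_add_period, hwe]; exact (hgm c).2
    have hmC : g m ∉ P.boundary ℝ := by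
      intro hC
      rw [P.boundary_eq_image_Icc s] at hC
      obtain ⟨w, hw, hwe⟩ := hC
      rcases le_total w t with h' | h'
      · exact hmin m ⟨hm0, hm.2⟩ ⟨w, ⟨hw.1, h'⟩, hwe⟩
      · exact hmax m ⟨hm.1, hm.2.le⟩ ⟨w, ⟨h', hw.2⟩, hwe⟩
    refine hP.totalAngle_ne_zero (hgm m).1 hmC ?_
    rw [← P.sideAngle_add hmC h.lt.le h.lt_add.le (hgm m).2, e1, e2, add_zero]
  constructor
  · rintro (h' | h')
    · exact hhit 1 ⟨zero_le_one, le_rfl⟩ (hg1 ▸ h')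
    · exact (hgm 1).2 (hg1 ▸ h')
  · rw [← hg1, hconst (Icc 0 1) isPreconnected_Icc hhit 1 ⟨zero_le_one, le_rfl⟩ 0
      ⟨le_rfl, zero_le_one⟩, hg0, hp.2]

lemma IsSimple.sideAngle_of_mem_openHalfPolygon' (hP : P.IsSimple) {s t : ℝ}
    (h : P.IsChordParam s t) {x : Plane} (hx : x ∈ P.openHalfPolygon s t) :
    x ∉ P.sideCurve t (s + n) ∧ P.sideAngle x t (s + n) = 0 :=
  hP.sideAngle_of_mem_openHalfPolygon h.swap (by rwa [openHalfPolygon_add])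

lemma IsSimple.notMem_boundary_of_notMem {s t : ℝ} {x : Plane}
    (h1 : x ∉ P.sideCurve s t) (h2 : x ∉ P.sideCurve t (s + n)) : x ∉ P.boundary ℝ := by
  rw [P.boundary_eq_image_Icc s]
  rintro ⟨w, hw, rfl⟩
  rcases le_total w t with h' | h'
  · exact h1 (Or.inl ⟨w, ⟨hw.1, h'⟩, rfl⟩)
  · exact h2 (Or.inl ⟨w, ⟨h', hw.2⟩, rfl⟩)

/-- The two open half-polygons of a chord are disjoint. -/
lemma IsSimple.disjoint_openHalfPolygon (hP : P.IsSimple) {s t : ℝ} (h : P.IsChordParam s t) :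
    Disjoint (P.openHalfPolygon s t) (P.openHalfPolygon t (s + n)) := by
  rw [Set.disjoint_left]
  intro x hx hx'
  obtain ⟨a1, a2⟩ := hP.sideAngle_of_mem_openHalfPolygon h hx'
  obtain ⟨b1, b2⟩ := hP.sideAngle_of_mem_openHalfPolygon' h hx
  have hxC := IsSimple.notMem_boundary_of_notMem a1 b1
  refine hP.totalAngle_ne_zero (openHalfPolygon_subset hx).1 hxC ?_
  rw [← P.sideAngle_add hxC h.lt.le h.lt_add.le (openHalfPolygon_subset hx).2, a2, b2, add_zero]

/-- This turns membership, defined by paths, into the vanishing of a locally constant angle, from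
which relative openness follows. -/
lemma IsSimple.mem_openHalfPolygon_iff (hP : P.IsSimple) {s t : ℝ} (h : P.IsChordParam s t)
    {x : Plane} (hx : x ∈ P.region) : x ∈ P.openHalfPolygon t (s + n) ↔
      x ∉ P.sideCurve s t ∧ P.sideAngle x s t = 0 := by
  refine ⟨hP.sideAngle_of_mem_openHalfPolygon h, fun ⟨a1, a2⟩ => ?_⟩
  have hK : x ∉ P.boundarySegment s t := fun h' => a1 (Or.inr h')
  refine (h.mem_or_mem hx hK).resolve_left fun hx' => ?_
  obtain ⟨b1, b2⟩ := hP.sideAngle_of_mem_openHalfPolygon' h hx'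
  have hxC := IsSimple.notMem_boundary_of_notMem a1 b1
  refine hP.totalAngle_ne_zero hx hxC ?_
  rw [← P.sideAngle_add hxC h.lt.le h.lt_add.le hK, a2, b2, add_zero]

/-- Open half-polygons are relatively open. -/
lemma IsSimple.eventually_mem_openHalfPolygon_swap (hP : P.IsSimple) {s t : ℝ}
    (h : P.IsChordParam s t) {x : Plane} (hx : x ∈ P.openHalfPolygon t (s + n)) :
    ∀ᶠ y in 𝓝 x, y ∈ P.region → y ∈ P.openHalfPolygon t (s + n) := by
  obtain ⟨a1, a2⟩ := hP.sideAngle_of_mem_openHalfPolygon h hx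
  obtain ⟨ε, hε, hb⟩ := Metric.isOpen_iff.1 (P.isClosed_sideCurve s t).isOpen_compl _ a1
  filter_upwards [Metric.ball_mem_nhds x hε] with y hy hyr
  rw [hP.mem_openHalfPolygon_iff h hyr]
  refine ⟨hb hy, ?_⟩
  rw [← a2]
  exact (convex_ball x ε).isPreconnected.eq_of_coe_angle_eq_zero
    (f := fun y => P.sideAngle y s t) (fun w hw => continuousAt_sideAngle h.lt.le (hb hw))
    (fun w hw => sideAngle_coe h.lt.le (hb hw)) hy (Metric.mem_ball_self hε)

end Polygon

/-! ### Lengths of paths -/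

lemma exists_path_of_continuousOn {f : ℝ → Plane} (hf : ContinuousOn f (Icc 0 1)) {x y : Plane}
    (h0 : f 0 = x) (h1 : f 1 = y) : ∃ γ : Path x y, range γ = f '' Icc 0 1 ∧
      eVariationOn γ univ = eVariationOn f (Icc 0 1) := by
  refine ⟨⟨⟨fun t => f t, continuousOn_iff_continuous_domRestrict.1 hf⟩, by simpa, by simpa⟩, ?_, ?_⟩
  · ext z
    constructor
    · rintro ⟨t, rfl⟩; exact ⟨t, t.2, rfl⟩
    · rintro ⟨t, ht, rfl⟩; exact ⟨⟨t, ht⟩, rfl⟩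
  · have := eVariationOn.comp_eq_of_monotoneOn f (t := (univ : Set unitInterval)) Subtype.val
      fun _ _ _ _ h => h
    rw [image_univ, Subtype.range_coe] at this
    exact this

lemma eVariationOn_path_eq_extend {x y : Plane} (γ : Path x y) :
    eVariationOn γ univ = eVariationOn (fun τ : ℝ => γ.extend τ) (Icc 0 1) := by
  have := eVariationOn.comp_eq_of_monotoneOn (fun τ : ℝ => γ.extend τ)
    (t := (univ : Set unitInterval)) Subtype.val fun _ _ _ _ h => h
  rw [image_univ, Subtype.range_coe] at this
  rw [← this]
  congr 1
  ext1 t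
  simp

lemma eVariationOn_trans_le {x y z : Plane} (γ : Path x y) (γ' : Path y z) :
    eVariationOn (γ.trans γ') univ ≤ eVariationOn γ univ + eVariationOn γ' univ := by
  have hh : (1 / 2 : ℝ) ∈ unitInterval := ⟨by norm_num, by norm_num⟩
  have hu : (univ : Set unitInterval) = Iic ⟨1 / 2, hh⟩ ∪ Ici ⟨1 / 2, hh⟩ := Iic_union_Ici.symm
  have hsplit := eVariationOn.union (γ.trans γ') (isGreatest_Iic (a := (⟨1 / 2, hh⟩ : unitInterval)))
    (isLeast_Ici (a := (⟨1 / 2, hh⟩ : unitInterval)))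
  rw [hu, hsplit, ← hu]
  refine add_le_add ?_ ?_
  · have hφ : Monotone fun t : unitInterval => projIcc (0 : ℝ) 1 zero_le_one (2 * t) :=
      fun a b hab => monotone_projIcc _ (by have : (a : ℝ) ≤ b := hab; linarith)
    refine le_trans (le_of_eq (eVariationOn.eq_of_eqOn ?_)) (eVariationOn.comp_le_of_monotoneOn γ _
      (hφ.monotoneOn (Iic ⟨1 / 2, hh⟩)) (mapsTo_univ _ _))
    intro t ht
    have ht' : (t : ℝ) ≤ 1 / 2 := ht
    rw [Path.trans_apply, dif_pos ht', Function.comp_apply, projIcc_of_mem]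
  · have hφ : Monotone fun t : unitInterval => projIcc (0 : ℝ) 1 zero_le_one (2 * t - 1) :=
      fun a b hab => monotone_projIcc _ (by have : (a : ℝ) ≤ b := hab; linarith)
    refine le_trans (le_of_eq (eVariationOn.eq_of_eqOn ?_)) (eVariationOn.comp_le_of_monotoneOn γ' _
      (hφ.monotoneOn (Ici ⟨1 / 2, hh⟩)) (mapsTo_univ _ _))
    intro t ht
    have ht' : 1 / 2 ≤ (t : ℝ) := ht
    have hm : 2 * (t : ℝ) - 1 ∈ Icc (0 : ℝ) 1 := ⟨by linarith, by linarith [t.2.2]⟩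
    rw [Path.trans_apply, Function.comp_apply, projIcc_of_mem _ hm]
    split_ifs with h
    · have h2 : (t : ℝ) = 1 / 2 := le_antisymm h ht'
      simp [h2]
    · rfl

lemma eVariationOn_segment_le (a b : Plane) {c d : ℝ} (h : c < d) :
    eVariationOn (fun τ : ℝ => a + ((τ - c) / (d - c)) • (b - a)) (Icc c d) ≤ edist a b := by
  have hL : LipschitzWith ‖b - a‖₊ fun l : ℝ => a + l • (b - a) := by
    refine LipschitzWith.of_dist_le_mul fun u v => ?_
    rw [dist_add_left, dist_eq_norm, ← sub_smul, norm_smul, mul_comm, dist_eq_norm]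
    rfl
  have hφ : MonotoneOn (fun τ : ℝ => (τ - c) / (d - c)) (Icc c d) := fun u _ v _ huv =>
    div_le_div_of_nonneg_right (by linarith) (by linarith)
  have h1 := (hL.lipschitzOnWith (s := univ)).comp_eVariationOn_le
    (g := fun τ : ℝ => (τ - c) / (d - c)) (s := Icc c d) (mapsTo_univ _ _)
  have h2 := hφ.eVariationOn_eq (a := c) (b := d) ⟨le_rfl, h.le⟩ ⟨h.le, le_rfl⟩
  rw [inter_self, sub_self, zero_div, div_self (by linarith), sub_zero, ENNReal.ofReal_one] at h2
  refine h1.trans ((mul_le_mul_right h2.le _).trans ?_)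
  rw [mul_one, edist_comm, edist_eq_enorm_sub]
  rfl

lemma exists_path_segment {F : Set Plane} {a b : Plane} (h : segment ℝ a b ⊆ F) :
    ∃ γ : Path a b, range γ ⊆ F ∧ eVariationOn γ univ ≠ ⊤ := by
  obtain ⟨γ, h1, h2⟩ := exists_path_of_continuousOn (f := fun τ : ℝ => a + ((τ - 0) / (1 - 0)) • (b - a))
    (by fun_prop) (x := a) (y := b) (by simp) (by simp)
  refine ⟨γ, ?_, ?_⟩
  · rw [h1]
    rintro _ ⟨t, ht, rfl⟩
    refine h ?_
    rw [segment_eq_image']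
    exact ⟨t, ht, by simp⟩
  · rw [h2]
    exact ne_top_of_le_ne_top (edist_ne_top a b) (eVariationOn_segment_le a b zero_lt_one)

lemma exists_path_of_reflTransGen {F : Set Plane} {a b : Plane} (ha : a ∈ F)
    (h : Relation.ReflTransGen (fun x y => segment ℝ x y ⊆ F) a b) :
    ∃ γ : Path a b, range γ ⊆ F ∧ eVariationOn γ univ ≠ ⊤ := by
  induction h with
  | refl =>
    refine exists_path_segment ?_
    rw [segment_same]; simpa using ha
  | tail _ h ih =>
    obtain ⟨γ, h1, h2⟩ := ih
    obtain ⟨γ', h1', h2'⟩ := exists_path_segment h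
    refine ⟨γ.trans γ', ?_, ne_top_of_le_ne_top (ENNReal.add_ne_top.2 ⟨h2, h2'⟩)
      (eVariationOn_trans_le γ γ')⟩
    rw [Path.trans_range]
    exact union_subset h1 h1'

/-- Replacing a part of a path by the straight segment makes it shorter if the part leaves the
segment. -/
lemma exists_shortcut {x y : Plane} (γ : Path x y) {c m d : ℝ} (hc : 0 ≤ c) (hcm : c ≤ m)
    (hmd : m ≤ d) (hd : d ≤ 1) (hm : γ.extend m ∉ segment ℝ (γ.extend c) (γ.extend d))
    (hfin : eVariationOn γ univ ≠ ⊤) :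
    ∃ γ' : Path x y, range γ' ⊆ range γ ∪ segment ℝ (γ.extend c) (γ.extend d) ∧
      eVariationOn γ' univ < eVariationOn γ univ := by
  set g : ℝ → Plane := fun τ => γ.extend τ with hg
  have hgc : Continuous g := γ.extend.continuous
  have hcm' : c < m := hcm.lt_of_ne (by rintro rfl; exact hm (left_mem_segment ℝ _ _))
  have hmd' : m < d := hmd.lt_of_ne (by rintro rfl; exact hm (right_mem_segment ℝ _ _))
  have hcd : c < d := hcm'.trans hmd'
  set l : ℝ → Plane := fun τ => g c + ((τ - c) / (d - c)) • (g d - g c) with hl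
  have hlc : l c = g c := by simp [hl]
  have hld : l d = g d := by
    have : d - c ≠ 0 := by linarith
    simp [hl, div_self this]
  set f : ℝ → Plane := fun τ => if τ ≤ c then g τ else if τ ≤ d then l τ else g τ with hf
  have hfc : Continuous f := by
    refine Continuous.if_le hgc (Continuous.if_le ?_ hgc continuous_id continuous_const ?_)
      continuous_id continuous_const ?_
    · fun_prop
    · rintro τ rfl; exact hld
    · rintro τ rfl
      rw [if_pos hcd.le, hlc]
  have e1 : EqOn f g (Icc 0 c) := fun τ hτ => if_pos hτ.2
  have e2 : EqOn f l (Icc c d) := by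
    intro τ hτ
    rcases hτ.1.eq_or_lt with rfl | h
    · simp only [hf, le_refl, if_true]; exact hlc.symm
    · simp only [hf, if_neg (not_le.2 h), if_pos hτ.2]
  have e3 : EqOn f g (Icc d 1) := by
    intro τ hτ
    have h : ¬ τ ≤ c := not_le.2 (hcd.trans_le hτ.1)
    rcases hτ.1.eq_or_lt with rfl | h'
    · simp only [hf, if_neg h, le_refl, if_true]; exact hld
    · simp only [hf, if_neg h, if_neg (not_le.2 h')]
  have hsplit : ∀ k : ℝ → Plane, eVariationOn k (Icc 0 1) =
      eVariationOn k (Icc 0 c) + eVariationOn k (Icc c d) + eVariationOn k (Icc d 1) := by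
    intro k
    have a1 := eVariationOn.Icc_add_Icc k (s := univ) hc hcd.le (mem_univ _)
    have a2 := eVariationOn.Icc_add_Icc k (s := univ) (hc.trans hcd.le) hd (mem_univ _)
    simp only [univ_inter] at a1 a2
    rw [a1, a2]
  obtain ⟨γ', h1, h2⟩ := exists_path_of_continuousOn (x := x) (y := y) (hfc.continuousOn (s := Icc 0 1))
    (by rw [e1 ⟨le_rfl, hc⟩]; exact γ.extend_zero) (by rw [e3 ⟨hd, le_rfl⟩]; exact γ.extend_one)
  refine ⟨γ', ?_, ?_⟩
  · rw [h1]
    rintro _ ⟨τ, hτ, rfl⟩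
    have hgr : g τ ∈ range γ := by rw [← γ.extend_range]; exact mem_range_self τ
    rcases le_total τ c with h | h
    · rw [e1 ⟨hτ.1, h⟩]; exact Or.inl hgr
    rcases le_total τ d with h' | h'
    · rw [e2 ⟨h, h'⟩]
      refine Or.inr ?_
      rw [segment_eq_image']
      exact ⟨(τ - c) / (d - c), ⟨div_nonneg (by linarith) (by linarith),
        (div_le_one (by linarith)).2 (by linarith)⟩, rfl⟩
    · rw [e3 ⟨h', hτ.2⟩]; exact Or.inl hgr
  · rw [h2, eVariationOn_path_eq_extend γ]
    rw [eVariationOn_path_eq_extend] at hfin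
    change eVariationOn g (Icc 0 1) ≠ ⊤ at hfin
    change _ < eVariationOn g (Icc 0 1)
    rw [hsplit g] at hfin ⊢
    rw [hsplit f, eVariationOn.eq_of_eqOn e1, eVariationOn.eq_of_eqOn e2, eVariationOn.eq_of_eqOn e3]
    rw [ENNReal.add_ne_top, ENNReal.add_ne_top] at hfin
    refine ENNReal.add_lt_add_right hfin.2 (ENNReal.add_lt_add_left hfin.1.1 ?_)
    refine (eVariationOn_segment_le _ _ hcd).trans_lt ?_
    have b1 : edist (g c) (g m) + edist (g m) (g d) ≤ eVariationOn g (Icc c d) := by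
      have := eVariationOn.Icc_add_Icc g (s := univ) hcm hmd (mem_univ _)
      simp only [univ_inter] at this
      rw [← this]
      exact add_le_add (eVariationOn.edist_le g ⟨le_rfl, hcm⟩ ⟨hcm, le_rfl⟩)
        (eVariationOn.edist_le g ⟨le_rfl, hmd⟩ ⟨hmd, le_rfl⟩)
    refine lt_of_lt_of_le ?_ b1
    -- Equality in the triangle inequality would put `g m` on the segment.
    have b2 : dist (g c) (g d) < dist (g c) (g m) + dist (g m) (g d) := by
      refine (dist_triangle _ _ _).lt_of_ne fun h => hm ?_
      rw [mem_segment_iff_wbtw, ← dist_add_dist_eq_iff]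
      exact h.symm
    rw [edist_dist, edist_dist, edist_dist, ← ENNReal.ofReal_add dist_nonneg dist_nonneg]
    exact ENNReal.ofReal_lt_ofReal_iff_of_nonneg dist_nonneg |>.2 b2

/-- Each segment contains the endpoints of the other, so the lengths agree. The parameters of `a`
and `b` on the segment from `c` to `d` then have distance `1` and must be `0` and `1`. -/
lemma segment_eq_segment {a b c d : Plane} (hab : a ≠ b) (h : segment ℝ a b = segment ℝ c d) :
    (a = c ∧ b = d) ∨ (a = d ∧ b = c) := by
  have dist_le : ∀ a b c d : Plane, a ∈ segment ℝ c d → b ∈ segment ℝ c d →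
      ∃ α ∈ Icc (0 : ℝ) 1, ∃ β ∈ Icc (0 : ℝ) 1, a = c + α • (d - c) ∧ b = c + β • (d - c) ∧
        dist a b = |α - β| * dist c d := by
    intro a b c d ha hb
    rw [segment_eq_image'] at ha hb
    obtain ⟨α, hα, rfl⟩ := ha
    obtain ⟨β, hβ, rfl⟩ := hb
    refine ⟨α, hα, β, hβ, rfl, rfl, ?_⟩
    simp only [dist_add_left]
    rw [dist_eq_norm, ← sub_smul, norm_smul, dist_comm c d, dist_eq_norm, Real.norm_eq_abs]
  obtain ⟨α, hα, β, hβ, ea, eb, h1⟩ := dist_le a b c d (h ▸ left_mem_segment ℝ a b)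
    (h ▸ right_mem_segment ℝ a b)
  obtain ⟨α', hα', β', hβ', -, -, h2⟩ := dist_le c d a b (h ▸ left_mem_segment ℝ c d)
    (h ▸ right_mem_segment ℝ c d)
  have hd : 0 < dist a b := dist_pos.2 hab
  have hd' : 0 < dist c d := by
    refine dist_nonneg.lt_of_ne' fun h0 => ?_
    rw [h0, mul_zero] at h1; exact hd.ne' h1
  have b2 : |α' - β'| ≤ 1 := abs_le.2 ⟨by linarith [hα'.1, hβ'.2], by linarith [hα'.2, hβ'.1]⟩
  have h3 : 1 ≤ |α - β| := by
    by_contra hc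
    rw [not_le] at hc
    nlinarith
  rcases le_abs.1 h3 with h4 | h4
  · obtain rfl : α = 1 := by linarith [hα.2, hβ.1]
    obtain rfl : β = 0 := by linarith [hα.2, hβ.1]
    right; rw [ea, eb]; simp
  · obtain rfl : α = 0 := by linarith [hα.1, hβ.2]
    obtain rfl : β = 1 := by linarith [hα.1, hβ.2]
    left; rw [ea, eb]; simp

namespace Polygon

variable {n : ℕ} [NeZero n] {P : Polygon Plane n}

/-! ### Half-polygons and convexity -/

/-- A path in the polygon that enters an open half-polygon meets the chord. -/
lemma exists_mem_chord_of_path {s t a b : ℝ} {g : ℝ → Plane} (hg : ContinuousOn g (Icc a b))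
    (hab : a ≤ b) (hr : ∀ τ ∈ Icc a b, g τ ∈ P.region)
    (h : ¬ (g a ∈ P.openHalfPolygon s t ↔ g b ∈ P.openHalfPolygon s t)) :
    ∃ c ∈ Icc a b, g c ∈ P.boundarySegment s t := by
  by_contra! hno
  have hpc : IsPathConnected (g '' Icc a b) :=
    ((convex_Icc a b).isPathConnected ⟨a, le_rfl, hab⟩).image' hg
  have hsub : g '' Icc a b ⊆ P.region \ P.boundarySegment s t := by
    rintro _ ⟨τ, hτ, rfl⟩; exact ⟨hr τ hτ, hno τ hτ⟩
  have hj := (hpc.joinedIn _ ⟨a, ⟨le_rfl, hab⟩, rfl⟩ _ ⟨b, ⟨hab, le_rfl⟩, rfl⟩).mono hsub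
  exact h ⟨fun h => openHalfPolygon_of_joinedIn h hj.symm, fun h => openHalfPolygon_of_joinedIn h hj⟩

/-- A segment in the polygon with both endpoints off an open half-polygon avoids it. -/
lemma segment_avoids_openHalfPolygon {s t : ℝ} {x y z : Plane} (hseg : segment ℝ x y ⊆ P.region)
    (hx : x ∉ P.openHalfPolygon s t) (hy : y ∉ P.openHalfPolygon s t) (hz : z ∈ segment ℝ x y) :
    z ∉ P.openHalfPolygon s t := by
  intro hzh
  -- The chord is met on both sides of `z`; by convexity it would contain `z`, which is off the
  -- chord.
  have key : ∀ w ∈ segment ℝ x y, w ∉ P.openHalfPolygon s t →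
      ∃ k ∈ segment ℝ w z, k ∈ P.boundarySegment s t := by
    intro w hw hwn
    obtain ⟨c, hc, hcm⟩ := exists_mem_chord_of_path (g := fun τ : ℝ => AffineMap.lineMap w z τ)
      (a := 0) (b := 1) (P := P) (s := s) (t := t)
      (AffineMap.lineMap_continuous.continuousOn) zero_le_one
      (fun τ hτ => hseg ((convex_segment x y).segment_subset hw hz (by
        rw [segment_eq_image_lineMap]; exact ⟨τ, hτ, rfl⟩)))
      (by
        simp only [AffineMap.lineMap_apply_zero, AffineMap.lineMap_apply_one]
        tauto)
    refine ⟨_, ?_, hcm⟩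
    rw [segment_eq_image_lineMap]; exact ⟨c, hc, rfl⟩
  obtain ⟨k, hk, hkK⟩ := key x (left_mem_segment ℝ x y) hx
  obtain ⟨k', hk', hkK'⟩ := key y (right_mem_segment ℝ x y) hy
  refine (openHalfPolygon_subset hzh).2 ((convex_segment _ _).segment_subset hkK hkK' ?_)
  rw [mem_segment_iff_wbtw] at hz hk hk' ⊢
  exact ((hz.trans_left_right hk).symm.trans_left_right hk').symm

lemma boundaryPoint_chain (P : Polygon Plane n) {u : ℝ} (hu : 0 ≤ u) :
    Relation.ReflTransGen (fun x y => segment ℝ x y ⊆ P.region) (P.boundaryPoint 0)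
      (P.boundaryPoint u) := by
  have hsub : ∀ (i : ℤ) (v : ℝ), (i : ℝ) ≤ v → v ≤ i + 1 →
      segment ℝ (P.boundaryPoint i) (P.boundaryPoint v) ⊆ P.region := by
    intro i v h1 h2
    rw [P.segment_boundaryPoint i le_rfl h1 h2]
    rintro _ ⟨w, -, rfl⟩; exact P.boundaryPoint_mem_region w
  have hnat : ∀ k : ℕ, Relation.ReflTransGen (fun x y => segment ℝ x y ⊆ P.region)
      (P.boundaryPoint 0) (P.boundaryPoint k) := by
    intro k
    induction k with
    | zero => simpa using Relation.ReflTransGen.refl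
    | succ k ih =>
      refine ih.tail ?_
      have := hsub k (k + 1 : ℕ) (by push_cast; linarith) (by push_cast; linarith)
      simpa using this
  refine (hnat ⌊u⌋₊).tail ?_
  have := hsub (⌊u⌋₊ : ℤ) u (by simpa using Nat.floor_le hu)
    (by simpa using (Nat.lt_floor_add_one u).le)
  simpa using this

/-- Geodesics therefore have finite length, without which a shortcut would not be strictly shorter.
-/
lemma exists_rectifiable_path {x y : Plane} (hx : x ∈ P.region) (hy : y ∈ P.region) :
    ∃ γ : Path x y, range γ ⊆ P.region ∧ eVariationOn γ univ ≠ ⊤ := by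
  have hsymm : ∀ {x y}, Relation.ReflTransGen (fun x y => segment ℝ x y ⊆ P.region) x y →
      Relation.ReflTransGen (fun x y => segment ℝ x y ⊆ P.region) y x := by
    intro x y h
    refine Relation.ReflTransGen.mono (fun a b (hab : segment ℝ b a ⊆ P.region) => ?_) _ _
      h.swap
    rwa [segment_symm]
  obtain ⟨d, hd⟩ := exists_ne (0 : Plane)
  have hto : ∀ x ∈ P.region,
      Relation.ReflTransGen (fun x y => segment ℝ x y ⊆ P.region) (P.boundaryPoint 0) x := by
    intro x hx
    obtain ⟨c, -, hcC, -, hseg⟩ := exists_ray_hit hx hd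
    obtain ⟨u, hu, he⟩ := P.exists_boundaryPoint_eq 0 hcC
    refine (P.boundaryPoint_chain hu.1).tail ?_
    rwa [he, segment_symm]
  exact exists_path_of_reflTransGen hx ((hsymm (hto x hx)).trans (hto y hy))

/-- The complement of an open half-polygon is geodesically convex. -/
lemma geodesicallyConvex_diff (P : Polygon Plane n) (s t : ℝ)
    (hK : P.boundarySegment s t ⊆ P.region) :
    P.GeodesicallyConvex (P.region \ P.openHalfPolygon s t) := by
  refine ⟨sdiff_subset, fun x hx y hy γ hγ => ?_⟩
  rintro _ ⟨m, rfl⟩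
  refine ⟨hγ.1 (mem_range_self m), fun hm => ?_⟩
  have hr : ∀ τ : ℝ, γ.extend τ ∈ P.region := by
    intro τ
    obtain ⟨w, hw⟩ : γ.extend τ ∈ range γ := by rw [← γ.extend_range]; exact mem_range_self τ
    rw [← hw]; exact hγ.1 (mem_range_self w)
  have hme : γ.extend m = γ m := by simp
  have hc := γ.extend.continuous
  -- A geodesic inside the half-polygon at time `m` meets the chord before and after `m`. Following
  -- the chord between these two times is strictly shorter.
  obtain ⟨c, hc1, hcK⟩ := exists_mem_chord_of_path (hc.continuousOn (s := Icc 0 (m : ℝ)))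
    m.2.1 (fun τ _ => hr τ) (s := s) (t := t)
    (by rw [hme, γ.extend_zero]; have := hx.2; tauto)
  obtain ⟨d, hd1, hdK⟩ := exists_mem_chord_of_path (hc.continuousOn (s := Icc (m : ℝ) 1))
    m.2.2 (fun τ _ => hr τ) (s := s) (t := t)
    (by rw [hme, γ.extend_one]; have := hy.2; tauto)
  have hsub : segment ℝ (γ.extend c) (γ.extend d) ⊆ P.boundarySegment s t :=
    (convex_segment _ _).segment_subset hcK hdK
  have hfin : eVariationOn γ univ ≠ ⊤ := by
    obtain ⟨γ₀, h1, h2⟩ := exists_rectifiable_path hx.1 hy.1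
    exact ne_top_of_le_ne_top h2 (hγ.2 γ₀ h1)
  obtain ⟨γ', h1, h2⟩ := exists_shortcut γ hc1.1 hc1.2 hd1.1 hd1.2
    (fun h => (openHalfPolygon_subset hm).2 (hsub (hme ▸ h))) hfin
  refine (hγ.2 γ' (h1.trans (union_subset hγ.1 (hsub.trans hK)))).not_gt h2

/-- If `S` misses the open half-polygon, the rest of the polygon is a geodesically convex set around
`S`, and so contains the hull. -/
lemma inter_geodesicHull_nonempty_iff {s t : ℝ} (hK : P.boundarySegment s t ⊆ P.region)
    {S : Set Plane} (hS : S ⊆ P.region) :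
    (P.openHalfPolygon s t ∩ P.geodesicHull S).Nonempty ↔ (P.openHalfPolygon s t ∩ S).Nonempty := by
  constructor
  · rintro ⟨x, hx, hxH⟩
    by_contra hc
    rw [not_nonempty_iff_eq_empty, ← disjoint_iff_inter_eq_empty, Set.disjoint_right] at hc
    have hsub : S ⊆ P.region \ P.openHalfPolygon s t := fun y hy => ⟨hS hy, hc hy⟩
    exact (hxH _ ⟨hsub, P.geodesicallyConvex_diff s t hK⟩).2 hx
  · rintro ⟨x, hx, hxS⟩
    exact ⟨x, hx, fun Q hQ => hQ.1 hxS⟩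

/-- Crossing does not depend on the parameters that are used for the chord. -/
lemma IsSimple.crosses_iff (hP : P.IsSimple) {s t : ℝ} (h : P.IsChordParam s t) (X : Set Plane) :
    P.Crosses (P.boundarySegment s t) X ↔
      (P.openHalfPolygon s t ∩ X).Nonempty ∧ (P.openHalfPolygon t (s + n) ∩ X).Nonempty := by
  refine ⟨?_, fun ⟨h1, h2⟩ => ⟨s, t, h.lt, h.lt_add, rfl, h1, h2⟩⟩
  rintro ⟨s', t', h1, h2, he, h3, h4⟩
  have hn : (0 : ℝ) < n := by exact_mod_cast NeZero.pos n
  have he' : segment ℝ (P.boundaryPoint s) (P.boundaryPoint t) =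
    segment ℝ (P.boundaryPoint s') (P.boundaryPoint t') := he
  rcases segment_eq_segment (hP.boundaryPoint_ne h.lt h.lt_add) he' with ⟨e1, e2⟩ | ⟨e1, e2⟩
  · obtain ⟨z, rfl⟩ := hP.exists_int_of_boundaryPoint_eq e1
    obtain ⟨w, rfl⟩ := hP.exists_int_of_boundaryPoint_eq e2
    have hl := h.lt
    have hla := h.lt_add
    have hzw : w = z := by
      have a1 : -1 < (w : ℝ) - z := by nlinarith
      have a2 : (w : ℝ) - z < 1 := by nlinarith
      have : -1 < w - z ∧ w - z < 1 := ⟨by exact_mod_cast a1, by exact_mod_cast a2⟩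
      omega
    subst hzw
    rw [openHalfPolygon_shift] at h3
    rw [show s + w * n + n = (s + n) + w * n by ring, openHalfPolygon_shift] at h4
    exact ⟨h3, h4⟩
  · obtain ⟨z, rfl⟩ := hP.exists_int_of_boundaryPoint_eq e1
    obtain ⟨w, rfl⟩ := hP.exists_int_of_boundaryPoint_eq e2
    have hl := h.lt
    have hla := h.lt_add
    -- The endpoints are matched in reverse order, which interchanges the two half-polygons.
    have hzw : z = w + 1 := by
      have a1 : 0 < (z : ℝ) - w := by nlinarith
      have a2 : (z : ℝ) - w < 2 := by nlinarith
      have : 0 < z - w ∧ z - w < 2 := ⟨by exact_mod_cast a1, by exact_mod_cast a2⟩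
      omega
    subst hzw
    rw [show s + ((w + 1 : ℤ) : ℝ) * n = (s + n) + w * n by push_cast; ring,
      openHalfPolygon_shift] at h3
    rw [show t + w * n + n = t + (w + 1 : ℤ) * n by push_cast; ring, openHalfPolygon_shift] at h4
    exact ⟨h4, h3⟩

/-! ### Sides of a chord -/

lemma IsSimple.sideAngle_eq_of_mem (hP : P.IsSimple) {ε : ℝ}
    (hε : ∀ x ∈ P.region, x ∉ P.boundary ℝ → P.totalAngle x = ε) {s t : ℝ}
    (h : P.IsChordParam s t) {x : Plane} (hx : x ∈ P.openHalfPolygon t (s + n))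
    (hx' : x ∉ P.sideCurve t (s + n)) : P.sideAngle x t (s + n) = ε := by
  obtain ⟨a1, a2⟩ := hP.sideAngle_of_mem_openHalfPolygon h hx
  have hxC := IsSimple.notMem_boundary_of_notMem a1 hx'
  rw [← hε x (openHalfPolygon_subset hx).1 hxC,
    ← P.sideAngle_add hxC h.lt.le h.lt_add.le (fun h' => a1 (Or.inr h')), a2, zero_add]

lemma IsSimple.sideAngle_cases (hP : P.IsSimple) {ε : ℝ}
    (hε : ∀ x ∈ P.region, x ∉ P.boundary ℝ → P.totalAngle x = ε) {s t : ℝ}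
    (h : P.IsChordParam s t) {x : Plane} (hx' : x ∉ P.sideCurve t (s + n)) :
    P.sideAngle x t (s + n) = 0 ∨ P.sideAngle x t (s + n) = ε := by
  by_cases hx : x ∈ P.region
  · rcases h.mem_or_mem hx (fun h' => hx' (Or.inr (by rwa [boundarySegment_swap]))) with h1 | h1
    · exact Or.inl (hP.sideAngle_of_mem_openHalfPolygon' h h1).2
    · exact Or.inr (hP.sideAngle_eq_of_mem hε h h1 hx')
  · exact Or.inl (h.swap.sideAngle_exterior hx).2

/-- The side angle of the opposite chain takes only the values `0` and `ε` off its curve, and it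
jumps by `2π` across the chord at `y`. So the sign of the cross product decides which value occurs
just beyond `y` towards `x`; the value `0` belongs to the half-polygon of the chain from `s` to `t`.
The mirrored point may be outside the polygon, which `IsSimple.sideAngle_cases` permits. -/
lemma IsSimple.mem_openHalfPolygon_iff_cross_aux (hP : P.IsSimple) {ε : ℝ}
    (hε0 : |ε| = 2 * Real.pi)
    (hε : ∀ x ∈ P.region, x ∉ P.boundary ℝ → P.totalAngle x = ε) {s t : ℝ}
    (h : P.IsChordParam s t) {x y : Plane} (hy : y ∈ P.boundarySegment s t)
    (hys : y ≠ P.boundaryPoint s) (hyt : y ≠ P.boundaryPoint t)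
    (hyC : y ∉ P.boundaryPoint '' Icc t (s + n))
    (hseg : segment ℝ y x ⊆ P.region) (hK : ∀ z ∈ segment ℝ y x, z ≠ y → z ∉ P.boundarySegment s t)
    (hc : cross (P.boundaryPoint t - P.boundaryPoint s) (x - y) ≠ 0) :
    x ∈ P.openHalfPolygon s t ↔
      ε * cross (P.boundaryPoint t - P.boundaryPoint s) (x - y) < 0 := by
  have hpi := Real.pi_pos
  set d := P.boundaryPoint t - P.boundaryPoint s with hd
  have hxy : x ≠ y := by rintro rfl; simp [cross] at hc
  have hε' : ε = 2 * Real.pi ∨ ε = -(2 * Real.pi) := by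
    rcases abs_choice ε with h' | h' <;> rw [h'] at hε0
    · exact Or.inl hε0
    · exact Or.inr (by linarith)
  have hr : ∀ r : ℝ, 0 < r → r ≤ 1 → y + r • (x - y) ∈ P.region ∧
      y + r • (x - y) ∉ P.boundarySegment s t ∧
      (x ∈ P.openHalfPolygon s t ↔ y + r • (x - y) ∈ P.openHalfPolygon s t) := by
    intro r h0 h1
    have hmem : ∀ l : ℝ, 0 ≤ l → l ≤ 1 → y + l • (x - y) ∈ segment ℝ y x := by
      intro l h0 h1; rw [segment_eq_image']; exact ⟨l, ⟨h0, h1⟩, rfl⟩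
    have hne : ∀ l : ℝ, 0 < l → y + l • (x - y) ≠ y := by
      intro l hl he
      rw [add_eq_left, smul_eq_zero, sub_eq_zero] at he
      rcases he with h | h
      exacts [hl.ne' h, hxy h]
    have hoff := fun l h0 h1 => hK _ (hmem l (le_of_lt h0) h1) (hne l h0)
    refine ⟨hseg (hmem r h0.le h1), hoff r h0 h1, ?_⟩
    by_contra hcon
    obtain ⟨c, hc, hcK⟩ := exists_mem_chord_of_path (g := fun l : ℝ => y + l • (x - y)) (P := P)
      (a := r) (b := 1) (s := s) (t := t) (by fun_prop) h1
      (fun l hl => hseg (hmem l (h0.le.trans hl.1) hl.2))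
      (by simpa using fun h' => hcon h'.symm)
    exact hoff c (h0.trans_le hc.1) hc.2 hcK
  have hsmall : ∀ᶠ r : ℝ in 𝓝[>] 0, r ∈ Ioo (0 : ℝ) 1 := Ioo_mem_nhdsGT one_pos
  have hval : ∀ w, w ∈ P.region → w ∉ P.boundarySegment s t → w ∉ P.sideCurve t (s + n) →
      (w ∈ P.openHalfPolygon s t ∧ P.sideAngle w t (s + n) = 0) ∨
      (w ∉ P.openHalfPolygon s t ∧ P.sideAngle w t (s + n) = ε) := by
    intro w hw hwK hwC
    rcases h.mem_or_mem hw hwK with h1 | h1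
    · exact Or.inl ⟨h1, (hP.sideAngle_of_mem_openHalfPolygon' h h1).2⟩
    · exact Or.inr ⟨fun h2 => Set.disjoint_left.1 (hP.disjoint_openHalfPolygon h) h2 h1,
        hP.sideAngle_eq_of_mem hε h h1 hwC⟩
  rcases hc.lt_or_gt with hneg | hpos
  · obtain ⟨r, ⟨o1, o2, hj⟩, hr0, hr1⟩ := ((P.eventually_sideAngle_jump (v := -(x - y)) h.lt_add.le hy hys hyt
      hyC (by rw [cross_neg_right]; linarith)).and hsmall).exists
    rw [smul_neg] at o1 o2 hj
    rw [sub_neg_eq_add] at o2 hj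
    obtain ⟨b1, b2, b3⟩ := hr r hr0 hr1.le
    rw [b3]
    rcases hval _ b1 b2 o2 with ⟨h1, h2⟩ | ⟨h1, h2⟩ <;>
      rcases hP.sideAngle_cases hε h o1 with h3 | h3 <;> rw [h2, h3] at hj
    · linarith
    · refine ⟨fun _ => ?_, fun _ => h1⟩
      rw [sub_zero] at hj; rw [hj]; nlinarith
    · refine ⟨fun h' => absurd h' h1, fun h' => ?_⟩
      have : ε = -(2 * Real.pi) := by linarith
      rw [this] at h'; nlinarith
    · linarith
  · obtain ⟨r, ⟨o1, o2, hj⟩, hr0, hr1⟩ := ((P.eventually_sideAngle_jump (v := x - y) h.lt_add.le hy hys hyt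
      hyC hpos).and hsmall).exists
    obtain ⟨b1, b2, b3⟩ := hr r hr0 hr1.le
    rw [b3]
    rcases hval _ b1 b2 o1 with ⟨h1, h2⟩ | ⟨h1, h2⟩ <;>
      rcases hP.sideAngle_cases hε h o2 with h3 | h3 <;> rw [h2, h3] at hj
    · linarith
    · refine ⟨fun _ => ?_, fun _ => h1⟩
      have : ε = -(2 * Real.pi) := by linarith
      rw [this]; nlinarith
    · refine ⟨fun h' => absurd h' h1, fun h' => ?_⟩
      rw [sub_zero] at hj; rw [hj] at h'; nlinarith
    · linarith

/-- Which of the two half-polygons of a chord is reached when one leaves the chord depends only on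
the side of the line through the chord. -/
lemma IsSimple.exists_side_sign (hP : P.IsSimple) : ∃ ε : ℝ, ε ≠ 0 ∧ ∀ {s t : ℝ},
    P.IsChordParam s t → ∀ {x y : Plane}, y ∈ P.boundarySegment s t →
    y ≠ P.boundaryPoint s → y ≠ P.boundaryPoint t →
    segment ℝ y x ⊆ P.region → (∀ z ∈ segment ℝ y x, z ≠ y → z ∉ P.boundarySegment s t) →
    cross (P.boundaryPoint t - P.boundaryPoint s) (x - y) ≠ 0 →
    (x ∈ P.openHalfPolygon s t ↔
      ε * cross (P.boundaryPoint t - P.boundaryPoint s) (x - y) < 0) := by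
  obtain ⟨ε, hε0, hε⟩ := hP.exists_orientation
  have hne : ε ≠ 0 := by
    rintro rfl; rw [abs_zero] at hε0; linarith [Real.pi_pos]
  refine ⟨ε, hne, ?_⟩
  intro s t h x y hy hys hyt hseg hK hc
  -- The chord may touch the boundary at `y`, but only one of the two chains. If it is the opposite
  -- one, the reversed chord is used; this flips both the half-polygon and the sign.
  by_cases hyC : y ∈ P.boundaryPoint '' Icc t (s + n)
  · have hyC' : y ∉ P.boundaryPoint '' Icc (s + n) (t + n) := by
      intro h'
      have : y ∈ P.boundaryPoint '' Icc s t := by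
        obtain ⟨u, hu, rfl⟩ := h'
        refine ⟨u - n, ⟨by linarith [hu.1], by linarith [hu.2]⟩, ?_⟩
        rw [← P.boundaryPoint_add_period, sub_add_cancel]
      rcases hP.chain_inter_subset ⟨this, hyC⟩ with h' | h'
      exacts [hys h', hyt h']
    have hxK : x ∉ P.boundarySegment s t :=
      hK x (right_mem_segment ℝ y x) (by rintro rfl; simp [cross] at hc)
    have hx : x ∈ P.region := hseg (right_mem_segment ℝ y x)
    have e : P.boundaryPoint (s + n) - P.boundaryPoint t =
        -(P.boundaryPoint t - P.boundaryPoint s) := by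
      rw [P.boundaryPoint_add_period]; abel
    have key := hP.mem_openHalfPolygon_iff_cross_aux hε0 hε h.swap (x := x) (y := y)
      (by rwa [boundarySegment_swap]) hyt (by rwa [P.boundaryPoint_add_period]) hyC' hseg
      (by rwa [boundarySegment_swap]) (by rw [e, cross_neg_left]; exact neg_ne_zero.2 hc)
    rw [e, cross_neg_left, mul_neg, neg_lt_zero] at key
    have hne' := mul_ne_zero hne hc
    have hdisj : x ∈ P.openHalfPolygon s t → x ∉ P.openHalfPolygon t (s + n) :=
      fun h1 => Set.disjoint_left.1 (hP.disjoint_openHalfPolygon h) h1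
    have hor := h.mem_or_mem hx hxK
    rcases hne'.lt_or_gt with h1 | h1
    · have : ¬ x ∈ P.openHalfPolygon t (s + n) := fun h2 => (key.1 h2).not_gt h1
      tauto
    · have h2 := key.2 h1
      have : ¬ ε * cross (P.boundaryPoint t - P.boundaryPoint s) (x - y) < 0 := h1.not_gt
      tauto
  · exact hP.mem_openHalfPolygon_iff_cross_aux hε0 hε h hy hys hyt hyC hseg hK hc

end Polygon

/-! ### Counting -/

/-- The members of a chain of finite sets have distinct cardinalities. -/
lemma ncard_le_of_isChain {ι : Type*} [Finite ι] {𝒞 : Set (Set ι)} (h : IsChain (· ⊆ ·) 𝒞) :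
    𝒞.ncard ≤ Nat.card ι + 1 := by
  have : 𝒞.ncard ≤ (Iic (Nat.card ι)).ncard := by
    refine Set.ncard_le_ncard_of_injOn (fun A => A.ncard)
      (fun A _ => by rw [← ncard_univ]; exact ncard_le_ncard (subset_univ A)) ?_ (finite_Iic _)
    intro A hA B hB hAB
    have hAB' : A.ncard = B.ncard := hAB
    rcases h.total hA hB with h' | h'
    · exact eq_of_subset_of_ncard_le h' hAB'.ge
    · exact (eq_of_subset_of_ncard_le h' hAB'.le).symm
  refine this.trans ?_
  rw [← Nat.card_coe_set_eq, Nat.card_eq_fintype_card]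
  simp

lemma ncard_image_le_of_monotoneOn {ι : Type*} [Finite ι] {S : Set ℝ} {f : ℝ → Set ι}
    (h : MonotoneOn f S) : (f '' S).ncard ≤ Nat.card ι + 1 := by
  refine ncard_le_of_isChain ?_
  rintro _ ⟨a, ha, rfl⟩ _ ⟨b, hb, rfl⟩ -
  rcases le_total a b with h' | h'
  exacts [Or.inl (h ha hb h'), Or.inr (h hb ha h')]

lemma ncard_image_le_of_antitoneOn {ι : Type*} [Finite ι] {S : Set ℝ} {f : ℝ → Set ι}
    (h : AntitoneOn f S) : (f '' S).ncard ≤ Nat.card ι + 1 := by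
  refine ncard_le_of_isChain ?_
  rintro _ ⟨a, ha, rfl⟩ _ ⟨b, hb, rfl⟩ -
  rcases le_total a b with h' | h'
  exacts [Or.inr (h ha hb h'), Or.inl (h hb ha h')]

lemma ncard_image_le_of_factor {α β γ : Type*} {S : Set α} {F : α → β} {f : α → γ}
    (h : ∀ a ∈ S, ∀ b ∈ S, f a = f b → F a = F b) (hfin : (f '' S).Finite) :
    (F '' S).ncard ≤ (f '' S).ncard := by
  rcases isEmpty_or_nonempty α with hα | hα
  · simp [Set.eq_empty_of_isEmpty S]
  have : F '' S = (fun c => F (Function.invFunOn f S c)) '' (f '' S) := by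
    rw [image_image]
    refine image_congr fun a ha => ?_
    have hex : ∃ b ∈ S, f b = f a := ⟨a, ha, rfl⟩
    exact h a ha _ (Function.invFunOn_mem hex) (Function.invFunOn_eq hex).symm
  rw [this]
  exact ncard_image_le hfin

/-- If `F` depends only on the membership in the intervals `I j`, then it takes few values. -/
lemma ncard_image_le_of_ordConnected {ι β : Type*} [Finite ι] {S : Set ℝ} {F : ℝ → β}
    {I : ι → Set ℝ} (hI : ∀ j, (I j).OrdConnected)
    (h : ∀ a ∈ S, ∀ b ∈ S, (∀ j, a ∈ I j ↔ b ∈ I j) → F a = F b) :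
    (F '' S).ncard ≤ 2 * Nat.card ι + 1 := by
  -- For each interval, `f l` records whether `l` has reached it and whether `l` has passed it. Both
  -- persist as `l` grows, so the values form a chain of subsets of a set with twice as many
  -- elements as `ι`.
  set f : ℝ → Set (ι × Bool) := fun l => {p | if p.2 then ∃ μ ∈ I p.1, μ ≤ l else ∀ μ ∈ I p.1, μ < l}
    with hf
  have hmono : Monotone f := by
    rintro a b hab ⟨j, c⟩ hp
    cases c
    · simp only [hf, mem_ofPred_eq, Bool.false_eq_true, if_false] at hp ⊢
      exact fun μ hμ => (hp μ hμ).trans_le hab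
    · simp only [hf, mem_ofPred_eq, if_true] at hp ⊢
      obtain ⟨μ, hμ, h1⟩ := hp
      exact ⟨μ, hμ, h1.trans hab⟩
  have hmem : ∀ l j, l ∈ I j ↔ (j, true) ∈ f l ∧ (j, false) ∉ f l := by
    intro l j
    simp only [hf, mem_ofPred_eq, if_true, Bool.false_eq_true, if_false, not_forall, not_lt]
    constructor
    · exact fun hl => ⟨⟨l, hl, le_rfl⟩, l, hl, le_rfl⟩
    · rintro ⟨⟨μ, hμ, h1⟩, ν, hν, h2⟩
      exact (hI j).out hμ hν ⟨h1, h2⟩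
  refine (ncard_image_le_of_factor (f := f) (fun a ha b hb hab => h a ha b hb fun j => ?_)
    (toFinite _)).trans ((ncard_image_le_of_monotoneOn (hmono.monotoneOn S)).trans ?_)
  · rw [hmem, hmem, hab]
  · rw [Nat.card_prod, Nat.card_eq_fintype_card (α := Bool), Fintype.card_bool, mul_comm]

lemma ncard_iUnion_le_mul {ι β : Type*} [Fintype ι] [Finite β] {A : ι → Set β} {N : ℕ}
    (h : ∀ i, (A i).ncard ≤ N) : (⋃ i, A i).ncard ≤ Fintype.card ι * N := by
  classical
  have hfin : (⋃ i, A i) = ((Finset.univ.biUnion fun i => (toFinite (A i)).toFinset : Finset β) : Set β) := by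
    ext; simp
  rw [hfin, ncard_coe_finset]
  refine Finset.card_biUnion_le_card_mul _ _ _ fun i _ => ?_
  rw [← ncard_eq_toFinset_card]
  exact h i

lemma ncard_image2_le_mul {α β γ : Type*} [Finite α] [Finite β] (f : α → β → γ) (A : Set α)
    (B : Set β) : (image2 f A B).ncard ≤ A.ncard * B.ncard := by
  rw [← image_prod, ← ncard_prod]
  exact ncard_image_le (toFinite _)

lemma ncard_iUnion_choice_le {ι : Type*} [Finite ι] (k : ℕ) (𝒟 : Set (Set ι)) :
    {T | ∃ F : Fin k → Set ι, (∀ i, F i ∈ 𝒟) ∧ T = ⋃ i, F i}.ncard ≤ 𝒟.ncard ^ k := by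
  classical
  have : {T | ∃ F : Fin k → Set ι, (∀ i, F i ∈ 𝒟) ∧ T = ⋃ i, F i} =
      (fun F : Fin k → Set ι => ⋃ i, F i) ''
        ((Fintype.piFinset fun _ => (toFinite 𝒟).toFinset : Finset (Fin k → Set ι)) : Set _) := by
    ext T
    simp only [mem_ofPred_eq, mem_image, Finset.mem_coe, Fintype.mem_piFinset, Finite.mem_toFinset]
    exact exists_congr fun F => and_congr_right fun _ => eq_comm
  rw [this]
  refine (ncard_image_le (Finset.finite_toSet _)).trans ?_
  rw [ncard_coe_finset, Fintype.card_piFinset_const, ← ncard_eq_toFinset_card]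

/-! ### Rays in general position -/

/-- A point other than `x` lies on at most one of the infinitely many rays with directions `(1, i)`.
-/
lemma exists_ray_avoiding_finite {F : Set Plane} (hF : F.Finite) {x : Plane} (hx : x ∉ F) :
    ∃ d : Plane, d ≠ 0 ∧ ∀ r : ℝ, 0 ≤ r → x + r • d ∉ F := by
  by_contra! hno
  have h1 : ∀ i : ℕ, ∃ r : ℝ, 0 ≤ r ∧ x + r • !₂[(1 : ℝ), (i : ℝ)] ∈ F := by
    intro i
    refine hno _ fun h => ?_
    have := congrArg (fun v : Plane => v 0) h
    simp at this
  choose r _ hrF using h1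
  have : Finite F := hF
  obtain ⟨i, j, hij, he⟩ := Finite.exists_ne_map_eq_of_infinite fun i : ℕ => (⟨_, hrF i⟩ : F)
  have he' := add_left_cancel (Subtype.ext_iff.1 he)
  have e0 := congrArg (fun v : Plane => v 0) he'
  have e1 := congrArg (fun v : Plane => v 1) he'
  simp at e0 e1
  rw [e0] at e1
  have hr : r j = 0 := by
    by_contra h0
    exact hij (by exact_mod_cast mul_left_cancel₀ h0 e1)
  have := hrF j
  rw [hr, zero_smul, add_zero] at this
  exact hx this

lemma subsingleton_inter_segment {a b c d : Plane} (h : cross (b - a) (d - c) ≠ 0) :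
    (segment ℝ a b ∩ segment ℝ c d).Subsingleton := by
  rintro p ⟨hp1, hp2⟩ q ⟨hq1, hq2⟩
  rw [segment_eq_image'] at hp1 hp2 hq1 hq2
  obtain ⟨α, -, rfl⟩ := hp1
  obtain ⟨β, -, rfl⟩ := hq1
  obtain ⟨α', -, h1⟩ := hp2
  obtain ⟨β', -, h2⟩ := hq2
  simp only at h1 h2 ⊢
  have h3 : (β - α) • (b - a) = (β' - α') • (d - c) := by
    have : (a + β • (b - a)) - (a + α • (b - a)) = (c + β' • (d - c)) - (c + α' • (d - c)) := by
      rw [h1, h2]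
    rw [add_sub_add_left_eq_sub, add_sub_add_left_eq_sub] at this
    rw [sub_smul, sub_smul, this]
  have h4 : (β - α) * cross (b - a) (d - c) = 0 := by
    rw [← cross_smul_left, h3, cross_smul_left, cross_self_eq_zero, mul_zero]
  have : β = α := by
    have := (mul_eq_zero.1 h4).resolve_right h
    linarith
  rw [this]

/-- If a point is collinear with a segment but not on it, then an endpoint of the segment lies
between it and any inner point of the segment. -/
lemma endpoint_mem_segment {a b x y : Plane} (hab : a ≠ b) (hy : y ∈ segment ℝ a b)
    (hx : x ∉ segment ℝ a b) (hc : cross (b - a) (x - y) = 0) :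
    a ∈ segment ℝ y x ∨ b ∈ segment ℝ y x := by
  obtain ⟨k, hk⟩ := exists_smul_of_cross_eq_zero (sub_ne_zero.2 hab.symm) hc
  rw [segment_eq_image'] at hy
  obtain ⟨l, hl, rfl⟩ := hy
  simp only at hk ⊢
  have hx' : x = a + (l + k) • (b - a) := by
    rw [add_smul, ← hk]; abel
  have hlk : ¬ (0 ≤ l + k ∧ l + k ≤ 1) := fun h => hx (by
    rw [segment_eq_image', hx']; exact ⟨_, h, rfl⟩)
  rw [not_and_or, not_le, not_le] at hlk
  rw [segment_eq_image']
  rcases hlk with h | h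
  · have hk0 : k < 0 := by linarith [hl.1]
    left
    refine ⟨-l / k, ⟨div_nonneg_of_nonpos (by linarith [hl.1]) hk0.le, ?_⟩, ?_⟩
    · rw [div_le_one_of_neg hk0]; linarith
    · simp only; rw [hk, smul_smul, div_mul_cancel₀ _ hk0.ne]; module
  · have hk0 : 0 < k := by linarith [hl.2]
    right
    refine ⟨(1 - l) / k, ⟨div_nonneg (by linarith [hl.2]) hk0.le, ?_⟩, ?_⟩
    · rw [div_le_one hk0]; linarith
    · simp only; rw [hk, smul_smul, div_mul_cancel₀ _ hk0.ne']; module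

namespace Polygon

variable {n : ℕ} [NeZero n] {P : Polygon Plane n}

/-! ### Types of sets with respect to a family of chords -/

section Types

variable {m : ℕ} {s t : Fin m → ℝ}

/-- The open half-polygons of the chords of a family. -/
def halfSide (P : Polygon Plane n) (s t : Fin m → ℝ) (p : Fin m × Bool) : Set Plane :=
  if p.2 then P.openHalfPolygon (s p.1) (t p.1) else P.openHalfPolygon (t p.1) (s p.1 + n)

/-- The type of a set: the open half-polygons of the chords of the family that it meets. -/
def sideType (P : Polygon Plane n) (s t : Fin m → ℝ) (X : Set Plane) : Set (Fin m × Bool) :=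
  {p | (P.halfSide s t p ∩ X).Nonempty}

@[simp] lemma halfSide_true (k : Fin m) :
    P.halfSide s t (k, true) = P.openHalfPolygon (s k) (t k) := rfl

@[simp] lemma halfSide_false (k : Fin m) :
    P.halfSide s t (k, false) = P.openHalfPolygon (t k) (s k + n) := rfl

lemma mem_sideType {p : Fin m × Bool} {X : Set Plane} :
    p ∈ P.sideType s t X ↔ ∃ x ∈ X, x ∈ P.halfSide s t p :=
  ⟨fun ⟨x, h1, h2⟩ => ⟨x, h2, h1⟩, fun ⟨x, h1, h2⟩ => ⟨x, h2, h1⟩⟩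

lemma mem_sideType_singleton {p : Fin m × Bool} {x : Plane} :
    p ∈ P.sideType s t {x} ↔ x ∈ P.halfSide s t p := by
  simp [mem_sideType]

lemma sideType_mono {X Y : Set Plane} (h : X ⊆ Y) : P.sideType s t X ⊆ P.sideType s t Y :=
  fun _ ⟨x, h1, h2⟩ => ⟨x, h1, h h2⟩

lemma sideType_union (X Y : Set Plane) :
    P.sideType s t (X ∪ Y) = P.sideType s t X ∪ P.sideType s t Y := by
  ext p
  simp only [sideType, mem_ofPred_eq, mem_union, inter_union_distrib_left, union_nonempty]

lemma sideType_iUnion {ι : Type*} (X : ι → Set Plane) :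
    P.sideType s t (⋃ i, X i) = ⋃ i, P.sideType s t (X i) := by
  ext p
  simp only [sideType, mem_ofPred_eq, mem_iUnion, inter_iUnion, nonempty_iUnion]

lemma sideType_empty : P.sideType s t ∅ = ∅ := by
  ext p; simp [sideType]

lemma halfSide_notMem_chord {p : Fin m × Bool} {x : Plane} (hx : x ∈ P.halfSide s t p) :
    x ∉ P.boundarySegment (s p.1) (t p.1) := by
  rcases p with ⟨k, b⟩
  cases b
  · rw [halfSide_false] at hx
    rw [← boundarySegment_swap]; exact (openHalfPolygon_subset hx).2
  · exact (openHalfPolygon_subset hx).2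

lemma halfSide_of_joinedIn {p : Fin m × Bool} {x y : Plane} (hx : x ∈ P.halfSide s t p)
    (h : JoinedIn (P.region \ P.boundarySegment (s p.1) (t p.1)) y x) : y ∈ P.halfSide s t p := by
  rcases p with ⟨k, b⟩
  cases b
  · rw [halfSide_false] at hx ⊢
    exact openHalfPolygon_of_joinedIn hx (by rwa [boundarySegment_swap])
  · exact openHalfPolygon_of_joinedIn hx h

lemma halfSide_iff_of_segment {p : Fin m × Bool} {x y : Plane}
    (h : segment ℝ x y ⊆ P.region \ P.boundarySegment (s p.1) (t p.1)) :
    x ∈ P.halfSide s t p ↔ y ∈ P.halfSide s t p :=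
  ⟨fun hx => halfSide_of_joinedIn hx (joinedIn_of_segment h).symm,
    fun hy => halfSide_of_joinedIn hy (joinedIn_of_segment h)⟩

lemma segment_avoids_halfSide {p : Fin m × Bool} {x y z : Plane} (hseg : segment ℝ x y ⊆ P.region)
    (hx : x ∉ P.halfSide s t p) (hy : y ∉ P.halfSide s t p) (hz : z ∈ segment ℝ x y) :
    z ∉ P.halfSide s t p := by
  rcases p with ⟨k, b⟩
  cases b <;> exact segment_avoids_openHalfPolygon hseg hx hy hz

lemma sideType_segment {x y : Plane} (hseg : segment ℝ x y ⊆ P.region) :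
    P.sideType s t (segment ℝ x y) = P.sideType s t {x} ∪ P.sideType s t {y} := by
  refine Subset.antisymm (fun p hp => ?_) (union_subset
    (sideType_mono (singleton_subset_iff.2 (left_mem_segment ℝ x y)))
    (sideType_mono (singleton_subset_iff.2 (right_mem_segment ℝ x y))))
  obtain ⟨z, hz, hzp⟩ := mem_sideType.1 hp
  rw [mem_union, mem_sideType_singleton, mem_sideType_singleton]
  by_contra hc
  rw [not_or] at hc
  exact segment_avoids_halfSide hseg hc.1 hc.2 hz hzp

lemma IsSimple.halfSide_false_iff (hP : P.IsSimple) (h : ∀ k, P.IsChordParam (s k) (t k))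
    {k : Fin m} {x : Plane} (hx : x ∈ P.region) (hK : x ∉ P.boundarySegment (s k) (t k)) :
    x ∈ P.halfSide s t (k, false) ↔ x ∉ P.halfSide s t (k, true) := by
  have h1 := (h k).mem_or_mem hx hK
  have h2 : x ∈ P.openHalfPolygon (s k) (t k) → x ∉ P.openHalfPolygon (t k) (s k + n) :=
    fun h1 => Set.disjoint_left.1 (hP.disjoint_openHalfPolygon (h k)) h1
  rw [halfSide_true, halfSide_false]
  tauto

/-- Points on a fixed segment have few types. -/
lemma ncard_sideType_segment_le (P : Polygon Plane n) (s t : Fin m → ℝ) {a b : Plane}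
    (hseg : segment ℝ a b ⊆ P.region) :
    ((fun x => P.sideType s t {x}) '' segment ℝ a b).ncard ≤ 4 * m + 1 := by
  rw [segment_eq_image_lineMap, image_image]
  have hsub : ∀ l ∈ Icc (0 : ℝ) 1, AffineMap.lineMap a b l ∈ P.region := fun l hl =>
    hseg (by rw [segment_eq_image_lineMap]; exact ⟨l, hl, rfl⟩)
  -- The parameters outside an open half-polygon form an interval; `2m` intervals give `4m + 1`
  -- types.
  refine (ncard_image_le_of_ordConnected (ι := Fin m × Bool)
    (I := fun p => {l | l ∈ Icc (0 : ℝ) 1 ∧ AffineMap.lineMap a b l ∉ P.halfSide s t p})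
    (fun p => ⟨?_⟩) ?_).trans (le_of_eq ?_)
  · rintro x ⟨hx, hx'⟩ y ⟨hy, hy'⟩ z hz
    refine ⟨⟨hx.1.trans hz.1, hz.2.trans hy.2⟩, ?_⟩
    have he : segment ℝ (AffineMap.lineMap a b x) (AffineMap.lineMap a b y) =
        AffineMap.lineMap a b '' Icc x y := by
      rw [← image_segment, segment_eq_Icc (hz.1.trans hz.2)]
    refine segment_avoids_halfSide ?_ hx' hy' (he ▸ ⟨z, hz, rfl⟩)
    rw [he]
    rintro _ ⟨w, hw, rfl⟩
    exact hsub w ⟨hx.1.trans hw.1, hw.2.trans hy.2⟩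
  · intro x hx y hy h
    ext p
    rw [mem_sideType_singleton, mem_sideType_singleton]
    have := h p
    simp only [mem_ofPred_eq, hx, hy, true_and] at this
    exact not_iff_not.1 this
  · simp; ring

/-- The sides of the chords on which the boundary point with parameter `u` is, provided that it is
not on these chords. -/
def paramType (n : ℕ) (s t : Fin m → ℝ) (u : ℝ) : Set (Fin m × Bool) :=
  {p | ∃ z : ℤ, u + z * n ∈
    if p.2 then Ioo (s p.1) (t p.1) else Ioo (t p.1) (s p.1 + n)}

omit [NeZero n] in
lemma paramType_shift (u : ℝ) (z : ℤ) : paramType n s t (u + z * n) = paramType n s t u := by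
  ext p
  constructor
  · rintro ⟨w, hw⟩
    refine ⟨z + w, ?_⟩
    have : u + ((z + w : ℤ) : ℝ) * n = u + z * n + w * n := by push_cast; ring
    rwa [this]
  · rintro ⟨w, hw⟩
    refine ⟨w - z, ?_⟩
    have : u + z * n + ((w - z : ℤ) : ℝ) * n = u + w * n := by push_cast; ring
    rwa [this]

lemma ncard_paramType_le (hs : ∀ k, s k ∈ Ico (0 : ℝ) n) (h1 : ∀ k, s k < t k)
    (h2 : ∀ k, t k < s k + n) : (range (paramType n s t)).ncard ≤ 8 * m + 1 := by
  have hn : (0 : ℝ) < n := by exact_mod_cast NeZero.pos n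
  have hrange : range (paramType n s t) = paramType n s t '' Ico 0 n := by
    refine Subset.antisymm ?_ (image_subset_range _ _)
    rintro _ ⟨u, rfl⟩
    obtain ⟨z, hz⟩ := exists_int_shift_mem_Ico (n := n) 0 u
    rw [zero_add] at hz
    exact ⟨_, hz, paramType_shift u z⟩
  have hz : ∀ {u : ℝ} {z : ℤ}, u ∈ Ico (0 : ℝ) n → 0 < u + z * n → u + z * n < 2 * n →
      z = 0 ∨ z = 1 := by
    intro u z hu h1 h2
    have a1 : (-1 : ℝ) < z := by
      by_contra hc; push Not at hc; nlinarith [hu.2]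
    have a2 : (z : ℝ) < 2 := by
      by_contra hc; push Not at hc; nlinarith [hu.1]
    have : -1 < z ∧ z < 2 := ⟨by exact_mod_cast a1, by exact_mod_cast a2⟩
    omega
  have htrue : ∀ u ∈ Ico (0 : ℝ) n, ∀ k, (k, true) ∈ paramType n s t u ↔
      u ∈ Ioo (s k) (t k) ∨ u ∈ Iio (t k - n) := by
    intro u hu k
    constructor
    · rintro ⟨z, hz'⟩
      simp only [if_true] at hz'
      rcases hz hu (by linarith [hz'.1, (hs k).1]) (by linarith [hz'.2, (hs k).2, h2 k]) with rfl | rfl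
      · left; simpa using hz'
      · right
        have := hz'.2; push_cast at this
        rw [mem_Iio]; linarith
    · rintro (h | h)
      · exact ⟨0, by simpa using h⟩
      · refine ⟨1, ?_⟩
        rw [mem_Iio] at h
        simp only [if_true, Int.cast_one, one_mul]
        exact ⟨by linarith [hu.1, (hs k).2], by linarith⟩
  have hfalse : ∀ u ∈ Ico (0 : ℝ) n, ∀ k, (k, false) ∈ paramType n s t u ↔
      u ∈ Ioi (t k) ∨ u ∈ Ioo (t k - n) (s k) := by
    intro u hu k
    constructor
    · rintro ⟨z, hz'⟩
      simp only [Bool.false_eq_true, if_false] at hz'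
      rcases hz hu (by linarith [hz'.1, (hs k).1, h1 k]) (by linarith [hz'.2, (hs k).2])
        with rfl | rfl
      · left; simpa using hz'.1
      · right
        have a1 := hz'.1
        have a2 := hz'.2
        push_cast at a1 a2
        exact ⟨by linarith, by linarith⟩
    · rintro (h | h)
      · refine ⟨0, ?_⟩
        rw [mem_Ioi] at h
        simp only [Bool.false_eq_true, if_false, Int.cast_zero, zero_mul, add_zero]
        exact ⟨h, by linarith [hu.2, (hs k).1]⟩
      · refine ⟨1, ?_⟩
        simp only [Bool.false_eq_true, if_false, Int.cast_one, one_mul]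
        exact ⟨by linarith [h.1], by linarith [h.2]⟩
  rw [hrange]
  -- In the window `[0, n)` only the shifts `0` and `1` matter, so each of the `2m` arcs is a union
  -- of two intervals; `4m` intervals give `8m + 1` types.
  refine (ncard_image_le_of_ordConnected (ι := (Fin m × Bool) × Bool)
    (I := fun q => if q.1.2 then (if q.2 then Ioo (s q.1.1) (t q.1.1) else Iio (t q.1.1 - n))
      else (if q.2 then Ioi (t q.1.1) else Ioo (t q.1.1 - n) (s q.1.1)))
    (fun q => ?_) ?_).trans (le_of_eq ?_)
  · rcases q with ⟨⟨k, b⟩, c⟩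
    cases b <;> cases c <;> simp only [if_true, Bool.false_eq_true, if_false]
    exacts [ordConnected_Ioo, ordConnected_Ioi, ordConnected_Iio, ordConnected_Ioo]
  · intro a ha b hb h
    ext ⟨k, c⟩
    cases c
    · have e1 := h ((k, false), true)
      have e2 := h ((k, false), false)
      simp only [if_true, Bool.false_eq_true, if_false] at e1 e2
      rw [hfalse a ha, hfalse b hb, e1, e2]
    · have e1 := h ((k, true), true)
      have e2 := h ((k, true), false)
      simp only [if_true, Bool.false_eq_true, if_false] at e1 e2
      rw [htrue a ha, htrue b hb, e1, e2]
  · simp; ring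

lemma IsSimple.boundaryPoint_mem_halfSide (hP : P.IsSimple)
    (h : ∀ k, P.IsChordParam (s k) (t k)) {p : Fin m × Bool} {u : ℝ}
    (hu : P.boundaryPoint u ∉ P.boundarySegment (s p.1) (t p.1)) :
    P.boundaryPoint u ∈ P.halfSide s t p ↔ p ∈ paramType n s t u := by
  have hin : ∀ p : Fin m × Bool, P.boundaryPoint u ∉ P.boundarySegment (s p.1) (t p.1) →
      p ∈ paramType n s t u → P.boundaryPoint u ∈ P.halfSide s t p := by
    rintro ⟨k, b⟩ hu ⟨z, hz⟩
    rw [← P.boundaryPoint_add_int_mul u z] at hu ⊢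
    cases b
    · exact boundaryPoint_mem_openHalfPolygon hz (by rwa [boundarySegment_swap])
    · exact boundaryPoint_mem_openHalfPolygon hz hu
  have hcov : (p.1, true) ∈ paramType n s t u ∨ (p.1, false) ∈ paramType n s t u := by
    rcases (h p.1).boundary_cases (P.boundaryPoint_mem u) hu with ⟨w, hw, he⟩ | ⟨w, hw, he⟩
    · obtain ⟨z, rfl⟩ := hP.exists_int_of_boundaryPoint_eq he.symm
      exact Or.inl ⟨z, hw⟩
    · obtain ⟨z, rfl⟩ := hP.exists_int_of_boundaryPoint_eq he.symm
      exact Or.inr ⟨z, hw⟩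
  refine ⟨fun hm => ?_, hin p hu⟩
  have hiff := hP.halfSide_false_iff h (P.boundaryPoint_mem_region u) hu
  rcases p with ⟨k, b⟩
  cases b
  · refine hcov.resolve_left fun h1 => ?_
    exact hiff.1 hm (hin (k, true) hu h1)
  · refine hcov.resolve_right fun h1 => ?_
    exact hiff.1 (hin (k, false) hu h1) hm

/-- The segment from `x` to `y` first meets the chords in an inner point `y` of the `k`-th chord,
and all chords through `y` are parallel. -/
structure HitsChord (P : Polygon Plane n) (s t : Fin m → ℝ) (k : Fin m) (σ : Bool)
    (x y : Plane) : Prop where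
  mem : y ∈ P.boundarySegment (s k) (t k)
  subset : segment ℝ y x ⊆ P.region
  notMem : ∀ z ∈ segment ℝ y x, z ≠ y → ∀ j, z ∉ P.boundarySegment (s j) (t j)
  ne_left : ∀ j, y ≠ P.boundaryPoint (s j)
  ne_right : ∀ j, y ≠ P.boundaryPoint (t j)
  cross_ne : ∀ j, y ∈ P.boundarySegment (s j) (t j) →
    cross (P.boundaryPoint (t j) - P.boundaryPoint (s j)) (x - y) ≠ 0
  cross_eq : ∀ j, y ∈ P.boundarySegment (s j) (t j) →
    cross (P.boundaryPoint (t k) - P.boundaryPoint (s k))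
      (P.boundaryPoint (t j) - P.boundaryPoint (s j)) = 0
  side : 0 < cross (P.boundaryPoint (t k) - P.boundaryPoint (s k)) (x - y) ↔ σ = true

/-- The type of `y` reveals the chords through `y`, as those with neither side in it. For any other
chord, `x` is on the side of `y`. The chords through `y` are all parallel to the `k`-th one, so that
`σ` determines the signs of their cross products with `x - y`, and hence their sides. -/
lemma IsSimple.sideType_eq_of_hitsChord (hP : P.IsSimple) (h : ∀ k, P.IsChordParam (s k) (t k))
    {k : Fin m} {σ : Bool} {x y x' y' : Plane} (hx : P.HitsChord s t k σ x y)
    (hx' : P.HitsChord s t k σ x' y') (he : P.sideType s t {y} = P.sideType s t {y'}) :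
    P.sideType s t {x} = P.sideType s t {x'} := by
  obtain ⟨ε, hε, hside⟩ := hP.exists_side_sign
  have hreg : ∀ {x y}, P.HitsChord s t k σ x y → y ∈ P.region :=
    fun hx => hx.subset (left_mem_segment ℝ _ _)
  have hon : ∀ {x y}, P.HitsChord s t k σ x y → ∀ j, y ∈ P.boundarySegment (s j) (t j) ↔
      (j, true) ∉ P.sideType s t {y} ∧ (j, false) ∉ P.sideType s t {y} := by
    intro x y hx j
    rw [mem_sideType_singleton, mem_sideType_singleton]
    constructor
    · exact fun hy => ⟨fun h1 => halfSide_notMem_chord h1 hy, fun h1 => halfSide_notMem_chord h1 hy⟩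
    · rintro ⟨h1, h2⟩
      by_contra hc
      exact h2 ((hP.halfSide_false_iff h (hreg hx) hc).2 h1)
  have hoff : ∀ {x y}, P.HitsChord s t k σ x y → ∀ j b, y ∉ P.boundarySegment (s j) (t j) →
      ((j, b) ∈ P.sideType s t {x} ↔ (j, b) ∈ P.sideType s t {y}) := by
    intro x y hx j b hj
    rw [mem_sideType_singleton, mem_sideType_singleton]
    refine (halfSide_iff_of_segment fun z hz => ⟨hx.subset hz, ?_⟩).symm
    by_cases hzy : z = y
    · rwa [hzy]
    · exact hx.notMem z hz hzy j
  have hd : P.boundaryPoint (t k) - P.boundaryPoint (s k) ≠ 0 :=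
    sub_ne_zero.2 (hP.boundaryPoint_ne (h k).lt (h k).lt_add).symm
  have htrue : ∀ j, y ∈ P.boundarySegment (s j) (t j) → y' ∈ P.boundarySegment (s j) (t j) →
      (x ∈ P.halfSide s t (j, true) ↔ x' ∈ P.halfSide s t (j, true)) := by
    intro j hj hj'
    rw [halfSide_true, hside (h j) hj (hx.ne_left j) (hx.ne_right j) hx.subset
        (fun z hz hzy => hx.notMem z hz hzy j) (hx.cross_ne j hj),
      hside (h j) hj' (hx'.ne_left j) (hx'.ne_right j) hx'.subset
        (fun z hz hzy => hx'.notMem z hz hzy j) (hx'.cross_ne j hj')]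
    have hk := hx.cross_ne k hx.mem
    have hk' := hx'.cross_ne k hx'.mem
    obtain ⟨c, hc⟩ := exists_smul_of_cross_eq_zero hd (hx.cross_eq j hj)
    rw [hc, cross_smul_left, cross_smul_left, ← mul_assoc, ← mul_assoc]
    have hs := hx.side
    have hs' := hx'.side
    cases σ
    · have a1 := lt_of_le_of_ne (not_lt.1 (fun h => by simpa using hs.1 h)) hk
      have a2 := lt_of_le_of_ne (not_lt.1 (fun h => by simpa using hs'.1 h)) hk'
      exact ⟨fun hh => mul_neg_of_pos_of_neg (pos_of_mul_neg_left hh a1.le) a2,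
        fun hh => mul_neg_of_pos_of_neg (pos_of_mul_neg_left hh a2.le) a1⟩
    · have a1 := hs.2 rfl
      have a2 := hs'.2 rfl
      exact ⟨fun hh => mul_neg_of_neg_of_pos (neg_of_mul_neg_left hh a1.le) a2,
        fun hh => mul_neg_of_neg_of_pos (neg_of_mul_neg_left hh a2.le) a1⟩
  ext ⟨j, b⟩
  by_cases hj : y ∈ P.boundarySegment (s j) (t j)
  · have hj' : y' ∈ P.boundarySegment (s j) (t j) := by
      rw [hon hx', ← he, ← hon hx]; exact hj
    have hxm : ∀ {x y}, P.HitsChord s t k σ x y → y ∈ P.boundarySegment (s j) (t j) →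
        x ∈ P.region ∧ x ∉ P.boundarySegment (s j) (t j) := by
      intro x y hx hj
      refine ⟨hx.subset (right_mem_segment ℝ _ _), hx.notMem x (right_mem_segment ℝ _ _) ?_ j⟩
      rintro rfl
      have := hx.cross_ne j hj
      simp [cross] at this
    rw [mem_sideType_singleton, mem_sideType_singleton]
    cases b
    · rw [hP.halfSide_false_iff h (hxm hx hj).1 (hxm hx hj).2,
        hP.halfSide_false_iff h (hxm hx' hj').1 (hxm hx' hj').2, htrue j hj hj']
    · exact htrue j hj hj'
  · have hj' : y' ∉ P.boundarySegment (s j) (t j) := by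
      rw [hon hx', ← he, ← hon hx]; exact hj
    rw [hoff hx j b hj, hoff hx' j b hj', he]

lemma IsSimple.exists_hit (hP : P.IsSimple) (h : ∀ k, P.IsChordParam (s k) (t k)) {x : Plane}
    (hx : x ∈ P.region) (hxK : ∀ k, x ∉ P.boundarySegment (s k) (t k)) :
    P.sideType s t {x} ∈ range (paramType n s t) ∨ ∃ k σ y, P.HitsChord s t k σ x y := by
  -- A ray that avoids the chord endpoints and the intersections of nonparallel chords first meets
  -- the chords in the way `HitsChord` asks for.
  set F : Set Plane := (⋃ k, {P.boundaryPoint (s k), P.boundaryPoint (t k)}) ∪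
    ⋃ k, ⋃ j, {y | y ∈ P.boundarySegment (s k) (t k) ∩ P.boundarySegment (s j) (t j) ∧
      cross (P.boundaryPoint (t k) - P.boundaryPoint (s k))
        (P.boundaryPoint (t j) - P.boundaryPoint (s j)) ≠ 0} with hF
  have hFfin : F.Finite := by
    refine (finite_iUnion fun k => toFinite _).union (finite_iUnion fun k => finite_iUnion fun j => ?_)
    refine Set.Subsingleton.finite ?_
    rintro a ⟨ha, hc⟩ b ⟨hb, -⟩
    exact subsingleton_inter_segment hc ha hb
  have hxF : x ∉ F := by
    rintro (hm | hm)
    · obtain ⟨k, hm | hm⟩ := mem_iUnion.1 hm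
      · exact hxK k (hm ▸ left_mem_segment ℝ _ _)
      · exact hxK k (hm ▸ right_mem_segment ℝ _ _)
    · obtain ⟨k, hm⟩ := mem_iUnion.1 hm
      obtain ⟨j, hm, -⟩ := mem_iUnion.1 hm
      exact hxK k hm.1
  obtain ⟨d, hd, hray⟩ := exists_ray_avoiding_finite hFfin hxF
  obtain ⟨c, hc, hcC, -, hseg⟩ := exists_ray_hit hx hd
  have hB : IsClosed (P.boundary ℝ ∪ ⋃ k, P.boundarySegment (s k) (t k)) :=
    P.isCompact_boundary.isClosed.union
      (isClosed_iUnion_of_finite fun k => (isCompact_segment_plane _ _).isClosed)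
  obtain ⟨e, he, heB, hmin⟩ := exists_first_mem hB (γ := fun r : ℝ => x + r • d) (a := 0) (b := c)
    (by fun_prop) hc (Or.inl hcC)
  set y := x + e • d with hy
  have hseg' : segment ℝ y x ⊆ P.region := by
    rw [segment_symm]
    intro z hz
    obtain ⟨r, hr, rfl⟩ := segment_ray he.1 hz
    refine hseg ?_
    rw [segment_eq_image']
    rcases hc.eq_or_lt with h0 | h0
    · have : r = 0 := le_antisymm (by linarith [hr.2, he.2]) hr.1
      exact ⟨0, ⟨le_rfl, zero_le_one⟩, by simp [this]⟩
    · refine ⟨r / c, ⟨div_nonneg hr.1 hc, (div_le_one h0).2 (hr.2.trans he.2)⟩, ?_⟩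
      simp only [add_sub_cancel_left, smul_smul]
      rw [div_mul_cancel₀ _ h0.ne']
  have hoff : ∀ z ∈ segment ℝ y x, z ≠ y → ∀ j, z ∉ P.boundarySegment (s j) (t j) := by
    intro z hz hzy j hj
    rw [segment_symm] at hz
    obtain ⟨r, hr, rfl⟩ := segment_ray he.1 hz
    have hre : r < e := hr.2.lt_of_ne (by rintro rfl; exact hzy rfl)
    exact hmin r ⟨hr.1, hre⟩ (Or.inr (mem_iUnion.2 ⟨j, hj⟩))
  have hyF := hray e he.1
  by_cases hyK : ∃ k, y ∈ P.boundarySegment (s k) (t k)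
  · obtain ⟨k, hk⟩ := hyK
    refine Or.inr ⟨k, decide (0 < cross (P.boundaryPoint (t k) - P.boundaryPoint (s k)) (x - y)), y,
      hk, hseg', hoff, ?_, ?_, ?_, ?_, by simp⟩
    · exact fun j hj => hyF (Or.inl (mem_iUnion.2 ⟨j, Or.inl hj⟩))
    · exact fun j hj => hyF (Or.inl (mem_iUnion.2 ⟨j, Or.inr hj⟩))
    -- If `x` were on the line of a chord through `y`, an endpoint of this chord would lie between
    -- `y` and `x`. It differs from `y` by the choice of the ray, so a chord would be met before
    -- `y`.
    · intro j hj hc0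
      rcases endpoint_mem_segment (hP.boundaryPoint_ne (h j).lt (h j).lt_add) hj (hxK j) hc0
        with hm | hm
      · refine hoff _ hm ?_ j (left_mem_segment ℝ _ _)
        exact fun hj => hyF (Or.inl (mem_iUnion.2 ⟨j, Or.inl hj.symm⟩))
      · refine hoff _ hm ?_ j (right_mem_segment ℝ _ _)
        exact fun hj => hyF (Or.inl (mem_iUnion.2 ⟨j, Or.inr hj.symm⟩))
    · intro j hj
      by_contra hc0
      exact hyF (Or.inr (mem_iUnion.2 ⟨k, mem_iUnion.2 ⟨j, ⟨hk, hj⟩, hc0⟩⟩))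
  · left
    rw [not_exists] at hyK
    have hyC : y ∈ P.boundary ℝ := by
      refine heB.resolve_right fun hm => ?_
      obtain ⟨k, hk⟩ := mem_iUnion.1 hm
      exact hyK k hk
    rw [boundary_eq_range] at hyC
    obtain ⟨u, hu⟩ := hyC
    refine ⟨u, ?_⟩
    ext p
    rw [mem_sideType_singleton, ← halfSide_iff_of_segment (x := y) (fun z hz => ⟨hseg' hz, ?_⟩), ← hu,
      hP.boundaryPoint_mem_halfSide h]
    · rw [hu]; exact hyK _
    · by_cases hzy : z = y
      · rw [hzy]; exact hyK _
      · exact hoff z hz hzy _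

/-- The number of types of points is at most quadratic. -/
lemma IsSimple.ncard_pointTypes_le (hP : P.IsSimple) (h : ∀ k, P.IsChordParam (s k) (t k))
    (hs : ∀ k, s k ∈ Ico (0 : ℝ) n) :
    ((fun x => P.sideType s t {x}) '' P.region).ncard ≤
      m * (4 * m + 1) + ((8 * m + 1) + m * (2 * (4 * m + 1))) := by
  -- The terms of the bound: points on a chord; points whose ray reaches the boundary off all
  -- chords; points whose ray stops at a chord, counted by chord, side and type of the hit point.
  have hsub : (fun x => P.sideType s t {x}) '' P.region ⊆
      (⋃ k, (fun x => P.sideType s t {x}) '' P.boundarySegment (s k) (t k)) ∪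
      (range (paramType n s t) ∪ ⋃ k, ⋃ σ, (fun q : Plane × Plane => P.sideType s t {q.1}) ''
        {q | P.HitsChord s t k σ q.1 q.2}) := by
    rintro _ ⟨x, hx, rfl⟩
    by_cases hxK : ∃ k, x ∈ P.boundarySegment (s k) (t k)
    · obtain ⟨k, hk⟩ := hxK
      exact Or.inl (mem_iUnion.2 ⟨k, x, hk, rfl⟩)
    · rw [not_exists] at hxK
      rcases hP.exists_hit h hx hxK with h1 | ⟨k, σ, y, hy⟩
      · exact Or.inr (Or.inl h1)
      · exact Or.inr (Or.inr (mem_iUnion.2 ⟨k, mem_iUnion.2 ⟨σ, (x, y), hy, rfl⟩⟩))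
  refine (ncard_le_ncard hsub (toFinite _)).trans ((ncard_union_le _ _).trans (add_le_add ?_
    ((ncard_union_le _ _).trans (add_le_add
      (ncard_paramType_le hs (fun k => (h k).lt) (fun k => (h k).lt_add)) ?_))))
  · refine (ncard_iUnion_le_mul fun k => ncard_sideType_segment_le P s t (h k).subset).trans ?_
    rw [Fintype.card_fin]
  · refine (ncard_iUnion_le_mul (N := 2 * (4 * m + 1)) fun k =>
      (ncard_iUnion_le_mul (N := 4 * m + 1) fun σ => ?_).trans ?_).trans ?_
    · refine (ncard_image_le_of_factor (f := fun q : Plane × Plane => P.sideType s t {q.2})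
        (fun a ha b hb hab => hP.sideType_eq_of_hitsChord h ha hb hab) (toFinite _)).trans ?_
      refine (ncard_le_ncard ?_ (toFinite _)).trans (ncard_sideType_segment_le P s t (h k).subset)
      rintro _ ⟨q, hq, rfl⟩
      exact ⟨q.2, hq.mem, rfl⟩
    · rw [Fintype.card_bool]
    · rw [Fintype.card_fin]

end Types

/-! ### Types of subchains and of anchor hulls -/

section Anchors

variable {m : ℕ} {s t : Fin m → ℝ}

/-- The types of the points of the polygon. -/
def pointTypes (P : Polygon Plane n) (s t : Fin m → ℝ) : Set (Set (Fin m × Bool)) :=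
  (fun x => P.sideType s t {x}) '' P.region

/-- The types of the subchains of the boundary. -/
def chainTypes (P : Polygon Plane n) (s t : Fin m → ℝ) : Set (Set (Fin m × Bool)) :=
  P.sideType s t '' {C | P.IsSubchain C}

/-- A bound for the number of types of points. -/
def pointTypeBound (m : ℕ) : ℕ := m * (4 * m + 1) + ((8 * m + 1) + m * (2 * (4 * m + 1)))

/-- A bound for the number of types of subchains. -/
def chainTypeBound (m : ℕ) : ℕ :=
  m * (2 * ((2 * m + 1) * (2 * m + 1))) + (pointTypeBound m ^ 2 + (8 * m + 1))

omit [NeZero n] in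
-- Without a chord endpoint between them, `u` and `v` have the same position relative to all ends of
-- the arcs.
lemma paramType_subset_of_notMem_Icc {σ τ : ℝ}
    (h : ∀ (k : Fin m) (z : ℤ), s k + z * n ∉ Icc σ τ ∧ t k + z * n ∉ Icc σ τ) {u v : ℝ}
    (hu : u ∈ Icc σ τ) (hv : v ∈ Icc σ τ) : paramType n s t u ⊆ paramType n s t v := by
  have key : ∀ (e : ℝ) (z : ℤ), e + (-z : ℤ) * n ∉ Icc σ τ →
      (e < u + z * n → e < v + z * n) ∧ (u + z * n < e → v + z * n < e) := by
    intro e z he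
    push_cast at he
    constructor
    · intro h1
      by_contra h2
      exact he ⟨by linarith [hv.1], by linarith [hu.2]⟩
    · intro h1
      by_contra h2
      exact he ⟨by linarith [hu.1], by linarith [hv.2]⟩
  rintro ⟨k, b⟩ ⟨z, hz⟩
  refine ⟨z, ?_⟩
  cases b
  · simp only [Bool.false_eq_true, if_false] at hz ⊢
    refine ⟨(key _ z (h k (-z)).2).1 hz.1, (key _ z ?_).2 hz.2⟩
    have := (h k (1 - z)).1
    rwa [show s k + ((1 - z : ℤ) : ℝ) * n = s k + n + (-z : ℤ) * n by push_cast; ring] at this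
  · simp only [if_true] at hz ⊢
    exact ⟨(key _ z (h k (-z)).1).1 hz.1, (key _ z (h k (-z)).2).2 hz.2⟩

/-- The type of a compact subset of a segment is determined by two of its points. -/
lemma exists_sideType_eq_union {a b : Plane} (hseg : segment ℝ a b ⊆ P.region) {S : Set Plane}
    (hS : IsCompact S) (hne : S.Nonempty) (hsub : S ⊆ segment ℝ a b) :
    ∃ p ∈ S, ∃ q ∈ S, P.sideType s t S = P.sideType s t {p} ∪ P.sideType s t {q} := by
  set L : Set ℝ := Icc 0 1 ∩ AffineMap.lineMap a b ⁻¹' S with hL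
  have hLc : IsCompact L :=
    isCompact_Icc.inter_right (hS.isClosed.preimage AffineMap.lineMap_continuous)
  have hSL : S ⊆ AffineMap.lineMap a b '' L := by
    intro x hx
    have := hsub hx
    rw [segment_eq_image_lineMap] at this
    obtain ⟨l, hl, rfl⟩ := this
    exact ⟨l, ⟨hl, hx⟩, rfl⟩
  have hLne : L.Nonempty := (hne.mono hSL).of_image
  obtain ⟨l, hl, hlmin⟩ := hLc.exists_isLeast hLne
  obtain ⟨r, hr, hrmax⟩ := hLc.exists_isGreatest hLne
  have hlr : l ≤ r := hlmin hr
  have he : segment ℝ (AffineMap.lineMap a b l : Plane) (AffineMap.lineMap a b r) =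
      AffineMap.lineMap a b '' Icc l r := by
    rw [← image_segment, segment_eq_Icc hlr]
  refine ⟨_, hl.2, _, hr.2, Subset.antisymm ?_ (union_subset
    (sideType_mono (singleton_subset_iff.2 hl.2)) (sideType_mono (singleton_subset_iff.2 hr.2)))⟩
  rw [← sideType_segment]
  · refine sideType_mono (hSL.trans ?_)
    rw [he]
    exact image_mono fun x hx => ⟨hlmin hx, hrmax hx⟩
  · refine subset_trans ?_ hseg
    rw [he, segment_eq_image_lineMap]
    exact image_mono (Icc_subset_Icc hl.1.1 hr.1.2)

lemma IsSubchain.shift {C : Set Plane} {σ τ : ℝ} (hC : C = P.boundaryPoint '' Icc σ τ) (z : ℤ) :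
    C = P.boundaryPoint '' Icc (σ + z * n) (τ + z * n) := by
  rw [hC, ← image_add_const_Icc, image_image]
  simp_rw [P.boundaryPoint_add_int_mul]

lemma IsSubchain.subset_region {C : Set Plane} (hC : P.IsSubchain C) : C ⊆ P.region := by
  obtain ⟨σ, τ, -, rfl⟩ := hC
  rintro _ ⟨u, -, rfl⟩
  exact P.boundaryPoint_mem_region u

lemma IsSimple.ncard_pointTypes_le_bound (hP : P.IsSimple)
    (h : ∀ k, P.IsChordParam (s k) (t k)) (hs : ∀ k, s k ∈ Ico (0 : ℝ) n) :
    (P.pointTypes s t).ncard ≤ pointTypeBound m :=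
  hP.ncard_pointTypes_le h hs

/-- A chain that contains a chord endpoint is cut there. The pieces with one end fixed form nested
families, so few types occur. In a chain without chord endpoints all parameters have the same
`paramType`; it is the type of the chain if every chord is left somewhere. Otherwise the chain lies
on a chord, and its two extreme points determine its type. -/
lemma IsSimple.chainTypes_subset (hP : P.IsSimple) (h : ∀ k, P.IsChordParam (s k) (t k)) :
    P.chainTypes s t ⊆
      (⋃ k, ⋃ b : Bool, image2 (· ∪ ·)
        (range fun σ => P.sideType s t (P.boundaryPoint '' Icc σ (if b then s k else t k)))
        (range fun τ => P.sideType s t (P.boundaryPoint '' Icc (if b then s k else t k) τ))) ∪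
      (image2 (· ∪ ·) (P.pointTypes s t) (P.pointTypes s t) ∪ range (paramType n s t)) := by
  rintro _ ⟨C, hC, rfl⟩
  have hCreg := hC.subset_region
  obtain ⟨σ, τ, hστ, hCe⟩ := hC
  by_cases hbr : ∀ (k : Fin m) (z : ℤ), s k + z * n ∉ Icc σ τ ∧ t k + z * n ∉ Icc σ τ
  · right
    by_cases hK : ∃ k, C ⊆ P.boundarySegment (s k) (t k)
    · left
      obtain ⟨k, hk⟩ := hK
      obtain ⟨p, hp, q, hq, he⟩ := exists_sideType_eq_union (s := s) (t := t) (h k).subset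
        (S := C) (hCe ▸ isCompact_Icc.image P.continuous_boundaryPoint)
        (hCe ▸ (nonempty_Icc.2 hστ).image _) hk
      rw [he]
      exact mem_image2_of_mem ⟨p, hCreg hp, rfl⟩ ⟨q, hCreg hq, rfl⟩
    · right
      rw [not_exists] at hK
      refine ⟨σ, ?_⟩
      have hσ : σ ∈ Icc σ τ := left_mem_Icc.2 hστ
      ext p
      rw [mem_sideType]
      constructor
      · intro hp
        obtain ⟨x, hx, hxK⟩ := not_subset.1 (hK p.1)
        rw [hCe] at hx
        obtain ⟨u, hu, rfl⟩ := hx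
        refine ⟨P.boundaryPoint u, hCe ▸ mem_image_of_mem _ hu, ?_⟩
        exact (hP.boundaryPoint_mem_halfSide h hxK).2 (paramType_subset_of_notMem_Icc hbr hσ hu hp)
      · rintro ⟨x, hx, hxp⟩
        rw [hCe] at hx
        obtain ⟨u, hu, rfl⟩ := hx
        exact paramType_subset_of_notMem_Icc hbr hu hσ
          ((hP.boundaryPoint_mem_halfSide h (halfSide_notMem_chord hxp)).1 hxp)
  · left
    have key : ∃ (k : Fin m) (b : Bool) (z : ℤ), (if b then s k else t k) + z * n ∈ Icc σ τ := by
      simp only [not_forall, not_and_or, not_not] at hbr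
      obtain ⟨k, z, h1 | h1⟩ := hbr
      exacts [⟨k, true, z, h1⟩, ⟨k, false, z, h1⟩]
    obtain ⟨k, b, z, hz⟩ := key
    refine mem_iUnion.2 ⟨k, mem_iUnion.2 ⟨b, ?_⟩⟩
    rw [IsSubchain.shift hCe (-z)]
    push_cast
    rw [← Icc_union_Icc_eq_Icc (b := if b then s k else t k) (by linarith [hz.1])
      (by linarith [hz.2]), image_union, sideType_union]
    exact mem_image2_of_mem ⟨_, rfl⟩ ⟨_, rfl⟩

lemma IsSimple.ncard_chainTypes_le (hP : P.IsSimple) (h : ∀ k, P.IsChordParam (s k) (t k))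
    (hs : ∀ k, s k ∈ Ico (0 : ℝ) n) : (P.chainTypes s t).ncard ≤ chainTypeBound m := by
  refine (ncard_le_ncard (hP.chainTypes_subset h) (toFinite _)).trans
    ((ncard_union_le _ _).trans (add_le_add ?_ ((ncard_union_le _ _).trans (add_le_add ?_
      (ncard_paramType_le hs (fun k => (h k).lt) (fun k => (h k).lt_add))))))
  · have hcard : Nat.card (Fin m × Bool) + 1 = 2 * m + 1 := by simp; ring
    refine (ncard_iUnion_le_mul fun k => (ncard_iUnion_le_mul fun b =>
      (ncard_image2_le_mul _ _ _).trans (Nat.mul_le_mul (n₂ := 2 * m + 1) (m₂ := 2 * m + 1)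
        ?_ ?_)).trans_eq (by rw [Fintype.card_bool])).trans_eq (by rw [Fintype.card_fin])
    · rw [← image_univ, ← hcard]
      refine ncard_image_le_of_antitoneOn fun x _ y _ hxy => ?_
      exact sideType_mono (image_mono (Icc_subset_Icc_left hxy))
    · rw [← image_univ, ← hcard]
      refine ncard_image_le_of_monotoneOn fun x _ y _ hxy => ?_
      exact sideType_mono (image_mono (Icc_subset_Icc_right hxy))
  · refine (ncard_image2_le_mul _ _ _).trans ?_
    rw [sq]
    exact Nat.mul_le_mul (hP.ncard_pointTypes_le_bound h hs) (hP.ncard_pointTypes_le_bound h hs)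

lemma sideType_geodesicHull (h : ∀ k, P.IsChordParam (s k) (t k)) {S : Set Plane}
    (hS : S ⊆ P.region) : P.sideType s t (P.geodesicHull S) = P.sideType s t S := by
  ext ⟨k, b⟩
  cases b
  · exact inter_geodesicHull_nonempty_iff (h k).swap.subset hS
  · exact inter_geodesicHull_nonempty_iff (h k).subset hS

lemma IsAnchor.subset_region {A : Set Plane} (hA : P.IsAnchor A) : A ⊆ P.region := by
  rcases hA with ⟨p, hp, rfl⟩ | hA
  exacts [singleton_subset_iff.2 hp, hA.subset_region]

lemma iUnion_pad {ι : Type*} {j k : ℕ} (hj : j ≤ k) (F : Fin j → Set ι) :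
    (⋃ i : Fin k, if h : (i : ℕ) < j then F ⟨i, h⟩ else ∅) = ⋃ i, F i := by
  ext x
  simp only [mem_iUnion]
  constructor
  · rintro ⟨i, hi⟩
    split_ifs at hi with hij
    exacts [⟨_, hi⟩, hi.elim]
  · rintro ⟨i, hi⟩
    exact ⟨Fin.castLE hj i, by simpa using hi⟩

/-- The type of a hull is the union of the types of its anchors. Each of the `k` slots holds the
type of a point or of a subchain, or `∅` if fewer anchors are used. -/
lemma IsSimple.ncard_anchorHullTypes_le (hP : P.IsSimple) (h : ∀ k, P.IsChordParam (s k) (t k))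
    (hs : ∀ k, s k ∈ Ico (0 : ℝ) n) (k : ℕ) :
    (P.sideType s t '' {X | P.IsAnchorHull k X}).ncard ≤
      (pointTypeBound m + chainTypeBound m + 1) ^ k := by
  refine (ncard_le_ncard ?_ (toFinite _)).trans ((ncard_iUnion_choice_le k
    (insert ∅ (P.pointTypes s t ∪ P.chainTypes s t))).trans (Nat.pow_le_pow_left ?_ k))
  · rintro _ ⟨X, ⟨j, hj, A, hA, rfl⟩, rfl⟩
    refine ⟨fun i => if h : (i : ℕ) < j then P.sideType s t (A ⟨i, h⟩) else ∅, fun i => ?_, ?_⟩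
    · simp only
      split_ifs with hi
      · right
        rcases hA ⟨i, hi⟩ with ⟨p, hp, he⟩ | hc
        · exact Or.inl ⟨p, hp, by simp only [he]⟩
        · exact Or.inr ⟨_, hc, rfl⟩
      · exact Or.inl rfl
    · rw [iUnion_pad hj (fun i => P.sideType s t (A i)), ← sideType_iUnion,
        sideType_geodesicHull h (iUnion_subset fun i => (hA i).subset_region)]
  · refine (ncard_insert_le _ _).trans (Nat.add_le_add_right ((ncard_union_le _ _).trans
      (add_le_add (hP.ncard_pointTypes_le_bound h hs) (hP.ncard_chainTypes_le h hs))) 1)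

end Anchors

/-! ### Types of cells -/

lemma IsSimple.isClosed_halfPolygon (hP : P.IsSimple) {s t : ℝ} (h : P.IsChordParam s t) :
    IsClosed (P.openHalfPolygon s t ∪ P.boundarySegment s t) := by
  rw [← isOpen_compl_iff, isOpen_iff_mem_nhds]
  intro x hx
  rw [mem_compl_iff, mem_union, not_or] at hx
  have hsub : P.openHalfPolygon s t ∪ P.boundarySegment s t ⊆ P.region :=
    union_subset (fun y hy => (openHalfPolygon_subset hy).1) h.subset
  by_cases hxr : x ∈ P.region
  · have hx' := (h.mem_or_mem hxr hx.2).resolve_left hx.1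
    filter_upwards [hP.eventually_mem_openHalfPolygon_swap h hx'] with y hy hyH
    have hy' := hy (hsub hyH)
    rcases hyH with h1 | h1
    · exact Set.disjoint_left.1 (hP.disjoint_openHalfPolygon h) h1 hy'
    · exact (openHalfPolygon_subset hy').2 (by rwa [boundarySegment_swap])
  · filter_upwards [P.isClosed_region.isOpen_compl.mem_nhds hxr] with y hy hyH
    exact hy (hsub hyH)

lemma boundaryPoint_mem_halfPolygon {s t u : ℝ} {z : ℤ} (hu : u + z * n ∈ Icc s t) :
    P.boundaryPoint u ∈ P.openHalfPolygon s t ∪ P.boundarySegment s t := by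
  rw [← P.boundaryPoint_add_int_mul u z]
  by_cases hK : P.boundaryPoint (u + z * n) ∈ P.boundarySegment s t
  · exact Or.inr hK
  · refine Or.inl (boundaryPoint_mem_openHalfPolygon ⟨hu.1.lt_of_ne ?_, hu.2.lt_of_ne ?_⟩ hK)
    · intro he; rw [← he] at hK; exact hK (left_mem_segment ℝ _ _)
    · intro he; rw [he] at hK; exact hK (right_mem_segment ℝ _ _)

lemma IsSimple.exists_int_of_mem_openHalfPolygon (hP : P.IsSimple) {s t u : ℝ}
    (h : P.IsChordParam s t) (hu : P.boundaryPoint u ∈ P.openHalfPolygon s t) :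
    ∃ z : ℤ, u + z * n ∈ Ioo s t := by
  have hK := (openHalfPolygon_subset hu).2
  rcases h.boundary_cases (P.boundaryPoint_mem u) hK with ⟨w, hw, he⟩ | ⟨w, hw, he⟩
  · obtain ⟨z, rfl⟩ := hP.exists_int_of_boundaryPoint_eq he.symm
    exact ⟨z, hw⟩
  · refine absurd ?_ (Set.disjoint_left.1 (hP.disjoint_openHalfPolygon h) hu)
    rw [← he] at hK ⊢
    exact boundaryPoint_mem_openHalfPolygon hw (by rwa [boundarySegment_swap])

/-- The part of `X` that is swept when one runs along the boundary from the parameter `s` as long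
as one stays in `X`. -/
def initialArc (P : Polygon Plane n) (s : ℝ) (X : Set Plane) : Set Plane :=
  P.boundaryPoint '' {v | v ∈ Icc s (s + n) ∧ ∀ w ∈ Icc s v, P.boundaryPoint w ∈ X}

lemma initialArc_subset (s : ℝ) (X : Set Plane) : P.initialArc s X ⊆ X := by
  rintro _ ⟨v, ⟨hv, hX⟩, rfl⟩
  exact hX v ⟨hv.1, le_rfl⟩

/-- The admissible end parameters form an interval that starts at `s`; as `X` is closed, it contains
its supremum. -/
lemma initialArc_eq_empty_or_isSubchain (P : Polygon Plane n) (s : ℝ) {X : Set Plane}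
    (hX : IsClosed X) : P.initialArc s X = ∅ ∨ P.IsSubchain (P.initialArc s X) := by
  set V : Set ℝ := {v | v ∈ Icc s (s + n) ∧ ∀ w ∈ Icc s v, P.boundaryPoint w ∈ X} with hV
  rcases V.eq_empty_or_nonempty with h0 | hne
  · left
    rw [initialArc, ← hV, h0, image_empty]
  right
  have hbdd : BddAbove V := ⟨s + n, fun v hv => hv.1.2⟩
  have hsup : s ≤ sSup V := hne.elim fun v hv => hv.1.1.trans (le_csSup hbdd hv)
  refine ⟨s, sSup V, hsup, ?_⟩
  rw [initialArc, ← hV]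
  congr 1
  refine Subset.antisymm (fun v hv => ⟨hv.1.1, le_csSup hbdd hv⟩) fun v hv => ?_
  have hmem : P.boundaryPoint (sSup V) ∈ X :=
    hX.closure_subset_iff.2 (image_subset_iff.2 fun v hv => hv.2 v ⟨hv.1.1, le_rfl⟩)
      (image_closure_subset_closure_image P.continuous_boundaryPoint
        (mem_image_of_mem _ (csSup_mem_closure hne hbdd)))
  refine ⟨⟨hv.1, hv.2.trans (csSup_le hne fun w hw => hw.1.2)⟩, fun w hw => ?_⟩
  rcases (hw.2.trans hv.2).eq_or_lt with he | hlt
  · rwa [he]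
  · obtain ⟨r, hr, hwr⟩ := exists_lt_of_lt_csSup hne hlt
    exact hr.2 w ⟨hw.1, hwr.le⟩

section Cells

variable {j : ℕ} {σ τ : Fin j → ℝ}

/-- The cell that is bounded by the chords of a family. -/
def cellOf (P : Polygon Plane n) (σ τ : Fin j → ℝ) : Set Plane :=
  P.region ∩ ⋂ i, (P.openHalfPolygon (σ i) (τ i) ∪ P.boundarySegment (σ i) (τ i))

lemma IsSimple.isClosed_cellOf (hP : P.IsSimple) (h : ∀ i, P.IsChordParam (σ i) (τ i)) :
    IsClosed (P.cellOf σ τ) :=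
  P.isClosed_region.inter (isClosed_iInter fun i => hP.isClosed_halfPolygon (h i))

lemma mem_cellOf {x : Plane} : x ∈ P.cellOf σ τ ↔ x ∈ P.region ∧
    ∀ i, x ∈ P.openHalfPolygon (σ i) (τ i) ∪ P.boundarySegment (σ i) (τ i) := by
  rw [cellOf, mem_inter_iff, mem_iInter]

variable {m : ℕ} {s t : Fin m → ℝ}

/-- From a point of a cell in an open half-polygon, one reaches the boundary or a bounding chord of
the cell along a ray that avoids the chord of the half-polygon. -/
lemma exists_exit_of_mem_cellOf {p : Fin m × Bool} {x : Plane} (hx : x ∈ P.cellOf σ τ)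
    (hp : x ∈ P.halfSide s t p) : ∃ y ∈ P.cellOf σ τ, y ∈ P.halfSide s t p ∧
      (y ∈ P.boundary ℝ ∨ ∃ i, y ∈ P.boundarySegment (σ i) (τ i)) := by
  rw [mem_cellOf] at hx
  obtain ⟨d, hd, hray⟩ := exists_ray_avoiding_segment (halfSide_notMem_chord hp)
  obtain ⟨c, hc, hcC, -, hseg⟩ := exists_ray_hit hx.1 hd
  have hB : IsClosed (P.boundary ℝ ∪ ⋃ i, P.boundarySegment (σ i) (τ i)) :=
    P.isCompact_boundary.isClosed.union
      (isClosed_iUnion_of_finite fun i => (isCompact_segment_plane _ _).isClosed)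
  -- Stopping at the first point of the boundary or of a bounding chord keeps `y` in the cell.
  obtain ⟨e, he, heB, hmin⟩ := exists_first_mem hB (γ := fun r : ℝ => x + r • d) (a := 0) (b := c)
    (by fun_prop) hc (Or.inl hcC)
  set y := x + e • d with hy
  have hxy : segment ℝ x y ⊆ P.region := by
    refine subset_trans ((convex_segment _ _).segment_subset (left_mem_segment ℝ x _) ?_) hseg
    have himg : AffineMap.lineMap (k := ℝ) x (x + d) '' Icc 0 c = segment ℝ x (x + c • d) := by
      rw [← segment_eq_Icc hc, image_segment]
      simp [AffineMap.lineMap_apply, add_comm]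
    rw [← himg]
    exact ⟨e, he, by simp [AffineMap.lineMap_apply, hy, add_comm]⟩
  refine ⟨y, mem_cellOf.2 ⟨hxy (right_mem_segment ℝ x y), fun i => ?_⟩, ?_, ?_⟩
  · by_cases hyK : y ∈ P.boundarySegment (σ i) (τ i)
    · exact Or.inr hyK
    left
    have hav : segment ℝ y x ⊆ P.region \ P.boundarySegment (σ i) (τ i) := by
      rw [segment_symm]
      refine fun z hz => ⟨hxy hz, ?_⟩
      obtain ⟨r, hr, rfl⟩ := segment_ray he.1 hz
      rcases hr.2.eq_or_lt with h1 | h1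
      · rwa [h1]
      · exact fun hK => hmin r ⟨hr.1, h1⟩ (Or.inr (mem_iUnion.2 ⟨i, hK⟩))
    exact openHalfPolygon_of_joinedIn
      ((hx.2 i).resolve_right (hav (right_mem_segment ℝ y x)).2) (joinedIn_of_segment hav)
  · refine (halfSide_iff_of_segment fun z hz => ⟨hxy hz, ?_⟩).1 hp
    obtain ⟨r, hr, rfl⟩ := segment_ray he.1 hz
    exact hray r hr.1
  · exact heB.imp_right fun hm => mem_iUnion.1 hm

lemma IsSimple.exists_mem_initialArc (hP : P.IsSimple) (h : ∀ i, P.IsChordParam (σ i) (τ i))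
    (hj : 0 < j) {y : Plane} (hy : y ∈ P.cellOf σ τ) (hyC : y ∈ P.boundary ℝ)
    (hyK : ∀ i, y ∉ P.boundarySegment (σ i) (τ i)) :
    ∃ i, y ∈ P.initialArc (σ i) (P.cellOf σ τ) := by
  rw [boundary_eq_range] at hyC
  obtain ⟨u, rfl⟩ := hyC
  have hz : ∀ i, ∃ z : ℤ, u + z * n ∈ Ioo (σ i) (τ i) := fun i =>
    hP.exists_int_of_mem_openHalfPolygon (h i) (((mem_cellOf.1 hy).2 i).resolve_right (hyK i))
  choose z hz using hz
  have : Nonempty (Fin j) := ⟨⟨0, hj⟩⟩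
  -- Among the bounding chains, lifted so as to contain `u`, take the one that starts last. From its
  -- start up to `u` one stays in all of them, hence in the cell.
  obtain ⟨i, hi⟩ := Finite.exists_max fun i => σ i - z i * n
  refine ⟨i, u + z i * n, ⟨⟨(hz i).1.le, by linarith [(hz i).2, (h i).lt_add]⟩, fun w hw => ?_⟩,
    P.boundaryPoint_add_int_mul u (z i)⟩
  refine mem_cellOf.2 ⟨P.boundaryPoint_mem_region w, fun l => ?_⟩
  refine boundaryPoint_mem_halfPolygon (z := z l - z i) ⟨?_, ?_⟩
  · have := hi l
    push_cast
    linarith [hw.1]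
  · push_cast
    linarith [hw.2, (hz l).2]

/-- A point of the cell can be moved, without changing its side of a given chord, to a bounding
chord or to a boundary point off the bounding chords. The latter lies on the arc that starts at one
of these chords. -/
lemma IsSimple.sideType_cellOf (hP : P.IsSimple) (h : ∀ i, P.IsChordParam (σ i) (τ i))
    (hj : 0 < j) : P.sideType s t (P.cellOf σ τ) =
      ⋃ i, (P.sideType s t (P.initialArc (σ i) (P.cellOf σ τ)) ∪
        P.sideType s t (P.cellOf σ τ ∩ P.boundarySegment (σ i) (τ i))) := by
  refine Subset.antisymm (fun p hp => ?_) (iUnion_subset fun i => union_subset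
    (sideType_mono (initialArc_subset _ _)) (sideType_mono inter_subset_left))
  obtain ⟨x, hx, hxp⟩ := mem_sideType.1 hp
  obtain ⟨y, hy, hyp, hyB⟩ := exists_exit_of_mem_cellOf hx hxp
  by_cases hyK : ∃ i, y ∈ P.boundarySegment (σ i) (τ i)
  · obtain ⟨i, hi⟩ := hyK
    exact mem_iUnion.2 ⟨i, Or.inr (mem_sideType.2 ⟨y, ⟨hy, hi⟩, hyp⟩)⟩
  · rw [or_iff_left hyK] at hyB
    rw [not_exists] at hyK
    obtain ⟨i, hi⟩ := hP.exists_mem_initialArc h hj hy hyB hyK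
    exact mem_iUnion.2 ⟨i, Or.inl (mem_sideType.2 ⟨y, hi, hyp⟩)⟩

/-- Each bounding chord contributes an arc, which is a subchain or empty, and a compact piece of the
chord, which is empty or has the type of two points. The final `+ 1` is for the cell without
half-polygons, the polygon itself. -/
lemma IsSimple.ncard_cellTypes_le (hP : P.IsSimple) (h : ∀ k, P.IsChordParam (s k) (t k))
    (hs : ∀ k, s k ∈ Ico (0 : ℝ) n) (k : ℕ) :
    (P.sideType s t '' {X | P.IsCell k X}).ncard ≤
      ((chainTypeBound m + 1) * (pointTypeBound m ^ 2 + 1)) ^ k + 1 := by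
  refine (ncard_le_ncard (t := insert (P.sideType s t P.region)
    {T | ∃ F : Fin k → Set (Fin m × Bool), (∀ i, F i ∈ image2 (· ∪ ·)
      (insert ∅ (P.chainTypes s t))
      (insert ∅ (image2 (· ∪ ·) (P.pointTypes s t) (P.pointTypes s t)))) ∧ T = ⋃ i, F i})
    ?_ (toFinite _)).trans ((ncard_insert_le _ _).trans (Nat.add_le_add_right
      ((ncard_iUnion_choice_le k _).trans (Nat.pow_le_pow_left ((ncard_image2_le_mul _ _ _).trans
        (Nat.mul_le_mul ((ncard_insert_le _ _).trans
          (Nat.add_le_add_right (hP.ncard_chainTypes_le h hs) 1)) ((ncard_insert_le _ _).trans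
          (Nat.add_le_add_right ((ncard_image2_le_mul _ _ _).trans ?_) 1)))) k)) 1))
  · rintro _ ⟨X, ⟨j, hj, H, hH, rfl⟩, rfl⟩
    choose σ τ h1 h2 h3 h4 using hH
    have hc : ∀ i, P.IsChordParam (σ i) (τ i) := fun i => ⟨h1 i, h2 i, h3 i⟩
    have hX : P.region ∩ ⋂ i, H i = P.cellOf σ τ := by
      rw [cellOf]; simp_rw [← h4]
    rw [hX]
    rcases Nat.eq_zero_or_pos j with rfl | hj0
    · left
      rw [cellOf, iInter_of_empty, inter_univ]
    · right
      refine ⟨fun i => if h : (i : ℕ) < j then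
        (P.sideType s t (P.initialArc (σ ⟨i, h⟩) (P.cellOf σ τ)) ∪
          P.sideType s t (P.cellOf σ τ ∩ P.boundarySegment (σ ⟨i, h⟩) (τ ⟨i, h⟩))) else ∅,
        fun i => ?_, ?_⟩
      · simp only
        split_ifs with hi
        · refine mem_image2_of_mem ?_ ?_
          · rcases P.initialArc_eq_empty_or_isSubchain (σ ⟨i, hi⟩) (hP.isClosed_cellOf hc)
              with h0 | h0
            · rw [h0, sideType_empty]; exact mem_insert _ _
            · exact Or.inr ⟨_, h0, rfl⟩
          · rcases (P.cellOf σ τ ∩ P.boundarySegment (σ ⟨i, hi⟩) (τ ⟨i, hi⟩)).eq_empty_or_nonempty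
              with h0 | h0
            · rw [h0, sideType_empty]; exact mem_insert _ _
            · obtain ⟨p, hp, q, hq, he⟩ := exists_sideType_eq_union (s := s) (t := t)
                (S := P.cellOf σ τ ∩ P.boundarySegment (σ ⟨i, hi⟩) (τ ⟨i, hi⟩))
                (hc ⟨i, hi⟩).subset ((isCompact_segment_plane _ _).inter_left
                  (hP.isClosed_cellOf hc)) h0 inter_subset_right
              rw [he]
              exact Or.inr (mem_image2_of_mem ⟨p, (mem_cellOf.1 hp.1).1, rfl⟩
                ⟨q, (mem_cellOf.1 hq.1).1, rfl⟩)
        · exact ⟨∅, mem_insert _ _, ∅, mem_insert _ _, union_empty ∅⟩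
      · rw [hP.sideType_cellOf hc hj0]
        exact (iUnion_pad hj _).symm
  · rw [sq]
    exact Nat.mul_le_mul (hP.ncard_pointTypes_le_bound h hs) (hP.ncard_pointTypes_le_bound h hs)

end Cells

/-! ### The VC-dimension -/

/-- A shattered set of chords is not larger than the number of types of ranges allows. -/
lemma IsSimple.encard_lt_of_shatters (hP : P.IsSimple) {𝒦 : Set (Set Plane)}
    (h𝒦 : ∀ K ∈ 𝒦, P.IsChord K) {F : Set Plane → Prop} {m : ℕ}
    (hF : ∀ s t : Fin m → ℝ, (∀ k, P.IsChordParam (s k) (t k)) → (∀ k, s k ∈ Ico (0 : ℝ) n) →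
      (P.sideType s t '' {X | F X}).ncard < 2 ^ m)
    {A : Set (Set Plane)} (hA : (P.crossingRangeSpace 𝒦 F).Shatters A) : A.encard < m := by
  by_contra! hm
  obtain ⟨B, hBA, hB⟩ := exists_subset_encard_eq hm
  have hBfin : B.Finite := finite_of_encard_eq_coe hB
  have hBcard : Nat.card B = m := by
    rw [Nat.card_coe_set_eq, ncard, hB, ENat.toNat_natCast]
  have : Finite B := hBfin
  let e : Fin m ≃ B := (Finite.equivFinOfCardEq hBcard).symm
  have hpar : ∀ k : Fin m, ∃ s t : ℝ, s ∈ Ico (0 : ℝ) n ∧ P.IsChordParam s t ∧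
      (e k : Set Plane) = P.boundarySegment s t := by
    intro k
    obtain ⟨a, ha, b, hb, hab, hK, hsub⟩ := h𝒦 _ (hA.1 (hBA (e k).2))
    obtain ⟨s, hs, rfl⟩ := P.exists_boundaryPoint_eq 0 ha
    obtain ⟨t, ht, rfl⟩ := P.exists_boundaryPoint_eq s hb
    rw [zero_add] at hs
    exact ⟨s, t, hs, ⟨ht.1.lt_of_ne (by rintro rfl; exact hab rfl), ht.2, by
      rwa [hK] at hsub⟩, hK⟩
  choose s t hs hc hK using hpar
  -- `R` reads off the crossed chords from a type. Shattering makes it map the types of ranges onto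
  -- all `2 ^ m` subsets.
  let R : Set (Fin m × Bool) → Set (Fin m) := fun T => {k | (k, true) ∈ T ∧ (k, false) ∈ T}
  have huniv : R '' (P.sideType s t '' {X | F X}) = univ := by
    refine eq_univ_of_forall fun S => ?_
    have hS : ((fun k => (e k : Set Plane)) '' S) ∈ 𝒫 A := by
      rintro _ ⟨k, -, rfl⟩
      exact hBA (e k).2
    rw [← hA.2] at hS
    obtain ⟨_, ⟨X, hX, rfl⟩, hR⟩ := hS
    refine ⟨_, ⟨X, hX, rfl⟩, ?_⟩
    ext k
    have h1 : k ∈ S ↔ P.Crosses (e k) X := by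
      have h2 : (e k : Set Plane) ∈ (fun k => (e k : Set Plane)) '' S ↔ P.Crosses (e k) X := by
        rw [hR]
        exact ⟨fun h => h.2.2, fun h => ⟨hBA (e k).2, hA.1 (hBA (e k).2), h⟩⟩
      rw [← h2]
      exact ((Subtype.val_injective.comp e.injective).mem_set_image (s := S) (a := k)).symm
    rw [h1, hK k, hP.crosses_iff (hc k)]
    rfl
  have h1 := ncard_image_le (f := R) (toFinite (P.sideType s t '' {X | F X}))
  rw [huniv, ncard_univ, Nat.card_eq_fintype_card, Fintype.card_set, Fintype.card_fin] at h1
  exact absurd (hF s t hc hs) (not_lt.2 h1)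

lemma IsSimple.vcDim_le (hP : P.IsSimple) {𝒦 : Set (Set Plane)}
    (h𝒦 : ∀ K ∈ 𝒦, P.IsChord K) {F : Set Plane → Prop} {m : ℕ}
    (hF : ∀ s t : Fin (m + 1) → ℝ, (∀ k, P.IsChordParam (s k) (t k)) →
      (∀ k, s k ∈ Ico (0 : ℝ) n) → (P.sideType s t '' {X | F X}).ncard < 2 ^ (m + 1)) :
    (P.crossingRangeSpace 𝒦 F).vcDim ≤ m := by
  refine iSup₂_le fun A hA => ?_
  have := hP.encard_lt_of_shatters h𝒦 hF hA
  exact ENat.lt_natCast_add_one_iff.1 (by exact_mod_cast this)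

end Polygon

end

/-! ### Numerical comparison. -/

theorem mainTheorem4 {n : ℕ} [NeZero n] (P : Polygon Plane n) (hP : P.IsSimple)
    (𝒦 : Set (Set Plane)) (h𝒦 : ∀ K ∈ 𝒦, P.IsChord K) :
    (P.anchorRangeSpace 3 𝒦).vcDim < 259 ∧
      (P.anchorRangeSpace 4 𝒦).vcDim ≤ 372 ∧
      (P.cellRangeSpace 4 𝒦).vcDim ≤ 372 := by
  -- The types are counted for one chord more than the bound allows: below `2 ^ 118` types for `259`
  -- chords, and for `373` chords below `2 ^ 166` types of hulls and below `2 ^ 331` types of cells.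
  refine ⟨lt_of_le_of_lt (b := ((258 : ℕ) : ℕ∞)) ?_ (by norm_cast), ?_, ?_⟩
  · refine hP.vcDim_le h𝒦 fun s t h hs => (hP.ncard_anchorHullTypes_le h hs 3).trans_lt ?_
    set_option exponentiation.threshold 400 in
    norm_num [Polygon.pointTypeBound, Polygon.chainTypeBound]
  · refine hP.vcDim_le (m := 372) h𝒦 fun s t h hs =>
      (hP.ncard_anchorHullTypes_le h hs 4).trans_lt ?_
    set_option exponentiation.threshold 400 in
    norm_num [Polygon.pointTypeBound, Polygon.chainTypeBound]
  · refine hP.vcDim_le (m := 372) h𝒦 fun s t h hs => (hP.ncard_cellTypes_le h hs 4).trans_lt ?_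
    set_option exponentiation.threshold 400 in
    norm_num [Polygon.pointTypeBound, Polygon.chainTypeBound]
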